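/- Let $\widehat{\mathfrak g}$ be the affine Lie superalgebra $\widehat{osp}(1|2)$ over $\mathbb C$, with basis the modes $J^{\pm}_n, J^3_n$ (even), $j^{\pm}_n$ (odd), $n\in\mathbb Z$, a central element $K$ and a derivation $d$, and relations $\{j^+_r,j^-_s\}=2J^3_{r+s}+2r\delta_{r+s,0}K$, $\{j^\pm_r,j^\pm_s\}=\pm2J^\pm_{r+s}$, $[J^3_n,j^\pm_r]=\pm\frac12 j^\pm_{n+r}$, $[J^\pm_n,j^\mp_r]=-j^\pm_{n+r}$, $[J^+_n,J^-_m]=2J^3_{n+m}+n\delta_{n+m,0}K$, $[J^3_n,J^\pm_m]=\pm J^\pm_{n+m}$, $[J^3_n,J^3_m]=\frac n2\delta_{n+m,0}K$, $[d,a_n]=n\,a_n$ for every mode $a_n$, all other (anti)commutators being $0$. Let $U$ be its universal enveloping algebra and $f_0=\sqrt2\,j^-_0$ (odd), $f_1=J^+_{-1}$ (even). For $k,j\in\mathbb C$ let $M_{k,j}$ be the Verma module generated by a highest weight vector $v$ with $a_nv=0$ for all modes with $n>0$, $j^+_0v=0$, $J^3_0v=jv$, $Kv=kv$, $dv=0$.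 For $m,s\in\mathbb Z$ and $t=2k+3$ define $j_{m,s}$ by $4j_{m,s}+1=m-st$. A singular vector of isospin $j'$ is a nonzero vector killed by all modes $a_n$ with $n>0$ and by $j^+_0$ that is an eigenvector of $J^3_0,K,d$, with $J^3_0$-eigenvalue $j'$. Let $\widehat U$ be the associative unital algebra obtained from $U$ by adjoining symbols $g^\gamma$ ($\gamma\in\mathbb C$) for $g=f_0^2$ and for $g=f_1$, subject to $g^0=1$, $g^1=g$, $g^{\gamma+\delta}=g^\gamma g^\delta$ and, for all $x\in U$, the generalized commutator formula $$x\,g^\gamma=\sum_{n\ge0}\binom{\gamma}{n}g^{\gamma-n}\,[\cdots[[x,\underbrace{g],g],\cdots,g}_{n}]$$ (a finite sum, since iterated commutators with $g$ vanish eventually). In $\widehat U$ write $f_0^x:=f_0\,(f_0^2)^{(x-1)/2}$ for $x\in\mathbb C$. Theorem. The canonical map $U\to\widehat U$ is injective, so that $U$ is a subalgebra of $\widehat U$. Moreover, let $m,s\in\mathbb Z$ with $m+s$ odd. 1. Let $m>0$, $s\ge0$. For every $t\in\mathbb C$ the product of $2s+1$ factors $$F(m,s,t)=f_0^{m+st}\,f_1^{\frac12[m+(s-1)t]}\,f_0^{m+(s-2)t}\cdots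 f_1^{\frac12[m-(s-1)t]}\,f_0^{m-st}$$ lies in $U$. If $k\in\mathbb C$ and $t=2k+3\ne0$, then $F(m,s,t)\,v$ is a singular vector of isospin $j_{-m,s}$ in the Verma module $M_{k,j_{m,s}}$, where $v$ is the highest weight vector. 2. Let $m<0$, $s<0$. For every $t\in\mathbb C$ the product of $-2s-1$ factors $$G(m,s,t)=f_1^{-\frac12[m+(s+1)t]}\,f_0^{-[m+(s+2)t]}\,f_1^{-\frac12[m+(s+3)t]}\cdots f_0^{-[m-(s+2)t]}\,f_1^{-\frac12[m-(s+1)t]}$$ lies in $U$. If $k\in\mathbb C$ and $t=2k+3\neq0$, then $G(m,s,t)\,v$ is a singular vector of isospin $j_{-m,s}$ in $M_{k,j_{m,s}}$. In both cases the $d$-eigenvalue of the singular vector is $-ms/2$. -/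

import Mathlib

noncomputable section

namespace AffineOsp

/-- The homogeneous basis `J⁺, J⁻, J³` (even), `j⁺, j⁻` (odd) of the Lie superalgebra `osp(1|2)`. -/
inductive Osp12 : Type
  | Jplus | Jminus | Jthree | jplus | jminus
  deriving DecidableEq

open Osp12

instance : Fintype Osp12 where
  elems := {Jplus, Jminus, Jthree, jplus, jminus}
  complete x := by cases x <;> simp

/-- The `ℤ/2`-degree of a basis element: `true` means odd. -/
def Osp12.isOdd : Osp12 → Bool
  | jplus => true
  | jminus => true
  | _ => false

/-- The sign `(-1)^{deg a · deg b}`. -/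
def koszulSign (a b : Osp12) : ℂ := if a.isOdd && b.isOdd then -1 else 1

/-- Structure constants of `osp(1|2)`: the super bracket `[a, b]` is `∑ c, bracket a b c • c`. -/
def bracket : Osp12 → Osp12 → (Osp12 → ℂ)
  | Jplus, Jminus => Pi.single Jthree 2
  | Jminus, Jplus => Pi.single Jthree (-2)
  | Jthree, Jplus => Pi.single Jplus 1
  | Jplus, Jthree => Pi.single Jplus (-1)
  | Jthree, Jminus => Pi.single Jminus (-1)
  | Jminus, Jthree => Pi.single Jminus 1
  | Jthree, jplus => Pi.single jplus (1 / 2)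
  | jplus, Jthree => Pi.single jplus (-1 / 2)
  | Jthree, jminus => Pi.single jminus (-1 / 2)
  | jminus, Jthree => Pi.single jminus (1 / 2)
  | Jplus, jminus => Pi.single jplus (-1)
  | jminus, Jplus => Pi.single jplus 1
  | Jminus, jplus => Pi.single jminus (-1)
  | jplus, Jminus => Pi.single jminus 1
  | jplus, jminus => Pi.single Jthree 2
  | jminus, jplus => Pi.single Jthree 2
  | jplus, jplus => Pi.single Jplus 2
  | jminus, jminus => Pi.single Jminus (-2)
  | _, _ => 0

/-- The invariant supersymmetric bilinear form of `osp(1|2)` (the supertrace form of the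
three-dimensional representation) on basis elements. -/
def form : Osp12 → Osp12 → ℂ
  | Jplus, Jminus => 1
  | Jminus, Jplus => 1
  | Jthree, Jthree => 1 / 2
  | jplus, jminus => 2
  | jminus, jplus => -2
  | _, _ => 0

/-- Basis of affine `osp(1|2)`: the modes `a_n`, the central element `K` and the derivation `d`. -/
inductive Gen : Type
  | mode (a : Osp12) (n : ℤ)
  | K
  | d

/-- The defining relations of the enveloping algebra of affine `osp(1|2)`:
`[a_n, b_m] = [a, b]_{n+m} + n δ_{n+m,0} (a|b) K` with the super bracket on the left, `K` central,
and `[d, a_n] = n a_n`. -/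
inductive EnvRel : FreeAlgebra ℂ Gen → FreeAlgebra ℂ Gen → Prop
  | mode_mode (a b : Osp12) (n m : ℤ) :
      EnvRel
        (FreeAlgebra.ι ℂ (Gen.mode a n) * FreeAlgebra.ι ℂ (Gen.mode b m)
          - koszulSign a b • (FreeAlgebra.ι ℂ (Gen.mode b m) * FreeAlgebra.ι ℂ (Gen.mode a n)))
        ((∑ c : Osp12, bracket a b c • FreeAlgebra.ι ℂ (Gen.mode c (n + m)))
          + (if n + m = 0 then (n : ℂ) * form a b else 0) • FreeAlgebra.ι ℂ Gen.K)
  | K_central (x : Gen) :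
      EnvRel (FreeAlgebra.ι ℂ Gen.K * FreeAlgebra.ι ℂ x)
        (FreeAlgebra.ι ℂ x * FreeAlgebra.ι ℂ Gen.K)
  | d_mode (a : Osp12) (n : ℤ) :
      EnvRel
        (FreeAlgebra.ι ℂ Gen.d * FreeAlgebra.ι ℂ (Gen.mode a n)
          - FreeAlgebra.ι ℂ (Gen.mode a n) * FreeAlgebra.ι ℂ Gen.d)
        ((n : ℂ) • FreeAlgebra.ι ℂ (Gen.mode a n))

/-- The universal enveloping algebra of affine `osp(1|2)`. -/
abbrev Env : Type := RingQuot EnvRel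

/-- The image of a basis element in the enveloping algebra. -/
def gen (x : Gen) : Env := RingQuot.mkAlgHom ℂ EnvRel (FreeAlgebra.ι ℂ x)

/-- The mode `a_n` in the enveloping algebra. -/
def mode (a : Osp12) (n : ℤ) : Env := gen (Gen.mode a n)

/-- The odd Chevalley generator `f₀ = √2 j⁻_0`. -/
def f₀ : Env := ((Real.sqrt 2 : ℝ) : ℂ) • mode jminus 0

/-- The even Chevalley generator `f₁ = J⁺_{-1}`. -/
def f₁ : Env := mode Jplus (-1)

/-! ### Verma modules -/

/-- The left ideal of the enveloping algebra generated by `a_n` (`n > 0`), `j⁺_0`, `J³_0 - j`,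
`K - k` and `d`. -/
def vermaIdeal (k j : ℂ) : Submodule Env Env :=
  Submodule.span Env
    ({x | ∃ (a : Osp12) (n : ℤ), 0 < n ∧ x = mode a n} ∪
      {mode jplus 0, mode Jthree 0 - algebraMap ℂ Env j, gen Gen.K - algebraMap ℂ Env k,
        gen Gen.d})

/-- The Verma module of level `k` and isospin `j` (its highest weight vanishes on `d`). -/
abbrev Verma (k j : ℂ) : Type := Env ⧸ vermaIdeal k j

/-- The highest weight vector of the Verma module. -/
def hwv (k j : ℂ) : Verma k j := (vermaIdeal k j).mkQ 1

/-- `w` is a singular vector of level `k`, isospin `j` and `d`-eigenvalue `δ`: a nonzero weight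
vector annihilated by all `a_n` with `n > 0` and by `j⁺_0`. -/
def IsSingularVector {M : Type} [AddCommGroup M] [Module Env M] (k j δ : ℂ) (w : M) : Prop :=
  w ≠ 0 ∧ (∀ (a : Osp12) (n : ℤ), 0 < n → mode a n • w = 0) ∧ mode jplus 0 • w = 0 ∧
    mode Jthree 0 • w = algebraMap ℂ Env j • w ∧ gen Gen.K • w = algebraMap ℂ Env k • w ∧
    gen Gen.d • w = algebraMap ℂ Env δ • w

/-- `4 j_{m,s} + 1 = m - s t`, where `t = 2k + 3`. -/
def isospin (t : ℂ) (m s : ℤ) : ℂ := ((m : ℂ) - (s : ℂ) * t - 1) / 4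

/-! ### Complex powers -/

/-- The even elements whose complex powers are adjoined: `f₀²` for `0` and `f₁` for `1`. -/
def base (i : Fin 2) : Env := if i = 0 then f₀ ^ 2 else f₁

/-- The iterated commutator `[⋯[[x, g], g], ⋯, g]` with `n` entries `g`. -/
def iterComm (g x : Env) (n : ℕ) : Env := (fun y => y * g - g * y)^[n] x

/-- Generators of the algebra of complex powers: the elements of the enveloping algebra and the
symbols `(base i)^γ`. -/
inductive PowGen : Type
  | elt (x : Env)
  | pow (i : Fin 2) (γ : ℂ)

/-- Relations of the algebra of complex powers. The first three make it an algebra over the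
enveloping algebra, the next three are the laws of exponents, and the last one is the generalized
commutator formula `x g^γ = ∑_{n ≥ 0} (γ choose n) g^{γ-n} [⋯[[x, g], g], ⋯, g]`, a finite sum
because iterated commutators with `g = base i` vanish eventually. -/
inductive PowRel : FreeAlgebra ℂ PowGen → FreeAlgebra ℂ PowGen → Prop
  | elt_add (x y : Env) :
      PowRel (FreeAlgebra.ι ℂ (PowGen.elt (x + y)))
        (FreeAlgebra.ι ℂ (PowGen.elt x) + FreeAlgebra.ι ℂ (PowGen.elt y))
  | elt_mul (x y : Env) :
      PowRel (FreeAlgebra.ι ℂ (PowGen.elt (x * y)))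
        (FreeAlgebra.ι ℂ (PowGen.elt x) * FreeAlgebra.ι ℂ (PowGen.elt y))
  | elt_scalar (c : ℂ) :
      PowRel (FreeAlgebra.ι ℂ (PowGen.elt (algebraMap ℂ Env c))) (algebraMap ℂ _ c)
  | pow_zero (i : Fin 2) : PowRel (FreeAlgebra.ι ℂ (PowGen.pow i 0)) 1
  | pow_one (i : Fin 2) :
      PowRel (FreeAlgebra.ι ℂ (PowGen.pow i 1)) (FreeAlgebra.ι ℂ (PowGen.elt (base i)))
  | pow_add (i : Fin 2) (γ δ : ℂ) :
      PowRel (FreeAlgebra.ι ℂ (PowGen.pow i (γ + δ)))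
        (FreeAlgebra.ι ℂ (PowGen.pow i γ) * FreeAlgebra.ι ℂ (PowGen.pow i δ))
  | commutator (i : Fin 2) (γ : ℂ) (x : Env) (N : ℕ) (hN : iterComm (base i) x N = 0) :
      PowRel (FreeAlgebra.ι ℂ (PowGen.elt x) * FreeAlgebra.ι ℂ (PowGen.pow i γ))
        (∑ n ∈ Finset.range N, Ring.choose γ n •
          (FreeAlgebra.ι ℂ (PowGen.pow i (γ - n)) *
            FreeAlgebra.ι ℂ (PowGen.elt (iterComm (base i) x n))))

/-- The algebra obtained from the enveloping algebra by adjoining all complex powers of `f₀²` and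
of `f₁`, subject to the laws of exponents and the generalized commutator formula. -/
abbrev PowAlg : Type := RingQuot PowRel

/-- The power `(base i)^γ`. -/
def cpow (i : Fin 2) (γ : ℂ) : PowAlg :=
  RingQuot.mkAlgHom ℂ PowRel (FreeAlgebra.ι ℂ (PowGen.pow i γ))

/-- The canonical homomorphism from the enveloping algebra to the algebra of complex powers. -/
def toPow : Env →ₐ[ℂ] PowAlg where
  toFun x := RingQuot.mkAlgHom ℂ PowRel (FreeAlgebra.ι ℂ (PowGen.elt x))
  map_one' := by
    have h := RingQuot.mkAlgHom_rel ℂ (PowRel.elt_scalar 1)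
    simpa using h
  map_mul' x y := by
    have h := RingQuot.mkAlgHom_rel ℂ (PowRel.elt_mul x y)
    simpa using h
  map_zero' := by
    have h := RingQuot.mkAlgHom_rel ℂ (PowRel.elt_scalar 0)
    simpa using h
  map_add' x y := by
    have h := RingQuot.mkAlgHom_rel ℂ (PowRel.elt_add x y)
    simpa using h
  commutes' c := by
    have h := RingQuot.mkAlgHom_rel ℂ (PowRel.elt_scalar c)
    rw [h, AlgHom.commutes]

/-- The factor `f₀^x`, understood as `f₀ (f₀²)^{(x-1)/2}`. -/
def f₀pow (x : ℂ) : PowAlg := toPow f₀ * cpow 0 ((x - 1) / 2)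

/-- The factor `f₁^x`. -/
def f₁pow (x : ℂ) : PowAlg := cpow 1 x

/-- For `s ≥ 0`, the product
`f₀^{m+st} f₁^{[m+(s-1)t]/2} f₀^{m+(s-2)t} ⋯ f₁^{[m-(s-1)t]/2} f₀^{m-st}`
with `2s + 1` factors. -/
def mffPos (m s : ℤ) (t : ℂ) : PowAlg :=
  ((List.range (2 * s.toNat + 1)).map fun i : ℕ =>
    if Even i then f₀pow ((m : ℂ) + ((s : ℂ) - (i : ℂ)) * t)
    else f₁pow (((m : ℂ) + ((s : ℂ) - (i : ℂ)) * t) / 2)).prod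

/-- For `s < 0`, the product
`f₁^{-[m+(s+1)t]/2} f₀^{-[m+(s+2)t]} f₁^{-[m+(s+3)t]/2} ⋯ f₀^{-[m-(s+2)t]} f₁^{-[m-(s+1)t]/2}`
with `-2s - 1` factors. -/
def mffNeg (m s : ℤ) (t : ℂ) : PowAlg :=
  ((List.range (-2 * s - 1).toNat).map fun i : ℕ =>
    if Even i then f₁pow (-((m : ℂ) + ((s : ℂ) + 1 + (i : ℂ)) * t) / 2)
    else f₀pow (-((m : ℂ) + ((s : ℂ) + 1 + (i : ℂ)) * t))).prod

end AffineOsp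

end

/-! ### Lie superalgebras given by structure constants -/

noncomputable section
namespace AffineOsp
open Finsupp (linearCombination)
open scoped TensorProduct

/-! This is the Malikov–Feigin–Fuchs construction, carried out inside the algebra of complex powers.
No PBW basis is used: every independence statement comes from an explicit induced module.

Injectivity. If `f₀²` and `f₁` act on a `U`-module as nonzero multiples `c (1 + ν)` with `ν` locally
nilpotent, then `c^γ (1 + ν)^γ`, defined by the binomial series, extends the action to the algebra
of complex powers: each required identity is polynomial in `γ` and holds for natural `γ`
(`exists_powRep`). Such modules are obtained by deforming left multiplication of `𝔫₋` on `U(𝔫₋)` by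
a parameter `z`: `f₁` receives a scalar `z` and `j⁻_0` receives `z` times the parity operator, while
a shift operator makes the remaining part locally nilpotent. The result is induced to `U`. An
element that dies in the algebra of complex powers acts by zero for every `z ≠ 0`. The action is
polynomial in `z`, hence it also vanishes at `z = 0`, where left multiplication is recovered
(`eq_zero_of_twistHom`, `toPow_injective`).

Singularity. Each product arises from a shorter one `Y` by wrapping it as `f_i^p Y f_i^q`. The
exponent `q` is the one for which `f_i^q v` is formally singular; it moves `v` to a vector of the
weight at which `Y` is singular, and `p` plays the same role after `Y`. Written as operators, this
gives relations `e_i F = η F e_i + a (h_i - l)`, which propagate through the wrapping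
(`mul_sandwich_even`, `mul_sandwich_odd`, `mul_sandwich_of_commute`).

Integrality. The sum of the outer exponents does not depend on `t`, so after the powers are moved to
one side only integral powers remain, and `F(t)` is a polynomial family in a localization of `U(𝔫₋)`
at `f_i`. Negative powers are removed one at a time: if `f_i^(N+1) F` lies in `U(𝔫₋)`, commuting it
with `e_i` produces a scalar multiple of `f_i^N F`, and the scalar is nonzero for non-real `t`
(`ChevalleyPair.descend`). A polynomial family lying in a subspace for infinitely many `t` lies in
it for all `t`. The induction on the number of factors is `singularFamily_mff`.

The vector `F(t) v` is nonzero because `F(t)` is a product of units in the algebra of complex powers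
and `U(𝔫₋)` acts freely on the highest weight vector; it is killed by all positive modes because
`j⁺_0` and `J⁻_1` generate them. -/

/-- The Koszul sign of two parities. -/
def paritySign (a b : Bool) : ℂ := if a && b then -1 else 1

/-- A Lie superalgebra over `ℂ`, given by structure constants on a homogeneous basis `ι`. -/
structure SuperBracket (ι : Type) where
  odd : ι → Bool
  br : ι → ι → ι →₀ ℂ
  odd_of_mem : ∀ x y u, u ∈ (br x y).support → odd u = xor (odd x) (odd y)
  skew : ∀ x y, br x y = -(paritySign (odd x) (odd y) • br y x)
  jacobi : ∀ x a b, linearCombination ℂ (fun u => br u b) (br x a)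
    - paritySign (odd a) (odd b) • linearCombination ℂ (fun u => br u a) (br x b)
    = linearCombination ℂ (br x) (br a b)

section Lc

variable {ι M : Type} [AddCommGroup M] [Module ℂ M]

theorem linearCombination_congr {f g : ι → M} {c : ι →₀ ℂ} (h : ∀ u ∈ c.support, f u = g u) :
    linearCombination ℂ f c = linearCombination ℂ g c := by
  rw [Finsupp.linearCombination_apply, Finsupp.linearCombination_apply]
  exact Finset.sum_congr rfl fun u hu => by simp only [h u hu]

theorem linearCombination_fun_add (f g : ι → M) (c : ι →₀ ℂ) :
    linearCombination ℂ (fun u => f u + g u) c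
      = linearCombination ℂ f c + linearCombination ℂ g c := by
  simp [Finsupp.linearCombination_apply, Finsupp.sum_add]

theorem linearCombination_fun_map {N : Type} [AddCommGroup N] [Module ℂ N] (F : M →ₗ[ℂ] N)
    (f : ι → M) (c : ι →₀ ℂ) :
    linearCombination ℂ (fun u => F (f u)) c = F (linearCombination ℂ f c) :=
  (Finsupp.apply_linearCombination ℂ F f c).symm

theorem linearCombination_mem {f : ι → M} {c : ι →₀ ℂ} {W : Submodule ℂ M}
    (h : ∀ u ∈ c.support, f u ∈ W) : linearCombination ℂ f c ∈ W := by
  rw [Finsupp.linearCombination_apply]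
  exact Submodule.sum_mem _ fun u hu => W.smul_mem _ (h u hu)

theorem linearCombination_mul_right {A : Type} [Ring A] [Algebra ℂ A] (f : ι → A) (c : ι →₀ ℂ)
    (a : A) : linearCombination ℂ f c * a = linearCombination ℂ (fun u => f u * a) c :=
  (linearCombination_fun_map (LinearMap.mulRight ℂ a) f c).symm

theorem linearCombination_end_apply (f : ι → Module.End ℂ M) (c : ι →₀ ℂ) (m : M) :
    linearCombination ℂ f c m = linearCombination ℂ (fun u => f u m) c :=
  (linearCombination_fun_map (LinearMap.applyₗ m) f c).symm

end Lc

/-! ### Enveloping algebras of subalgebras spanned by basis elements -/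

namespace SuperBracket

variable {ι : Type} (B : SuperBracket ι)

/-- The Koszul sign of two basis elements. -/
def ε (x y : ι) : ℂ := paritySign (B.odd x) (B.odd y)

theorem ε_comm (x y : ι) : B.ε x y = B.ε y x := by simp [ε, paritySign, Bool.and_comm]

theorem ε_mul_self (x y : ι) : B.ε x y * B.ε x y = 1 := by
  unfold ε paritySign; split_ifs <;> norm_num

theorem ε_left {x y u : ι} (h : u ∈ (B.br x y).support) (z : ι) :
    B.ε u z = B.ε x z * B.ε y z := by
  unfold ε
  rw [B.odd_of_mem x y u h]
  cases B.odd x <;> cases B.odd y <;> cases B.odd z <;> simp [paritySign]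

theorem ε_right {x y u : ι} (h : u ∈ (B.br x y).support) (z : ι) :
    B.ε z u = B.ε z x * B.ε z y := by
  rw [B.ε_comm, B.ε_left h, B.ε_comm x, B.ε_comm y]

/-- A family of basis elements spanning a subalgebra. -/
def Closed (S : ι → Prop) : Prop := ∀ x y, S x → S y → ∀ u ∈ (B.br x y).support, S u

/-- Operators indexed by `ι` that represent the span of `S`. -/
def IsRep (S : ι → Prop) {A : Type} [Ring A] [Algebra ℂ A] (f : ι → A) : Prop :=
  ∀ x y, S x → S y → f x * f y - B.ε x y • (f y * f x) = linearCombination ℂ f (B.br x y)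

/-- The relations of the enveloping algebra of the span of `S`; generators outside `S` vanish. -/
inductive EnvOfRel (S : ι → Prop) : FreeAlgebra ℂ ι → FreeAlgebra ℂ ι → Prop
  | bracket (x y : ι) (hx : S x) (hy : S y) :
      EnvOfRel S
        (FreeAlgebra.ι ℂ x * FreeAlgebra.ι ℂ y - B.ε x y • (FreeAlgebra.ι ℂ y * FreeAlgebra.ι ℂ x))
        (linearCombination ℂ (FreeAlgebra.ι ℂ) (B.br x y))
  | outside (x : ι) (hx : ¬ S x) : EnvOfRel S (FreeAlgebra.ι ℂ x) 0

/-- The enveloping algebra of the span of `S`. -/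
abbrev EnvOf (S : ι → Prop) : Type := RingQuot (B.EnvOfRel S)

variable (S : ι → Prop)

/-- The generators of the enveloping algebra of the span of `S`. -/
def of (x : ι) : B.EnvOf S := RingQuot.mkAlgHom ℂ (B.EnvOfRel S) (FreeAlgebra.ι ℂ x)

variable {S}

theorem of_eq_zero {x : ι} (hx : ¬ S x) : B.of S x = 0 := by
  simpa [of] using RingQuot.mkAlgHom_rel ℂ (EnvOfRel.outside (B := B) x hx)

theorem isRep_of : B.IsRep S (B.of S) := by
  intro x y hx hy
  have h := RingQuot.mkAlgHom_rel ℂ (EnvOfRel.bracket (B := B) x y hx hy)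
  rw [map_sub, map_smul, map_mul, map_mul] at h
  exact h.trans (Finsupp.apply_linearCombination ℂ
    (RingQuot.mkAlgHom ℂ (B.EnvOfRel S)).toLinearMap _ _)

/-- The universal property of the enveloping algebra. -/
def liftEnv {A : Type} [Ring A] [Algebra ℂ A] (f : ι → A) (h : B.IsRep S f)
    (h0 : ∀ x, ¬ S x → f x = 0) : B.EnvOf S →ₐ[ℂ] A :=
  RingQuot.liftAlgHom ℂ ⟨FreeAlgebra.lift ℂ f, by
    intro u v huv
    induction huv with
    | bracket x y hx hy =>
      rw [map_sub, map_smul, map_mul, map_mul, FreeAlgebra.lift_ι_apply, FreeAlgebra.lift_ι_apply,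
        h x y hx hy]
      refine ((Finsupp.apply_linearCombination ℂ (FreeAlgebra.lift ℂ f).toLinearMap _ _).trans
        ?_).symm
      exact linearCombination_congr fun u _ => FreeAlgebra.lift_ι_apply f u
    | outside x hx => simp [h0 x hx]⟩

@[simp]
theorem liftEnv_of {A : Type} [Ring A] [Algebra ℂ A] (f : ι → A) (h : B.IsRep S f)
    (h0 : ∀ x, ¬ S x → f x = 0) (x : ι) : B.liftEnv f h h0 (B.of S x) = f x := by
  simp [liftEnv, of]

theorem envOf_induction {P : B.EnvOf S → Prop} (one : P 1) (add : ∀ a b, P a → P b → P (a + b))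
    (smul : ∀ (c : ℂ) a, P a → P (c • a)) (mul : ∀ x a, S x → P a → P (B.of S x * a))
    (w : B.EnvOf S) : P w := by
  obtain ⟨w, rfl⟩ := RingQuot.mkAlgHom_surjective ℂ (B.EnvOfRel S) w
  -- Products are handled by letting an arbitrary right factor accumulate, so that only left
  -- multiplication by generators has to preserve `P`.
  suffices H : ∀ a, P a → P (RingQuot.mkAlgHom ℂ (B.EnvOfRel S) w * a) by simpa using H 1 one
  induction w using FreeAlgebra.induction with
  | grade0 r =>
    intro a ha
    rw [AlgHom.commutes, ← Algebra.smul_def]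
    exact smul r a ha
  | grade1 x =>
    intro a ha
    by_cases hx : S x
    · exact mul x a hx ha
    · have : RingQuot.mkAlgHom ℂ (B.EnvOfRel S) (FreeAlgebra.ι ℂ x) = 0 := B.of_eq_zero hx
      rw [this, zero_mul]
      simpa using smul 0 1 one
  | mul p q hp hq => intro a ha; rw [map_mul, mul_assoc]; exact hp _ (hq _ ha)
  | add p q hp hq => intro a ha; rw [map_add, add_mul]; exact add _ _ (hp _ ha) (hq _ ha)

/-! ### The action of `U(S)` on families `x ↦ x • m` -/

section Coinduced

variable {M : Type} [AddCommGroup M] [Module ℂ M] (lam : B.EnvOf S →ₐ[ℂ] Module.End ℂ M)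

/-- How the values `θ x = x • m` change when `m` is replaced by `a • m`. -/
def coinducedOp (a : ι) : Module.End ℂ (ι → M) where
  toFun θ x := B.ε x a • lam (B.of S a) (θ x) + linearCombination ℂ θ (B.br x a)
  map_add' θ η := by
    funext x
    have := linearCombination_fun_add θ η (B.br x a)
    simp only [Pi.add_apply, map_add, smul_add]
    rw [show (θ + η) = fun u => θ u + η u from rfl, this]
    abel
  map_smul' c θ := by
    funext x
    have := linearCombination_fun_map (c • (LinearMap.id : M →ₗ[ℂ] M)) θ (B.br x a)
    simp only [Pi.smul_apply, map_smul, RingHom.id_apply, smul_add]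
    rw [show (c • θ) = fun u => (c • (LinearMap.id : M →ₗ[ℂ] M)) (θ u) from rfl, this,
      smul_comm c]
    rfl

theorem coinducedOp_apply (a : ι) (θ : ι → M) (x : ι) : B.coinducedOp lam a θ x
    = B.ε x a • lam (B.of S a) (θ x) + linearCombination ℂ θ (B.br x a) := rfl

theorem coinducedOp_coinducedOp (a b : ι) (θ : ι → M) (x : ι) :
    B.coinducedOp lam a (B.coinducedOp lam b θ) x
      = (B.ε x a * B.ε x b) • lam (B.of S a) (lam (B.of S b) (θ x))
        + B.ε x a • lam (B.of S a) (linearCombination ℂ θ (B.br x b))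
        + (B.ε x b * B.ε a b) • lam (B.of S b) (linearCombination ℂ θ (B.br x a))
        + linearCombination ℂ θ (linearCombination ℂ (fun u => B.br u b) (B.br x a)) := by
  rw [coinducedOp_apply, coinducedOp_apply]
  have h1 : linearCombination ℂ (B.coinducedOp lam b θ) (B.br x a)
      = linearCombination ℂ (fun u => ((B.ε x b * B.ε a b) • lam (B.of S b)) (θ u)
        + linearCombination ℂ θ (B.br u b)) (B.br x a) :=
    linearCombination_congr fun u hu => by
      rw [coinducedOp_apply, B.ε_left hu, LinearMap.smul_apply]
  rw [h1, linearCombination_fun_add, linearCombination_fun_map, linearCombination_fun_map,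
    map_add, map_smul, LinearMap.smul_apply]
  module

-- The operators encode the rule `x (a m) = ±a (x m) + [x, a] m`. Compatibility with `[a, b]` is the
-- super Jacobi identity for `x, a, b`, together with multiplicativity of the Koszul sign over
-- brackets. Hence the action of all basis elements can be transported consistently along words in
-- `S`, which makes the induced action well defined on `U(S) ⊗ V`.
open Classical in
theorem isRep_coinducedOp (hS : B.Closed S) :
    B.IsRep S (fun a => if S a then B.coinducedOp lam a else 0) := by
  intro a b ha hb
  have hc : linearCombination ℂ (fun a => if S a then B.coinducedOp lam a else 0) (B.br a b)
      = linearCombination ℂ (B.coinducedOp lam) (B.br a b) :=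
    linearCombination_congr fun u hu => if_pos (hS a b ha hb u hu)
  rw [hc]
  simp only [if_pos ha, if_pos hb]
  refine LinearMap.ext fun θ => funext fun x => ?_
  have key : linearCombination ℂ (B.coinducedOp lam) (B.br a b) θ x
      = (B.ε x a * B.ε x b) • lam (linearCombination ℂ (B.of S) (B.br a b)) (θ x)
        + linearCombination ℂ θ (linearCombination ℂ (B.br x) (B.br a b)) := by
    rw [linearCombination_end_apply,
      show ∀ c : ι →₀ ℂ, (linearCombination ℂ (fun u => B.coinducedOp lam u θ) c) x
        = linearCombination ℂ (fun u => B.coinducedOp lam u θ x) c from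
        fun c => (linearCombination_fun_map (LinearMap.proj (R := ℂ) (φ := fun _ : ι => M) x) _ c).symm]
    have h1 : linearCombination ℂ (fun u => B.coinducedOp lam u θ x) (B.br a b)
        = linearCombination ℂ (fun u => (B.ε x a * B.ε x b) • lam (B.of S u) (θ x)
          + linearCombination ℂ θ (B.br x u)) (B.br a b) :=
      linearCombination_congr fun u hu => by rw [coinducedOp_apply, B.ε_right hu]
    rw [h1, linearCombination_fun_add, linearCombination_fun_map]
    congr 1
    exact linearCombination_fun_map
      ((B.ε x a * B.ε x b) • (LinearMap.applyₗ (θ x)).comp lam.toLinearMap) (B.of S) (B.br a b)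
  rw [key, ← B.isRep_of a b ha hb, ← B.jacobi]
  have h2 : (B.coinducedOp lam a * B.coinducedOp lam b
        - B.ε a b • (B.coinducedOp lam b * B.coinducedOp lam a)) θ x
      = B.coinducedOp lam a (B.coinducedOp lam b θ) x
        - B.ε a b • B.coinducedOp lam b (B.coinducedOp lam a θ) x := rfl
  rw [h2, coinducedOp_coinducedOp, coinducedOp_coinducedOp]
  simp only [map_sub, map_smul, map_mul, LinearMap.sub_apply, LinearMap.smul_apply,
    Module.End.mul_apply, B.ε_comm b a]
  rw [show paritySign (B.odd a) (B.odd b) = B.ε a b from rfl]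
  have e := B.ε_mul_self a b
  linear_combination (norm := module) ((-(B.ε x a)) * e) • lam (B.of S a) (linearCombination ℂ θ (B.br x b))

end Coinduced

/-! ### Induced modules on `U(S) ⊗ V` -/

section Induced

variable {V : Type} [AddCommGroup V] [Module ℂ V]

variable (S V) in
/-- The vector space `U(S) ⊗ V`. -/
def IndMod : Type := B.EnvOf S ⊗[ℂ] V

instance : AddCommGroup (B.IndMod S V) := inferInstanceAs (AddCommGroup (B.EnvOf S ⊗[ℂ] V))

instance : Module ℂ (B.IndMod S V) := inferInstanceAs (Module ℂ (B.EnvOf S ⊗[ℂ] V))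

/-- The pure tensors of `U(S) ⊗ V`. -/
def tens : B.EnvOf S →ₗ[ℂ] V →ₗ[ℂ] B.IndMod S V := TensorProduct.mk ℂ (B.EnvOf S) V

variable {B} in
/-- Linear maps out of `U(S) ⊗ V`. -/
def IndMod.lift {M : Type} [AddCommGroup M] [Module ℂ M] (f : B.EnvOf S →ₗ[ℂ] V →ₗ[ℂ] M) :
    B.IndMod S V →ₗ[ℂ] M := (TensorProduct.lift f : B.EnvOf S ⊗[ℂ] V →ₗ[ℂ] M)

@[simp]
theorem IndMod.lift_tens {M : Type} [AddCommGroup M] [Module ℂ M]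
    (f : B.EnvOf S →ₗ[ℂ] V →ₗ[ℂ] M) (w : B.EnvOf S) (v : V) :
    IndMod.lift f (B.tens w v) = f w v := TensorProduct.lift.tmul w v

variable {B} in
theorem IndMod.hom_ext {M : Type} [AddCommGroup M] [Module ℂ M] {f g : B.IndMod S V →ₗ[ℂ] M}
    (h : ∀ w v, f (B.tens w v) = g (B.tens w v)) : f = g :=
  TensorProduct.ext' (M := B.EnvOf S) (N := V) h

variable {B} in
theorem IndMod.span_tens (W : Submodule ℂ (B.IndMod S V)) (h : ∀ w v, B.tens w v ∈ W) : W = ⊤ := by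
  have h1 : W.mkQ = 0 := IndMod.hom_ext fun w v => by simpa using h w v
  rw [← W.ker_mkQ, h1, LinearMap.ker_zero]

/-- Left multiplication on `U(S) ⊗ V`. -/
def leftMul : B.EnvOf S →ₐ[ℂ] Module.End ℂ (B.IndMod S V) :=
  AlgHom.ofLinearMap
    (LinearMap.mk₂ ℂ (fun a m => IndMod.lift (B.tens.comp (LinearMap.mulLeft ℂ a)) m)
      (fun a b m => by
        rw [← LinearMap.add_apply]
        exact DFunLike.congr_fun (IndMod.hom_ext fun w v => by simp [add_mul]) m)
      (fun c a m => by
        rw [← LinearMap.smul_apply]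
        exact DFunLike.congr_fun (IndMod.hom_ext fun w v => by simp) m)
      (fun a m n => map_add _ _ _) (fun c a m => map_smul _ _ _))
    (IndMod.hom_ext fun w v => by simp) (fun a b => IndMod.hom_ext fun w v => by simp)

@[simp]
theorem leftMul_tens (a b : B.EnvOf S) (v : V) :
    B.leftMul a (B.tens b v) = B.tens (a * b) v := by
  simp [leftMul]

variable (τ : ι → Module.End ℂ V)

open Classical in
/-- The action of all basis elements on `1 ⊗ v`. -/
def inducedBase : V →ₗ[ℂ] (ι → B.IndMod S V) :=
  LinearMap.pi fun x =>
    if S x then B.tens (B.of S x) else (B.tens 1).comp (τ x)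

variable (hS : B.Closed S)

open Classical in
/-- The action of `U(S)` on families of actions of basis elements on an element of `U(S) ⊗ V`. -/
def coinducedHom (hS : B.Closed S) :
    B.EnvOf S →ₐ[ℂ] Module.End ℂ (ι → B.IndMod S V) :=
  B.liftEnv _ (B.isRep_coinducedOp (M := B.IndMod S V) B.leftMul hS) (fun _ h => if_neg h)

theorem coinducedHom_of {x : ι} (hx : S x) (θ : ι → B.IndMod S V) (y : ι) :
    B.coinducedHom hS (B.of S x) θ y = B.ε y x • B.leftMul (B.of S x) (θ y)
      + linearCombination ℂ θ (B.br y x) := by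
  rw [coinducedHom, liftEnv_of, if_pos hx, coinducedOp_apply]

/-- The action of basis elements on the module `U(S) ⊗ V` induced from the complement of `S`. -/
def induced (x : ι) : Module.End ℂ (B.IndMod S V) :=
  IndMod.lift (LinearMap.mk₂ ℂ (fun w v => B.coinducedHom hS w (B.inducedBase τ v) x)
    (fun a b v => by rw [map_add]; rfl) (fun c a v => by rw [map_smul]; rfl)
    (fun a v w => by rw [map_add, map_add]; rfl) (fun c a v => by rw [map_smul, map_smul]; rfl))

theorem induced_tens (x : ι) (w : B.EnvOf S) (v : V) :
    B.induced τ hS x (B.tens w v) = B.coinducedHom hS w (B.inducedBase τ v) x := by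
  simp [induced]

theorem induced_one_tens (x : ι) (v : V) :
    B.induced τ hS x (B.tens 1 v) = B.inducedBase τ v x := by
  rw [induced_tens, map_one]; rfl

theorem induced_of_mul_tens (x a : ι) (ha : S a) (w : B.EnvOf S) (v : V) :
    B.induced τ hS x (B.tens (B.of S a * w) v)
      = B.ε x a • B.leftMul (B.of S a) (B.induced τ hS x (B.tens w v))
        + linearCombination ℂ (B.induced τ hS) (B.br x a) (B.tens w v) := by
  rw [induced_tens, map_mul, Module.End.mul_apply, coinducedHom_of B hS ha,
    linearCombination_end_apply]
  rfl

/-- The construction imposes left multiplication only on `1 ⊗ v`. It persists on longer words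
because commuting `x` past a letter `a` of `S` leaves `[x, a]` in the span of `S`, where the
induction hypothesis applies. -/
theorem induced_eq_leftMul (x : ι) (hx : S x) :
    B.induced τ hS x = B.leftMul (B.of S x) := by
  classical
  refine IndMod.hom_ext fun w v => ?_
  induction w using B.envOf_induction generalizing x with
  | one => rw [induced_one_tens]; simp [inducedBase, hx]
  | add a b ha hb => rw [map_add, LinearMap.add_apply, map_add, map_add, ha x hx, hb x hx]
  | smul c a ha => rw [map_smul, LinearMap.smul_apply, map_smul, map_smul, ha x hx]
  | mul a w haS ih =>
    rw [induced_of_mul_tens _ _ _ _ _ haS, ih x hx, linearCombination_end_apply,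
      linearCombination_congr (g := fun u => B.leftMul (B.of S u) (B.tens w v))
        fun u hu => ih u (hS x a hx haS u hu)]
    simp only [leftMul_tens]
    have h := B.isRep_of x a hx haS
    have h2 : linearCombination ℂ (fun u => B.tens (B.of S u * w) v) (B.br x a)
        = B.tens (linearCombination ℂ (B.of S) (B.br x a) * w) v := by
      rw [linearCombination_mul_right]
      exact linearCombination_fun_map (B.tens.flip v) _ _
    rw [h2, ← h]
    simp [sub_mul, mul_assoc]

/-- The Koszul commutator of two operators minus the operator of the bracket. -/
def defect (x y : ι) : Module.End ℂ (B.IndMod S V) :=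
  B.induced τ hS x * B.induced τ hS y - B.ε x y • (B.induced τ hS y * B.induced τ hS x)
    - linearCombination ℂ (B.induced τ hS) (B.br x y)

theorem defect_swap (x y : ι) : B.defect τ hS y x = -(B.ε x y • B.defect τ hS x y) := by
  unfold defect
  rw [B.skew y x, show paritySign (B.odd y) (B.odd x) = B.ε y x from rfl, B.ε_comm y x, map_neg,
    map_smul]
  have e := B.ε_mul_self x y
  linear_combination (norm := module) (-e) • (B.induced τ hS y * B.induced τ hS x)

theorem induced_mul_apply (x a : ι) (ha : S a) (m : B.IndMod S V) :
    B.induced τ hS x (B.leftMul (B.of S a) m)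
      = B.ε x a • B.leftMul (B.of S a) (B.induced τ hS x m)
        + linearCombination ℂ (B.induced τ hS) (B.br x a) m := by
  suffices H : (B.induced τ hS x).comp (B.leftMul (B.of S a))
      = B.ε x a • (B.leftMul (B.of S a)).comp (B.induced τ hS x)
        + linearCombination ℂ (B.induced τ hS) (B.br x a) from DFunLike.congr_fun H m
  exact IndMod.hom_ext fun w v => by
    simpa using B.induced_of_mul_tens τ hS x a ha w v

theorem linearCombination_induced_mul_apply (x y a : ι) (ha : S a) (m : B.IndMod S V) :
    linearCombination ℂ (B.induced τ hS) (B.br x y) (B.leftMul (B.of S a) m)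
      = (B.ε x a * B.ε y a) • B.leftMul (B.of S a)
          (linearCombination ℂ (B.induced τ hS) (B.br x y) m)
        + linearCombination ℂ (B.induced τ hS)
          (linearCombination ℂ (fun u => B.br u a) (B.br x y)) m := by
  rw [linearCombination_end_apply, linearCombination_congr (fun u hu =>
    (B.induced_mul_apply τ hS u a ha m).trans (by rw [B.ε_left hu])), linearCombination_fun_add]
  congr 1
  · rw [linearCombination_end_apply]
    exact linearCombination_fun_map ((B.ε x a * B.ε y a) • B.leftMul (B.of S a)) _ _
  · exact linearCombination_fun_map
      ((LinearMap.applyₗ m).comp (linearCombination ℂ (B.induced τ hS))) _ _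

/-- For `y` in `S` the commutation rule of `induced_mul_apply` is already the bracket relation,
since `y` acts by left multiplication. -/
theorem defect_of_right {x y : ι} (hy : S y) : B.defect τ hS x y = 0 := by
  refine LinearMap.ext fun m => ?_
  rw [defect, B.induced_eq_leftMul τ hS y hy]
  simp [B.induced_mul_apply τ hS x y hy m]

theorem defect_apply (x y : ι) (m : B.IndMod S V) : B.defect τ hS x y m
    = B.induced τ hS x (B.induced τ hS y m) - B.ε x y • B.induced τ hS y (B.induced τ hS x m)
      - linearCombination ℂ (B.induced τ hS) (B.br x y) m := rfl

theorem linearCombination_defect (c : ι →₀ ℂ) (y : ι) (e : ℂ) (hc : ∀ u ∈ c.support, B.ε u y = e)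
    (m : B.IndMod S V) (h : ∀ u, B.defect τ hS u y m = 0) :
    linearCombination ℂ (B.induced τ hS) c (B.induced τ hS y m)
      = e • B.induced τ hS y (linearCombination ℂ (B.induced τ hS) c m)
        + linearCombination ℂ (B.induced τ hS) (linearCombination ℂ (fun u => B.br u y) c) m := by
  rw [linearCombination_end_apply, linearCombination_congr (g := fun u =>
    (e • B.induced τ hS y) (B.induced τ hS u m)
      + linearCombination ℂ (B.induced τ hS) (B.br u y) m) (fun u hu => ?_),
    linearCombination_fun_add]
  · congr 1
    · rw [linearCombination_end_apply]
      exact linearCombination_fun_map (e • B.induced τ hS y) _ _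
    · exact linearCombination_fun_map
        ((LinearMap.applyₗ m).comp (linearCombination ℂ (B.induced τ hS))) _ _
  · have := h u
    rw [defect_apply, hc u hu] at this
    rw [LinearMap.smul_apply]
    linear_combination (norm := module) this

/-- Commuting `a` to the left turns the defect of `(x, y)` at `a m` into `±a` times the defect at
`m`, plus defects of `([x, a], y)` and `(x, [y, a])` at `m`. What is left over cancels by Jacobi.
All pairs must be assumed at `m`, because the brackets bring in new basis elements. -/
theorem defect_mul_apply (x y a : ι) (ha : S a) (m : B.IndMod S V)
    (h : ∀ u v, B.defect τ hS u v m = 0) :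
    B.defect τ hS x y (B.leftMul (B.of S a) m) = 0 := by
  rw [defect_apply, B.linearCombination_induced_mul_apply τ hS x y a ha,
    B.induced_mul_apply τ hS y a ha, B.induced_mul_apply τ hS x a ha]
  simp only [map_add, map_smul, B.induced_mul_apply τ hS _ a ha]
  rw [B.linearCombination_defect τ hS (B.br x a) y _ (fun u hu => B.ε_left hu y) m (fun u => h u y),
    B.linearCombination_defect τ hS (B.br y a) x _ (fun u hu => B.ε_left hu x) m (fun u => h u x)]
  have hj := congrArg (fun c => linearCombination ℂ (B.induced τ hS) c m) (B.jacobi x y a)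
  have hs : linearCombination ℂ (fun u => B.br u x) (B.br y a)
      = -((B.ε y x * B.ε a x) • linearCombination ℂ (B.br x) (B.br y a)) := by
    rw [linearCombination_congr (g := fun u => (-(B.ε y x * B.ε a x) • LinearMap.id :
      (ι →₀ ℂ) →ₗ[ℂ] (ι →₀ ℂ)) (B.br x u)) (fun u hu => ?_), linearCombination_fun_map]
    · simp
    · rw [B.skew u x, ← B.ε_left hu x]; simp [ε]
  have hd := congrArg (B.leftMul (B.of S a)) (h x y)
  rw [defect_apply] at hd
  rw [hs]
  simp only [map_sub, map_smul, map_neg, LinearMap.sub_apply, LinearMap.smul_apply,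
    LinearMap.neg_apply, map_zero] at hj hd ⊢
  rw [show paritySign (B.odd y) (B.odd a) = B.ε y a from rfl] at hj
  rw [B.ε_comm a y, B.ε_comm y x, B.ε_comm a x]
  have e1 := B.ε_mul_self x y
  have e2 := B.ε_mul_self x a
  have e3 := B.ε_mul_self y a
  generalize B.ε x y = p at *
  generalize B.ε x a = q at *
  generalize B.ε y a = r at *
  have e12 : p * q * (p * q) = 1 := by linear_combination (p * p) * e2 + e1
  linear_combination (norm := module) (q * r) • hd - hj
    + (p * e3) • B.induced τ hS y (linearCombination ℂ (B.induced τ hS) (B.br x a) m)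
    - e12 • B.induced τ hS x (linearCombination ℂ (B.induced τ hS) (B.br y a) m)
    + e12 • linearCombination ℂ (B.induced τ hS) (linearCombination ℂ (B.br x) (B.br y a)) m

/-- Induction on the word in `U(S)`. On `1 ⊗ v` the relation is the hypothesis on `τ` when both
elements lie outside `S`, and `defect_of_right` with skew symmetry otherwise; longer words are
`defect_mul_apply`. -/
theorem isRep_induced (hτ : B.IsRep (fun x => ¬ S x) τ) (hT : B.Closed (fun x => ¬ S x)) :
    B.IsRep (fun _ => True) (B.induced τ hS) := by
  suffices H : ∀ (w : B.EnvOf S) (v : V) (x y : ι), B.defect τ hS x y (B.tens w v) = 0 by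
    intro x y _ _
    have : B.defect τ hS x y = 0 := IndMod.hom_ext fun w v => by simpa using H w v x y
    exact sub_eq_zero.1 this
  intro w v
  induction w using B.envOf_induction with
  | one =>
    intro x y
    by_cases hy : S y
    · rw [B.defect_of_right τ hS hy]; rfl
    by_cases hx : S x
    · rw [B.defect_swap, B.defect_of_right τ hS hx]; simp
    have h1 : ∀ z, ¬ S z → ∀ v', B.induced τ hS z (B.tens 1 v') = B.tens 1 (τ z v') := by
      intro z hz v'
      rw [induced_one_tens]; simp [inducedBase, hz]
    rw [defect_apply, h1 y hy, h1 x hx, h1 x hx, h1 y hy, linearCombination_end_apply,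
      linearCombination_congr (fun u hu => h1 u (hT x y hx hy u hu) v), linearCombination_fun_map,
      ← linearCombination_end_apply, ← hτ x y hx hy]
    simp
  | add a b ha hb => intro x y; rw [map_add, LinearMap.add_apply, map_add, ha, hb, add_zero]
  | smul c a ha => intro x y; rw [map_smul, LinearMap.smul_apply, map_smul, ha, smul_zero]
  | mul a w haS ih =>
    intro x y
    rw [← leftMul_tens]
    exact B.defect_mul_apply τ hS x y a haS _ ih

end Induced
end SuperBracket
end AffineOsp
end

/-! ### The affine Lie superalgebra and its Jacobi identity -/

noncomputable section
namespace AffineOsp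
open Finsupp (linearCombination)
open Osp12

section FiniteBracket

/-- Twice the structure constants: `2 [a, b] = (bracketTable a b).2 • (bracketTable a b).1`. -/
def bracketTable : Osp12 → Osp12 → Osp12 × ℤ
  | Jplus, Jminus => (Jthree, 4)
  | Jminus, Jplus => (Jthree, -4)
  | Jthree, Jplus => (Jplus, 2)
  | Jplus, Jthree => (Jplus, -2)
  | Jthree, Jminus => (Jminus, -2)
  | Jminus, Jthree => (Jminus, 2)
  | Jthree, jplus => (jplus, 1)
  | jplus, Jthree => (jplus, -1)
  | Jthree, jminus => (jminus, -1)
  | jminus, Jthree => (jminus, 1)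
  | Jplus, jminus => (jplus, -2)
  | jminus, Jplus => (jplus, 2)
  | Jminus, jplus => (jminus, -2)
  | jplus, Jminus => (jminus, 2)
  | jplus, jminus => (Jthree, 4)
  | jminus, jplus => (Jthree, 4)
  | jplus, jplus => (Jplus, 4)
  | jminus, jminus => (Jminus, -4)
  | _, _ => (Jthree, 0)

/-- Twice the structure constants, as integers. -/
def bracketInt (a b c : Osp12) : ℤ := if c = (bracketTable a b).1 then (bracketTable a b).2 else 0

/-- Twice the invariant form, as integers. -/
def formInt : Osp12 → Osp12 → ℤ
  | Jplus, Jminus => 2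
  | Jminus, Jplus => 2
  | Jthree, Jthree => 1
  | jplus, jminus => 4
  | jminus, jplus => -4
  | _, _ => 0

/-- The Koszul sign as an integer. -/
def signInt (a b : Osp12) : ℤ := if a.isOdd && b.isOdd then -1 else 1

theorem bracket_eq (a b c : Osp12) : bracket a b c = (bracketInt a b c : ℂ) / 2 := by
  cases a <;> cases b <;>
    simp only [bracket, bracketInt, bracketTable, Pi.single_apply, Pi.zero_apply] <;>
    split_ifs <;> simp_all <;> norm_num

theorem form_eq (a b : Osp12) : form a b = (formInt a b : ℂ) / 2 := by
  cases a <;> cases b <;> norm_num [form, formInt]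

theorem paritySign_eq (a b : Osp12) : paritySign a.isOdd b.isOdd = (signInt a b : ℂ) := by
  cases a <;> cases b <;> simp [paritySign, signInt, Osp12.isOdd]

/-- Doubling clears the halves in the structure constants, so the finite-dimensional axioms become
finite checks over the integers. -/
theorem bracketInt_jacobi : ∀ x a b e : Osp12,
    (∑ d, bracketInt x a d * bracketInt d b e) - signInt a b * ∑ d, bracketInt x b d * bracketInt d a e
      = ∑ d, bracketInt a b d * bracketInt x d e := by decide

theorem formInt_invariant : ∀ a b c : Osp12,
    ∑ d, bracketInt a b d * formInt d c = ∑ d, bracketInt b c d * formInt a d := by decide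

/-- The companion of `formInt_invariant` that matches the second, signed term of the Jacobi
identity. Together they say that the central extension is given by a cocycle. -/
theorem formInt_invariant' : ∀ a b c : Osp12,
    signInt b c * ∑ d, bracketInt a c d * formInt d b = -∑ d, bracketInt b c d * formInt a d := by
  decide

theorem bracketInt_skew : ∀ a b c : Osp12, bracketInt a b c = -(signInt a b * bracketInt b a c) := by
  decide

theorem formInt_symm : ∀ a b : Osp12, formInt a b = signInt a b * formInt b a := by decide

theorem bracketInt_parity : ∀ a b c : Osp12, bracketInt a b c ≠ 0 → c.isOdd = xor a.isOdd b.isOdd := by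
  decide

theorem formInt_parity : ∀ a b : Osp12, formInt a b ≠ 0 → a.isOdd = b.isOdd := by decide

end FiniteBracket

/-- The parity of a basis element of the affine Lie superalgebra. -/
def Gen.isOdd : Gen → Bool
  | Gen.mode a _ => a.isOdd
  | _ => false

/-- The combination `∑ c, f c • c_n` of modes. -/
def modes (n : ℤ) : (Osp12 → ℂ) →ₗ[ℂ] (Gen →₀ ℂ) :=
  ∑ c, (Finsupp.lsingle (Gen.mode c n)).comp (LinearMap.proj (R := ℂ) (φ := fun _ => ℂ) c)

theorem modes_apply (n : ℤ) (f : Osp12 → ℂ) :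
    modes n f = ∑ c, Finsupp.single (Gen.mode c n) (f c) := by
  simp [modes, LinearMap.sum_apply]

/-- The super bracket of basis elements of the affine Lie superalgebra. -/
def affineBr : Gen → Gen → Gen →₀ ℂ
  | Gen.mode a n, Gen.mode b m => modes (n + m) (bracket a b)
      + Finsupp.single Gen.K (if n + m = 0 then (n : ℂ) * form a b else 0)
  | Gen.d, Gen.mode a n => Finsupp.single (Gen.mode a n) (n : ℂ)
  | Gen.mode a n, Gen.d => Finsupp.single (Gen.mode a n) (-n : ℂ)
  | _, _ => 0

theorem mem_support_affineBr_mode {a b : Osp12} {n m : ℤ} {u : Gen}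
    (h : u ∈ (affineBr (Gen.mode a n) (Gen.mode b m)).support) :
    (∃ c, bracket a b c ≠ 0 ∧ u = Gen.mode c (n + m)) ∨
      (u = Gen.K ∧ n + m = 0 ∧ n ≠ 0 ∧ form a b ≠ 0) := by
  classical
  rw [Finsupp.mem_support_iff, affineBr, modes_apply, Finsupp.add_apply, Finsupp.finsetSum_apply] at h
  cases u with
  | mode c r =>
    left
    refine ⟨c, ?_, ?_⟩
    · rintro h0
      apply h
      simp only [Finsupp.single_apply]
      simp only [reduceCtorEq, if_false, add_zero]
      refine Finset.sum_eq_zero fun e _ => ?_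
      split_ifs with h1
      · rw [Gen.mode.injEq] at h1; rw [h1.1, h0]
      · rfl
    · by_contra h0
      apply h
      simp only [Finsupp.single_apply]
      simp only [reduceCtorEq, if_false, add_zero]
      refine Finset.sum_eq_zero fun e _ => if_neg fun h1 => h0 ?_
      rw [Gen.mode.injEq] at h1 ⊢; exact ⟨rfl, h1.2.symm⟩
  | K =>
    right
    simp only [Finsupp.single_apply, reduceCtorEq, if_false, Finset.sum_const_zero, zero_add,
      if_true, ne_eq, ite_eq_right_iff, not_forall, mul_eq_zero, not_or, Int.cast_eq_zero] at h
    exact ⟨rfl, h.1, h.2.1, h.2.2⟩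
  | d => simp at h

theorem affineBr_skew (x y : Gen) :
    affineBr x y = -(paritySign x.isOdd y.isOdd • affineBr y x) := by
  have hs : ∀ a b, bracket a b = -(paritySign a.isOdd b.isOdd) • bracket b a := by
    intro a b; funext c
    rw [Pi.smul_apply, bracket_eq, bracket_eq, paritySign_eq, bracketInt_skew a b c, smul_eq_mul]
    push_cast; ring
  cases x with
  | mode a n =>
    cases y with
    | mode b m =>
      simp only [affineBr, Gen.isOdd]
      rw [add_comm m n, hs a b, map_smul, smul_add, Finsupp.smul_single, form_eq, form_eq b a,
        formInt_symm a b, paritySign_eq]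
      have : ((if n + m = 0 then (n : ℂ) * (((signInt a b * formInt b a : ℤ) : ℂ) / 2) else 0))
          = -((signInt a b : ℂ) • (if n + m = 0 then (m : ℂ) * ((formInt b a : ℂ) / 2) else 0)) := by
        split_ifs with h
        · have : (m : ℂ) = -n := by rw [eq_neg_iff_add_eq_zero, add_comm]; exact_mod_cast h
          rw [this, smul_eq_mul]; push_cast; ring
        · simp
      rw [this, Finsupp.single_neg]
      module
    | K => simp [affineBr]
    | d => simp [affineBr, Gen.isOdd, paritySign]
  | K => cases y <;> simp [affineBr]
  | d => cases y <;> simp [affineBr, Gen.isOdd, paritySign]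

theorem linearCombination_modes {M : Type} [AddCommGroup M] [Module ℂ M] (f : Gen → M) (n : ℤ)
    (k : Osp12 → ℂ) : linearCombination ℂ f (modes n k) = ∑ c, k c • f (Gen.mode c n) := by
  simp [modes_apply, map_sum]

theorem sum_smul_modes (n : ℤ) (k : Osp12 → ℂ) (g : Osp12 → Osp12 → ℂ) :
    ∑ c, k c • modes n (g c) = modes n (fun e => ∑ c, k c * g c e) := by
  simp_rw [← map_smul, ← map_sum]
  exact congrArg _ (funext fun e => by simp)

theorem linearCombination_affineBr_left (x a b : Osp12) (l n m : ℤ) :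
    linearCombination ℂ (fun u => affineBr u (Gen.mode b m)) (affineBr (Gen.mode x l) (Gen.mode a n))
      = modes (l + n + m) (fun e => ∑ c, bracket x a c * bracket c b e)
        + Finsupp.single Gen.K
          (if l + n + m = 0 then ((l : ℂ) + n) * ∑ c, bracket x a c * form c b else 0) := by
  simp only [affineBr, map_add, linearCombination_modes, Finsupp.linearCombination_single,
    smul_zero, add_zero, smul_add, Finset.sum_add_distrib, sum_smul_modes, Finsupp.smul_single,
    ← Finsupp.single_finsetSum]
  congr 2
  split_ifs
  · rw [Finset.mul_sum]
    exact Finset.sum_congr rfl fun c _ => by rw [smul_eq_mul]; push_cast; ring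
  · simp

theorem linearCombination_affineBr_right (x a b : Osp12) (l n m : ℤ) :
    linearCombination ℂ (affineBr (Gen.mode x l)) (affineBr (Gen.mode a n) (Gen.mode b m))
      = modes (l + (n + m)) (fun e => ∑ c, bracket a b c * bracket x c e)
        + Finsupp.single Gen.K
          (if l + (n + m) = 0 then (l : ℂ) * ∑ c, bracket a b c * form x c else 0) := by
  simp only [affineBr, map_add, linearCombination_modes, Finsupp.linearCombination_single,
    smul_zero, add_zero, smul_add, Finset.sum_add_distrib, sum_smul_modes, Finsupp.smul_single,
    ← Finsupp.single_finsetSum]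
  congr 2
  split_ifs
  · rw [Finset.mul_sum]
    exact Finset.sum_congr rfl fun c _ => by rw [smul_eq_mul]; ring
  · simp

theorem affineBr_d (n m : ℤ) (a b : Osp12) :
    linearCombination ℂ (affineBr Gen.d) (affineBr (Gen.mode a n) (Gen.mode b m))
      = ((n : ℂ) + m) • affineBr (Gen.mode a n) (Gen.mode b m) := by
  simp only [affineBr, map_add, linearCombination_modes, Finsupp.linearCombination_single,
    smul_zero, add_zero, smul_add, Finsupp.smul_single]
  rw [eq_comm, add_eq_left.2]
  · rw [modes_apply, Finset.smul_sum]
    refine Finset.sum_congr rfl fun c _ => ?_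
    simp only [Finsupp.smul_single, smul_eq_mul, mul_comm, Int.cast_add]
  · split_ifs with h0
    · have : (n : ℂ) + m = 0 := by exact_mod_cast h0
      simp [this]
    · simp

theorem affineBr_d' (n m : ℤ) (a b : Osp12) :
    linearCombination ℂ (fun u => affineBr u Gen.d) (affineBr (Gen.mode a n) (Gen.mode b m))
      = -((n : ℂ) + m) • affineBr (Gen.mode a n) (Gen.mode b m) := by
  rw [neg_smul, ← affineBr_d, linearCombination_congr (g := fun u =>
    (-LinearMap.id : (Gen →₀ ℂ) →ₗ[ℂ] (Gen →₀ ℂ)) (affineBr Gen.d u)) (fun u _ => ?_),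
    linearCombination_fun_map]
  · rfl
  · rw [affineBr_skew]; cases u <;> simp [Gen.isOdd, paritySign]

theorem affineBr_jacobi (x a b : Gen) :
    linearCombination ℂ (fun u => affineBr u b) (affineBr x a)
      - paritySign a.isOdd b.isOdd • linearCombination ℂ (fun u => affineBr u a) (affineBr x b)
      = linearCombination ℂ (affineBr x) (affineBr a b) := by
  have hK : ∀ y, affineBr Gen.K y = 0 := fun y => by cases y <;> rfl
  have hK' : ∀ y, affineBr y Gen.K = 0 := fun y => by cases y <;> rfl
  have f1 : affineBr Gen.K = 0 := funext hK
  have f2 : (fun u => affineBr u Gen.K) = 0 := funext hK'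
  cases x with
  | K => simp [hK, f1]
  | d =>
    cases a with
    | K => rw [f2]; simp [hK, hK']
    | d => cases b <;> simp [affineBr, Gen.isOdd, paritySign]
    | mode a n =>
      cases b with
      | K => rw [f2]; simp [hK']
      | d => simp [affineBr, Gen.isOdd, paritySign]
      | mode b m =>
        have h := affineBr_skew (Gen.mode a n) (Gen.mode b m)
        rw [affineBr_d]
        simp only [affineBr, Finsupp.linearCombination_single] at h ⊢
        linear_combination (norm := module) (-(m : ℂ)) • h
  | mode x l =>
    cases a with
    | K => rw [f2]; simp [hK, hK']
    | d =>
      cases b with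
      | K => rw [f2]; simp [hK']
      | d => simp [affineBr, Gen.isOdd, paritySign]
      | mode b m =>
        rw [affineBr_d']
        simp only [affineBr, Finsupp.linearCombination_single, Gen.isOdd, paritySign,
          Bool.false_and, Bool.false_eq_true, if_false]
        module
    | mode a n =>
      cases b with
      | K => rw [f2]; simp [hK']
      | d =>
        rw [affineBr_d']
        simp only [affineBr, Finsupp.linearCombination_single, Gen.isOdd, paritySign,
          Bool.and_false, Bool.false_eq_true, if_false]
        module
      | mode b m =>
        rw [linearCombination_affineBr_left, linearCombination_affineBr_left,
          linearCombination_affineBr_right]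
        rw [add_right_comm l m n, ← add_assoc l n m, smul_add, ← map_smul, Finsupp.smul_single,
          add_sub_add_comm, ← map_sub, ← Finsupp.single_sub]
        simp only [Gen.isOdd, paritySign_eq, bracket_eq, form_eq]
        congr 2
        · funext e
          have h := congrArg (Int.cast : ℤ → ℂ) (bracketInt_jacobi x a b e)
          push_cast at h
          simp only [Pi.sub_apply, Pi.smul_apply, smul_eq_mul, div_mul_div_comm,
            ← Finset.sum_div]
          rw [← h]; ring
        · have h1 := congrArg (Int.cast : ℤ → ℂ) (formInt_invariant x a b)
          have h2 := congrArg (Int.cast : ℤ → ℂ) (formInt_invariant' x a b)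
          push_cast at h1 h2
          split_ifs with h0
          · have h0' : (l : ℂ) + n + m = 0 := by exact_mod_cast h0
            -- By invariance of the form, every term is a multiple of `(x|[a, b])`; the multiples
            -- `(l + n) + (l + m)` and `l` agree because `l + n + m = 0`.
            simp only [smul_eq_mul, div_mul_div_comm, ← Finset.sum_div]
            linear_combination ((l : ℂ) + n) / (2 * 2) * h1 - ((l : ℂ) + m) / (2 * 2) * h2
              + (∑ d, (bracketInt a b d : ℂ) * formInt x d) / (2 * 2) * h0'
          · simp

/-- The affine Lie superalgebra `osp(1|2)^`. -/
def affine : SuperBracket Gen where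
  odd := Gen.isOdd
  br := affineBr
  odd_of_mem x y u hu := by
    cases x with
    | mode a n =>
      cases y with
      | mode b m =>
        rcases mem_support_affineBr_mode hu with ⟨c, hc, rfl⟩ | ⟨rfl, _, _, hf⟩
        · refine bracketInt_parity a b c fun h => hc ?_
          rw [bracket_eq, h]; simp
        · have := formInt_parity a b fun h => hf (by rw [form_eq, h]; simp)
          simp [Gen.isOdd, this]
      | K => simp [affineBr] at hu
      | d =>
        have := Finsupp.support_single_subset hu
        rw [Finset.mem_singleton] at this; simp [this, Gen.isOdd]
    | K => cases y <;> simp [affineBr] at hu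
    | d =>
      cases y with
      | mode b m =>
        have := Finsupp.support_single_subset hu
        rw [Finset.mem_singleton] at this; simp [this, Gen.isOdd]
      | K => simp [affineBr] at hu
      | d => simp [affineBr] at hu
  skew := affineBr_skew
  jacobi := affineBr_jacobi

end AffineOsp
end

/-! ### Universal property of the affine enveloping algebra -/

noncomputable section
namespace AffineOsp
open Finsupp (linearCombination)
open Osp12 SuperBracket

section EnvUniversal

theorem gen_eq (x : Gen) : gen x = RingQuot.mkAlgHom ℂ EnvRel (FreeAlgebra.ι ℂ x) := rfl

theorem linearCombination_affineBr_mode {M : Type} [AddCommGroup M] [Module ℂ M] (f : Gen → M)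
    (a b : Osp12) (n m : ℤ) :
    linearCombination ℂ f (affine.br (Gen.mode a n) (Gen.mode b m))
      = (∑ c, bracket a b c • f (Gen.mode c (n + m)))
        + (if n + m = 0 then (n : ℂ) * form a b else 0) • f Gen.K := by
  simp only [affine, affineBr, map_add, linearCombination_modes,
    Finsupp.linearCombination_single]

theorem isRep_gen : affine.IsRep (fun _ => True) gen := by
  have hK : ∀ x, gen Gen.K * gen x = gen x * gen Gen.K := fun x => by
    simpa [gen_eq] using RingQuot.mkAlgHom_rel ℂ (EnvRel.K_central x)
  have hd : ∀ a n, gen Gen.d * gen (Gen.mode a n) - gen (Gen.mode a n) * gen Gen.d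
      = (n : ℂ) • gen (Gen.mode a n) := fun a n => by
    simpa only [gen_eq, map_sub, map_mul, map_smul] using
      RingQuot.mkAlgHom_rel ℂ (EnvRel.d_mode a n)
  intro x y _ _
  cases x with
  | mode a n =>
    cases y with
    | mode b m =>
      rw [linearCombination_affineBr_mode,
        show affine.ε (Gen.mode a n) (Gen.mode b m) = koszulSign a b from rfl]
      simpa only [gen_eq, map_sub, map_mul, map_smul, map_add, map_sum] using
        RingQuot.mkAlgHom_rel ℂ (EnvRel.mode_mode a b n m)
    | K => simp [affine, affineBr, ε, paritySign, Gen.isOdd, hK]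
    | d =>
      simp only [affine, affineBr, ε, paritySign, Gen.isOdd, Bool.and_false, Bool.false_eq_true,
        if_false, Finsupp.linearCombination_single, one_smul]
      rw [neg_smul, ← hd]; abel
  | K => cases y <;> simp [affine, affineBr, ε, paritySign, Gen.isOdd, hK]
  | d =>
    cases y with
    | mode b m =>
      simpa [affine, affineBr, ε, paritySign, Gen.isOdd] using hd b m
    | K => simp [affine, affineBr, ε, paritySign, Gen.isOdd, hK]
    | d => simp [affine, affineBr, ε, paritySign, Gen.isOdd]

/-- The universal property of the enveloping algebra of the affine Lie superalgebra. -/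
def envLift {A : Type} [Ring A] [Algebra ℂ A] (f : Gen → A)
    (h : affine.IsRep (fun _ => True) f) : Env →ₐ[ℂ] A :=
  RingQuot.liftAlgHom ℂ ⟨FreeAlgebra.lift ℂ f, by
    intro u v huv
    induction huv with
    | mode_mode a b n m =>
      have := h (Gen.mode a n) (Gen.mode b m) trivial trivial
      rw [linearCombination_affineBr_mode,
        show affine.ε (Gen.mode a n) (Gen.mode b m) = koszulSign a b from rfl] at this
      simpa only [map_sub, map_mul, map_smul, map_add, map_sum, FreeAlgebra.lift_ι_apply]
        using this
    | K_central x =>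
      have := h Gen.K x trivial trivial
      cases x <;> simp_all [affine, affineBr, ε, paritySign, Gen.isOdd, sub_eq_zero]
    | d_mode a n =>
      have := h Gen.d (Gen.mode a n) trivial trivial
      simpa [affine, affineBr, ε, paritySign, Gen.isOdd] using this⟩

@[simp]
theorem envLift_gen {A : Type} [Ring A] [Algebra ℂ A] (f : Gen → A)
    (h : affine.IsRep (fun _ => True) f) (x : Gen) : envLift f h (gen x) = f x := by
  simp [envLift, gen]

theorem env_induction {P : Env → Prop} (one : P 1) (add : ∀ a b, P a → P b → P (a + b))
    (smul : ∀ (c : ℂ) a, P a → P (c • a)) (mul : ∀ x a, P a → P (gen x * a)) (w : Env) : P w := by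
  obtain ⟨w, rfl⟩ := RingQuot.mkAlgHom_surjective ℂ EnvRel w
  suffices H : ∀ a, P a → P (RingQuot.mkAlgHom ℂ EnvRel w * a) by simpa using H 1 one
  induction w using FreeAlgebra.induction with
  | grade0 r =>
    intro a ha
    rw [AlgHom.commutes, ← Algebra.smul_def]
    exact smul r a ha
  | grade1 x => intro a ha; exact mul x a ha
  | mul p q hp hq => intro a ha; rw [map_mul, mul_assoc]; exact hp _ (hq _ ha)
  | add p q hp hq => intro a ha; rw [map_add, add_mul]; exact add _ _ (hp _ ha) (hq _ ha)

open Classical in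
theorem SuperBracket.IsRep.restrict {ι : Type} {B : SuperBracket ι} {S T : ι → Prop}
    (hST : ∀ x, S x → T x) (hS : B.Closed S) {A : Type} [Ring A] [Algebra ℂ A] {f : ι → A}
    (h : B.IsRep T f) : B.IsRep S (fun x => if S x then f x else 0) := by
  intro x y hx hy
  have := h x y (hST x hx) (hST y hy)
  simp only [if_pos hx, if_pos hy, this]
  exact linearCombination_congr fun u hu => (if_pos (hS x y hx hy u hu)).symm

open Classical in
/-- The canonical map from the enveloping algebra of a subalgebra. -/
def envIncl {S : Gen → Prop} (hS : affine.Closed S) : affine.EnvOf S →ₐ[ℂ] Env :=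
  affine.liftEnv _ (isRep_gen.restrict (fun _ _ => trivial) hS) (fun _ h => if_neg h)

theorem envIncl_of {S : Gen → Prop} (hS : affine.Closed S) {x : Gen} (hx : S x) :
    envIncl hS (affine.of S x) = gen x := by simp [envIncl, hx]

end EnvUniversal

/-! ### The negative part acts freely on highest weight vectors -/

section Triangular

/-- The basis elements of the negative part `𝔫₋`. -/
def Gen.IsNeg : Gen → Prop
  | Gen.mode a n => n < 0 ∨ n = 0 ∧ (a = Jminus ∨ a = jminus)
  | _ => False

theorem bracketInt_neg : ∀ a b c : Osp12, (a = Jminus ∨ a = jminus) → (b = Jminus ∨ b = jminus) →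
    bracketInt a b c ≠ 0 → (c = Jminus ∨ c = jminus) := by decide

theorem bracketInt_nonneg : ∀ a b c : Osp12, ¬ (a = Jminus ∨ a = jminus) →
    ¬ (b = Jminus ∨ b = jminus) → bracketInt a b c ≠ 0 → ¬ (c = Jminus ∨ c = jminus) := by decide

theorem bracketInt_ne_zero {a b c : Osp12} (h : bracket a b c ≠ 0) : bracketInt a b c ≠ 0 :=
  fun h0 => h (by rw [bracket_eq, h0]; simp)

theorem closed_isNeg : affine.Closed Gen.IsNeg := by
  intro x y hx hy u hu
  cases x with
  | mode a n =>
    cases y with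
    | mode b m =>
      rcases mem_support_affineBr_mode hu with ⟨c, hc, rfl⟩ | ⟨rfl, h0, h1, _⟩
      · simp only [Gen.IsNeg] at hx hy ⊢
        rcases hx with hx | ⟨hx, ha⟩
        · left; omega
        · rcases hy with hy | ⟨hy, hb⟩
          · left; omega
          · exact Or.inr ⟨by omega, bracketInt_neg a b c ha hb (bracketInt_ne_zero hc)⟩
      · simp only [Gen.IsNeg] at hx hy; omega
    | K => exact hy.elim
    | d => exact hy.elim
  | K => exact hx.elim
  | d => exact hx.elim

theorem closed_not_isNeg : affine.Closed (fun x => ¬ Gen.IsNeg x) := by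
  intro x y hx hy u hu
  cases x with
  | mode a n =>
    cases y with
    | mode b m =>
      rcases mem_support_affineBr_mode hu with ⟨c, hc, rfl⟩ | ⟨rfl, h0, h1, _⟩
      · simp only [Gen.IsNeg, not_or, not_and, not_lt] at hx hy ⊢
        refine ⟨by omega, fun h => ?_⟩
        have := bracketInt_nonneg a b c (by simpa using hx.2 (by omega))
          (by simpa using hy.2 (by omega)) (bracketInt_ne_zero hc)
        simpa using this
      · simp [Gen.IsNeg]
    | K => simp [affine, affineBr] at hu
    | d =>
      have := Finsupp.support_single_subset hu
      rw [Finset.mem_singleton] at this; rwa [this]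
  | K => cases y <;> simp [affine, affineBr] at hu
  | d =>
    cases y with
    | mode b m =>
      have := Finsupp.support_single_subset hu
      rw [Finset.mem_singleton] at this; rwa [this]
    | K => simp [affine, affineBr] at hu
    | d => simp [affine, affineBr] at hu

/-- The enveloping algebra of `𝔫₋` as a subalgebra. -/
def negSub : Subalgebra ℂ Env := (envIncl closed_isNeg).range

theorem gen_mem_negSub {x : Gen} (hx : x.IsNeg) : gen x ∈ negSub :=
  ⟨affine.of Gen.IsNeg x, envIncl_of closed_isNeg hx⟩

/-- The representation of the enveloping algebra on an induced module. -/
def inducedRep {S : Gen → Prop} (hS : affine.Closed S) (hT : affine.Closed (fun x => ¬ S x))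
    {V : Type} [AddCommGroup V] [Module ℂ V] (τ : Gen → Module.End ℂ V)
    (hτ : affine.IsRep (fun x => ¬ S x) τ) : Env →ₐ[ℂ] Module.End ℂ (affine.IndMod S V) :=
  envLift (affine.induced τ hS) (affine.isRep_induced τ hS hτ hT)

section InducedRep

variable {S : Gen → Prop} (hS : affine.Closed S) (hT : affine.Closed (fun x => ¬ S x))
  {V : Type} [AddCommGroup V] [Module ℂ V] (τ : Gen → Module.End ℂ V)
  (hτ : affine.IsRep (fun x => ¬ S x) τ)

theorem inducedRep_incl (w : affine.EnvOf S) :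
    inducedRep hS hT τ hτ (envIncl hS w) = affine.leftMul w := by
  induction w using affine.envOf_induction with
  | one => simp
  | add a b ha hb => simp [ha, hb]
  | smul c a ha => simp [ha]
  | mul x a hx ha =>
    rw [map_mul, map_mul, map_mul, ha, envIncl_of hS hx, inducedRep, envLift_gen,
      affine.induced_eq_leftMul τ hS x hx]

theorem inducedRep_incl_one (w : affine.EnvOf S) (v : V) :
    inducedRep hS hT τ hτ (envIncl hS w) (affine.tens 1 v) = affine.tens w v := by
  rw [inducedRep_incl, leftMul_tens, mul_one]

theorem inducedRep_gen_one {x : Gen} (hx : ¬ S x) (v : V) :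
    inducedRep hS hT τ hτ (gen x) (affine.tens 1 v) = affine.tens 1 (τ x v) := by
  rw [inducedRep, envLift_gen, induced_one_tens]
  simp [inducedBase, hx]

end InducedRep

open Classical in
/-- The one-dimensional representation of the nonnegative part defining a Verma module. -/
def vermaChar (k j : ℂ) (x : Gen) : Module.End ℂ ℂ :=
  (if x = Gen.mode Jthree 0 then j else if x = Gen.K then k else 0) • LinearMap.id

/-- Among the nonnegative modes, `J³_0` could occur only in a bracket of zero modes of `J⁺, J³, j⁺`,
and there it does not. This is why the Verma character vanishes on brackets. -/
theorem bracketInt_Jthree : ∀ a b : Osp12, ¬ (a = Jminus ∨ a = jminus) →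
    ¬ (b = Jminus ∨ b = jminus) → bracketInt a b Jthree = 0 := by decide

theorem isRep_vermaChar (k j : ℂ) :
    affine.IsRep (fun x => ¬ Gen.IsNeg x) (vermaChar k j) := by
  have hodd : ∀ x : Gen, x.isOdd = true → vermaChar k j x = 0 := by
    intro x hx
    unfold vermaChar
    rw [if_neg, if_neg, zero_smul]
    · rintro rfl; simp [Gen.isOdd] at hx
    · rintro rfl; simp [Gen.isOdd, Osp12.isOdd] at hx
  intro x y hx hy
  have h1 : vermaChar k j x * vermaChar k j y
      - affine.ε x y • (vermaChar k j y * vermaChar k j x) = 0 := by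
    by_cases h : x.isOdd = true
    · simp [hodd x h]
    · have : affine.ε x y = 1 := by simp [ε, paritySign, affine, h]
      rw [this, one_smul, sub_eq_zero]
      unfold vermaChar
      rw [smul_mul_smul_comm, smul_mul_smul_comm, mul_comm]
  rw [h1, eq_comm]
  have h2 : ∀ u ∈ (affine.br x y).support, vermaChar k j u = (0 : Gen → Module.End ℂ ℂ) u := by
    intro u hu
    have hu2 : u ≠ Gen.mode Jthree 0 ∧ u ≠ Gen.K → vermaChar k j u = 0 := by
      rintro ⟨h3, h4⟩; simp [vermaChar, h3, h4]
    apply hu2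
    cases x with
    | mode a n =>
      cases y with
      | mode b m =>
        simp only [Gen.IsNeg, not_or, not_and, not_lt] at hx hy
        rcases mem_support_affineBr_mode hu with ⟨c, hc, rfl⟩ | ⟨rfl, h0, h1, _⟩
        · refine ⟨fun h => ?_, by simp⟩
          rw [Gen.mode.injEq] at h
          obtain ⟨rfl, h⟩ := h
          exact bracketInt_ne_zero hc (bracketInt_Jthree a b (by simpa using hx.2 (by omega))
            (by simpa using hy.2 (by omega)))
        · omega
      | K => simp [affine, affineBr] at hu
      | d =>
        have h3 := Finsupp.support_single_subset hu
        rw [Finset.mem_singleton] at h3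
        subst h3
        refine ⟨fun h => ?_, by simp⟩
        rw [Gen.mode.injEq] at h; simp [affine, affineBr, h.2] at hu
    | K => cases y <;> simp [affine, affineBr] at hu
    | d =>
      cases y with
      | mode b m =>
        have h3 := Finsupp.support_single_subset hu
        rw [Finset.mem_singleton] at h3
        subst h3
        refine ⟨fun h => ?_, by simp⟩
        rw [Gen.mode.injEq] at h; simp [affine, affineBr, h.2] at hu
      | K => simp [affine, affineBr] at hu
      | d => simp [affine, affineBr] at hu
  rw [linearCombination_congr h2, Finsupp.linearCombination_zero]
  rfl

/-- In the module induced from the one-dimensional character of the nonnegative part, `1 ⊗ 1` is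
killed by the generators of the Verma ideal, while `w` in `U(𝔫₋)` sends it to `w ⊗ 1`. So an element
of the ideal coming from `w` forces `w = 0`. -/
theorem negSub_inter_vermaIdeal {u : Env} (hu : u ∈ negSub) {k j : ℂ}
    (h : u ∈ vermaIdeal k j) : u = 0 := by
  set ρ := inducedRep closed_isNeg closed_not_isNeg (vermaChar k j) (isRep_vermaChar k j) with hρ
  set v : affine.IndMod Gen.IsNeg ℂ := affine.tens 1 1 with hv
  have hx : ∀ x : Gen, ¬ x.IsNeg → ρ (gen x) v = affine.tens 1 (vermaChar k j x 1) :=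
    fun x hx => inducedRep_gen_one _ _ _ _ hx 1
  have h0 : ∀ x ∈ vermaIdeal k j, ρ x v = 0 := by
    intro x hxm
    induction hxm using Submodule.span_induction with
    | mem x hxm =>
      rcases hxm with ⟨a, n, hn, rfl⟩ | rfl | rfl | rfl | rfl
      · rw [mode, hx _ (by simp [Gen.IsNeg]; omega)]
        have : ¬ (Gen.mode a n = Gen.mode Jthree 0) := by rw [Gen.mode.injEq]; omega
        simp [vermaChar, this]
      · rw [mode, hx _ (by simp [Gen.IsNeg])]
        simp [vermaChar]
      · rw [map_sub, mode, LinearMap.sub_apply, hx _ (by simp [Gen.IsNeg]), AlgHom.commutes]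
        simp only [vermaChar, if_true, hv, LinearMap.smul_apply, LinearMap.id_apply, map_smul,
          Module.algebraMap_end_apply, sub_self]
      · rw [map_sub, LinearMap.sub_apply, hx _ (by simp [Gen.IsNeg]), AlgHom.commutes]
        rw [show vermaChar k j Gen.K 1 = k • (1 : ℂ) by simp [vermaChar], map_smul,
          Module.algebraMap_end_apply, sub_self]
      · rw [hx _ (by simp [Gen.IsNeg])]
        simp [vermaChar]
    | zero => simp
    | add x y _ _ hx hy => simp [hx, hy]
    | smul c x _ hx => simp [hx]
  obtain ⟨w, rfl⟩ := hu
  have h1 := h0 _ h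
  have h2 : ρ (envIncl closed_isNeg w) v = affine.tens w 1 :=
    inducedRep_incl_one _ _ _ _ w 1
  have h3 : affine.tens w (1 : ℂ) = 0 := h2.symm.trans h1
  have h4 : w = 0 := by
    have := congrArg (IndMod.lift (LinearMap.lsmul ℂ (affine.EnvOf Gen.IsNeg)).flip) h3
    simpa using this
  rw [h4, map_zero]

theorem eq_zero_of_smul_hwv {u : Env} (hu : u ∈ negSub) {k j : ℂ} (h : u • hwv k j = 0) :
    u = 0 := by
  refine negSub_inter_vermaIdeal hu (k := k) (j := j) ?_
  rw [hwv, ← map_smul, smul_eq_mul, mul_one] at h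
  exact (Submodule.Quotient.mk_eq_zero _).1 h

end Triangular
end AffineOsp
end

noncomputable section
namespace AffineOsp
open Polynomial

/-! ### Vector-valued polynomial functions and Zariski density -/

section PolyFun

variable {M N : Type} [AddCommGroup M] [Module ℂ M] [AddCommGroup N] [Module ℂ N]

/-- The polynomial functions of a complex variable with values in a subspace. -/
def polyFun (W : Submodule ℂ M) : Submodule ℂ (ℂ → M) :=
  Submodule.span ℂ {f | ∃ p : ℂ[X], ∃ w ∈ W, f = fun t => p.eval t • w}

variable {W : Submodule ℂ M} {f : ℂ → M}

theorem eval_smul_mem_polyFun (p : ℂ[X]) {w : M} (hw : w ∈ W) :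
    (fun t => p.eval t • w) ∈ polyFun W := Submodule.subset_span ⟨p, w, hw, rfl⟩

theorem const_mem_polyFun {w : M} (hw : w ∈ W) : (fun _ => w) ∈ polyFun W := by
  simpa using eval_smul_mem_polyFun (1 : ℂ[X]) hw

theorem apply_mem_of_mem_polyFun (hf : f ∈ polyFun W) (t : ℂ) : f t ∈ W := by
  induction hf using Submodule.span_induction with
  | mem x h => obtain ⟨p, w, hw, rfl⟩ := h; exact W.smul_mem _ hw
  | zero => exact W.zero_mem
  | add x y _ _ hx hy => exact W.add_mem hx hy
  | smul c x _ hx => exact W.smul_mem c hx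

theorem eval_smul_polyFun (p : ℂ[X]) (hf : f ∈ polyFun W) :
    (fun t => p.eval t • f t) ∈ polyFun W := by
  induction hf using Submodule.span_induction with
  | mem x h =>
    obtain ⟨q, w, hw, rfl⟩ := h
    simpa [mul_smul] using eval_smul_mem_polyFun (p * q) hw
  | zero => convert (polyFun W).zero_mem using 1; funext t; simp
  | add x y _ _ hx hy => convert (polyFun W).add_mem hx hy using 1; funext t; simp
  | smul c x _ hx =>
    have := (polyFun W).smul_mem c hx
    convert this using 2 with t
    exact smul_comm _ _ _

theorem polyFun_comp (q : ℂ[X]) (hf : f ∈ polyFun W) : (fun t => f (q.eval t)) ∈ polyFun W := by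
  induction hf using Submodule.span_induction with
  | mem x h =>
    obtain ⟨p, w, hw, rfl⟩ := h
    simpa using eval_smul_mem_polyFun (p.comp q) hw
  | zero => exact (polyFun W).zero_mem
  | add x y _ _ hx hy => exact (polyFun W).add_mem hx hy
  | smul c x _ hx => exact (polyFun W).smul_mem c hx

theorem polyFun_map (L : M →ₗ[ℂ] N) {W' : Submodule ℂ N} (hL : ∀ w ∈ W, L w ∈ W')
    (hf : f ∈ polyFun W) : (fun t => L (f t)) ∈ polyFun W' := by
  induction hf using Submodule.span_induction with
  | mem x h =>
    obtain ⟨p, w, hw, rfl⟩ := h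
    simpa using eval_smul_mem_polyFun p (hL w hw)
  | zero => convert (polyFun W').zero_mem using 1; funext t; simp
  | add x y _ _ hx hy => convert (polyFun W').add_mem hx hy using 1; funext t; simp
  | smul c x _ hx => convert (polyFun W').smul_mem c hx using 1; funext t; simp

theorem exists_coeff_of_mem_polyFun (hf : f ∈ polyFun W) :
    ∃ c : ℕ →₀ M, (∀ i, c i ∈ W) ∧ ∀ t, f t = c.sum fun i w => t ^ i • w := by
  induction hf using Submodule.span_induction with
  | mem x h =>
    obtain ⟨p, w, hw, rfl⟩ := h
    refine ⟨Finsupp.onFinset p.support (fun i => p.coeff i • w) (fun i hi => ?_),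
      fun i => W.smul_mem _ hw, fun t => ?_⟩
    · rw [mem_support_iff]; rintro h0; simp [h0] at hi
    · change p.eval t • w = _
      rw [Finsupp.onFinset_sum _ (by simp), Polynomial.eval_eq_sum, Polynomial.sum, Finset.sum_smul]
      exact Finset.sum_congr rfl fun i _ => by rw [mul_comm, mul_smul]
  | zero => exact ⟨0, fun _ => W.zero_mem, fun t => by simp⟩
  | add x y _ _ hx hy =>
    obtain ⟨c, hc, hx⟩ := hx
    obtain ⟨d, hd, hy⟩ := hy
    refine ⟨c + d, fun i => W.add_mem (hc i) (hd i), fun t => ?_⟩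
    rw [Finsupp.sum_add_index' (by simp) (by simp [smul_add]), Pi.add_apply, hx, hy]
  | smul a x _ hx =>
    obtain ⟨c, hc, hx⟩ := hx
    refine ⟨a • c, fun i => W.smul_mem a (hc i), fun t => ?_⟩
    rw [Finsupp.sum_smul_index' (by simp), Pi.smul_apply, hx, Finsupp.smul_sum]
    exact Finset.sum_congr rfl fun i _ => smul_comm _ _ _

theorem sum_mem_polyFun (c : ℕ →₀ M) (hc : ∀ i, c i ∈ W) :
    (fun t : ℂ => c.sum fun i w => t ^ i • w) ∈ polyFun W := by
  have : (fun t : ℂ => c.sum fun i w => t ^ i • w)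
      = ∑ i ∈ c.support, fun t : ℂ => ((X : ℂ[X]) ^ i).eval t • c i := by
    funext t; simp [Finsupp.sum]
  rw [this]
  exact Submodule.sum_mem _ fun i _ => eval_smul_mem_polyFun _ (hc i)

/-- Each linear functional turns the family into a scalar polynomial with infinitely many roots, and
functionals separate the points of `M`. -/
theorem coeff_eq_zero_of_infinite (c : ℕ →₀ M) {s : Set ℂ} (hs : s.Infinite)
    (h : ∀ t ∈ s, (c.sum fun i w => t ^ i • w) = 0) : c = 0 := by
  ext i
  rw [Finsupp.zero_apply, ← Module.forall_dual_apply_eq_zero_iff ℂ]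
  intro φ
  have hp : (c.sum fun i w => monomial i (φ w)) = (0 : ℂ[X]) := by
    refine Polynomial.eq_zero_of_infinite_isRoot _ (hs.mono fun t ht => ?_)
    have := congrArg φ (h t ht)
    simp only [Finsupp.sum, map_sum, map_smul, map_zero, smul_eq_mul] at this
    simp only [Finsupp.sum, Set.mem_ofPred_eq, IsRoot.def, Polynomial.eval_finsetSum,
      eval_monomial]
    rw [← this]
    exact Finset.sum_congr rfl fun i _ => mul_comm _ _
  have := congrArg (fun p => p.coeff i) hp
  simp only [Finsupp.sum, finsetSum_coeff, coeff_monomial, coeff_zero] at this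
  rw [Finset.sum_ite_eq'] at this
  split_ifs at this with h
  · exact this
  · rw [Finsupp.notMem_support_iff.1 h, map_zero]

/-- Modulo `W'` the family vanishes at infinitely many parameters, so all its coefficients lie in
`W'`. This is how membership for generic parameters is extended to every parameter, keeping
polynomial dependence. -/
theorem polyFun_of_infinite (hf : f ∈ polyFun W) {W' : Submodule ℂ M} {s : Set ℂ}
    (hs : s.Infinite) (h : ∀ t ∈ s, f t ∈ W') : f ∈ polyFun W' := by
  obtain ⟨c, -, hc⟩ := exists_coeff_of_mem_polyFun hf
  have h0 : c.mapRange W'.mkQ (map_zero _) = 0 := by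
    refine coeff_eq_zero_of_infinite _ hs fun t ht => ?_
    rw [Finsupp.sum_mapRange_index (by simp)]
    have := (Submodule.Quotient.mk_eq_zero W').2 (h t ht)
    rw [hc] at this
    rw [← this, ← Submodule.mkQ_apply, Finsupp.sum, Finsupp.sum, map_sum]
    simp only [map_smul]
  have h1 : ∀ i, c i ∈ W' := fun i => by
    have := DFunLike.congr_fun h0 i
    simpa using this
  rw [show f = _ from funext hc]
  exact sum_mem_polyFun c h1

theorem eq_zero_of_infinite (hf : f ∈ polyFun W) {s : Set ℂ}
    (hs : s.Infinite) (h : ∀ t ∈ s, f t = 0) (t : ℂ) : f t = 0 := by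
  have := apply_mem_of_mem_polyFun (polyFun_of_infinite hf (W' := ⊥) hs (by simpa using h)) t
  simpa using this

theorem eq_of_polyFun_nat {g : ℂ → M} (hf : f ∈ polyFun W) (hg : g ∈ polyFun W)
    (h : ∀ n : ℕ, f n = g n) (t : ℂ) : f t = g t := by
  refine sub_eq_zero.1 (eq_zero_of_infinite ((polyFun W).sub_mem hf hg)
    (Set.infinite_range_of_injective (f := fun n : ℕ => (n : ℂ)) Nat.cast_injective) ?_ t)
  rintro _ ⟨n, rfl⟩
  simp [h n]

theorem exists_choose_eq_eval (n : ℕ) : ∃ p : ℂ[X], ∀ t : ℂ, Ring.choose t n = p.eval t := by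
  refine ⟨C ((n.factorial : ℂ)⁻¹) * descPochhammer ℂ n, fun t => ?_⟩
  rw [Ring.choose_eq_smul, eval_mul, eval_C, smul_eq_mul, ← descPochhammer_map (Int.castRingHom ℂ)]
  rw [Polynomial.eval_map, ← Polynomial.eval₂_smulOneHom_eq_smeval]
  congr 2
  exact RingHom.ext_int _ _

end PolyFun

/-! ### Complex powers of locally unipotent operators -/

section Unipotent

variable {M : Type} [AddCommGroup M] [Module ℂ M]

/-- Every vector is annihilated by a power of the operator. -/
def LocallyNilpotent (ν : Module.End ℂ M) : Prop := ∀ m, ∃ n, (ν ^ n) m = 0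

theorem pow_apply_eq_zero_of_le {ν : Module.End ℂ M} {m : M} {n k : ℕ} (h : (ν ^ n) m = 0)
    (hk : n ≤ k) : (ν ^ k) m = 0 := by
  rw [← Nat.sub_add_cancel hk, pow_add, Module.End.mul_apply, h, map_zero]

theorem unipotentPow_support {ν : Module.End ℂ M} (hν : LocallyNilpotent ν) (γ : ℂ) (m : M) :
    (Function.support fun n : ℕ => Ring.choose γ n • (ν ^ n) m).Finite := by
  obtain ⟨N, hN⟩ := hν m
  refine (Set.finite_lt_nat N).subset fun n hn => ?_
  by_contra h
  exact hn (by simp only [pow_apply_eq_zero_of_le hN (not_lt.1 h), smul_zero])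

/-- The power `(1 + ν)^γ` of a locally unipotent operator. -/
def unipotentPow {ν : Module.End ℂ M} (hν : LocallyNilpotent ν) (γ : ℂ) : Module.End ℂ M where
  toFun m := ∑ᶠ n : ℕ, Ring.choose γ n • (ν ^ n) m
  map_add' m m' := by
    rw [← finsum_add_distrib (unipotentPow_support hν γ m) (unipotentPow_support hν γ m')]
    simp only [map_add, smul_add]
  map_smul' c m := by
    rw [RingHom.id_apply, smul_finsum' c (unipotentPow_support hν γ m)]
    exact finsum_congr fun n => by rw [map_smul, smul_comm]

variable {ν : Module.End ℂ M} (hν : LocallyNilpotent ν)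

theorem unipotentPow_apply (γ : ℂ) {m : M} {N : ℕ} (hN : (ν ^ N) m = 0) :
    unipotentPow hν γ m = ∑ n ∈ Finset.range N, Ring.choose γ n • (ν ^ n) m := by
  refine finsum_eq_sum_of_support_subset _ fun n hn => ?_
  by_contra h
  rw [Finset.mem_coe, Finset.mem_range, not_lt] at h
  exact hn (by simp only [pow_apply_eq_zero_of_le hN h, smul_zero])

theorem unipotentPow_nat (k : ℕ) : unipotentPow hν k = (1 + ν) ^ k := by
  refine LinearMap.ext fun m => ?_
  obtain ⟨N, hN⟩ := hν m
  rw [unipotentPow_apply hν _ (pow_apply_eq_zero_of_le hN (le_max_left N (k + 1))), add_comm 1 ν,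
    (Commute.one_right ν).add_pow, LinearMap.sum_apply]
  rw [← Finset.sum_subset (Finset.range_mono (le_max_right N (k + 1)))]
  · refine Finset.sum_congr rfl fun n _ => ?_
    rw [Ring.choose_natCast, one_pow, mul_one, Nat.cast_smul_eq_nsmul ℂ, ← nsmul_eq_mul']
    rfl
  · intro n _ hn
    rw [Finset.mem_range, not_lt] at hn
    rw [Ring.choose_natCast, Nat.choose_eq_zero_of_lt hn, Nat.cast_zero, zero_smul]

theorem unipotentPow_mem_polyFun (m : M) : (fun γ => unipotentPow hν γ m) ∈ polyFun ⊤ := by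
  obtain ⟨N, hN⟩ := hν m
  choose p hp using exists_choose_eq_eval
  have : (fun γ => unipotentPow hν γ m)
      = ∑ n ∈ Finset.range N, fun γ => (p n).eval γ • (ν ^ n) m := by
    funext γ
    rw [unipotentPow_apply hν γ hN, Finset.sum_apply]
    exact Finset.sum_congr rfl fun n _ => by rw [hp]
  rw [this]
  exact Submodule.sum_mem _ fun n _ => eval_smul_mem_polyFun _ Submodule.mem_top

theorem unipotentPow_shift_mem_polyFun (m : M) (a : ℂ) :
    (fun γ => unipotentPow hν (γ + a) m) ∈ polyFun ⊤ := by
  have := polyFun_comp (X + C a) (unipotentPow_mem_polyFun hν m)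
  simpa using this

/-- On a fixed vector both sides are polynomial in each exponent, and for natural exponents the
identity is the law for powers of `1 + ν`. One exponent is freed at a time. -/
theorem unipotentPow_add (γ δ : ℂ) :
    unipotentPow hν (γ + δ) = unipotentPow hν γ * unipotentPow hν δ := by
  have h1 : ∀ (k : ℕ) (m : M) (γ : ℂ),
      unipotentPow hν (γ + k) m = unipotentPow hν γ (unipotentPow hν k m) := by
    intro k m
    refine eq_of_polyFun_nat (unipotentPow_shift_mem_polyFun hν m k)
      (unipotentPow_mem_polyFun hν _) fun n => ?_
    rw [← Nat.cast_add, unipotentPow_nat, unipotentPow_nat, unipotentPow_nat, pow_add]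
    rfl
  refine LinearMap.ext fun m => ?_
  have h2 := unipotentPow_shift_mem_polyFun hν m γ
  have h3 := polyFun_map (unipotentPow hν γ) (W' := ⊤) (fun _ _ => Submodule.mem_top)
    (unipotentPow_mem_polyFun hν m)
  have := eq_of_polyFun_nat h2 h3 (fun n => by rw [← h1, add_comm]) δ
  simpa [add_comm] using this

theorem unipotentPow_zero : unipotentPow hν 0 = 1 := by simpa using unipotentPow_nat hν 0

theorem unipotentPow_one : unipotentPow hν 1 = 1 + ν := by simpa using unipotentPow_nat hν 1

/-- The commutator with `g`, as a linear map. -/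
def adRight {A : Type} [Ring A] [Algebra ℂ A] (g : A) : Module.End ℂ A :=
  LinearMap.mulRight ℂ g - LinearMap.mulLeft ℂ g

@[simp]
theorem adRight_apply {A : Type} [Ring A] [Algebra ℂ A] (g x : A) : adRight g x = x * g - g * x :=
  rfl

/-- Right multiplication by `g` is the sum of the commuting operators `adRight g` and left
multiplication by `g`, so this is the binomial theorem. -/
theorem mul_pow_eq_sum {A : Type} [Ring A] [Algebra ℂ A] (g x : A) (k : ℕ) :
    x * g ^ k = ∑ n ∈ Finset.range (k + 1), (k.choose n : ℂ) • (g ^ (k - n) * (adRight g ^ n) x) := by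
  have hc : Commute (adRight g) (LinearMap.mulLeft ℂ g) := by
    refine LinearMap.ext fun y => ?_
    simp [mul_sub, mul_assoc]
  have h1 : LinearMap.mulRight ℂ g = adRight g + LinearMap.mulLeft ℂ g := by simp [adRight]
  have h2 : x * g ^ k = (LinearMap.mulRight ℂ g ^ k) x := by
    rw [LinearMap.pow_mulRight]; rfl
  rw [h2, h1, hc.add_pow, LinearMap.sum_apply]
  refine Finset.sum_congr rfl fun n _ => ?_
  rw [(hc.pow_pow n _).eq, LinearMap.pow_mulLeft, ← nsmul_eq_mul', Nat.cast_smul_eq_nsmul ℂ]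
  rfl

/-- The generalized commutator formula: both sides are polynomial in `γ` on each vector, and at
natural `γ` it is `mul_pow_eq_sum`. -/
theorem mul_unipotentPow (x : Module.End ℂ M) (γ : ℂ) {N : ℕ} (hN : (adRight (1 + ν) ^ N) x = 0) :
    x * unipotentPow hν γ = ∑ n ∈ Finset.range N,
      Ring.choose γ n • (unipotentPow hν (γ - n) * (adRight (1 + ν) ^ n) x) := by
  refine LinearMap.ext fun m => ?_
  choose p hp using exists_choose_eq_eval
  have h1 := polyFun_map x (W' := ⊤) (fun _ _ => Submodule.mem_top) (unipotentPow_mem_polyFun hν m)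
  have h2 : (fun γ => (∑ n ∈ Finset.range N, Ring.choose γ n •
      (unipotentPow hν (γ - n) * (adRight (1 + ν) ^ n) x)) m) ∈ polyFun (⊤ : Submodule ℂ M) := by
    have : (fun γ => (∑ n ∈ Finset.range N, Ring.choose γ n •
      (unipotentPow hν (γ - n) * (adRight (1 + ν) ^ n) x)) m)
      = ∑ n ∈ Finset.range N, fun γ => (p n).eval γ •
        unipotentPow hν (γ + (-n)) (((adRight (1 + ν) ^ n) x) m) := by
      funext γ
      rw [LinearMap.sum_apply, Finset.sum_apply]
      exact Finset.sum_congr rfl fun n _ => by rw [hp, sub_eq_add_neg]; rfl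
    rw [this]
    exact Submodule.sum_mem _ fun n _ =>
      eval_smul_polyFun _ (unipotentPow_shift_mem_polyFun hν _ _)
  refine eq_of_polyFun_nat h1 h2 (fun k => ?_) γ
  have h3 := mul_pow_eq_sum (1 + ν) x k
  rw [show x (unipotentPow hν k m) = (x * unipotentPow hν k) m from rfl, unipotentPow_nat, h3]
  congr 1
  -- The two sums stop at different places, at `k` by vanishing binomials and at `N` by nilpotency,
  -- so both are extended to a common range.
  rw [Finset.sum_subset (Finset.range_mono (le_max_left (k + 1) N)), eq_comm,
    Finset.sum_subset (Finset.range_mono (le_max_right (k + 1) N))]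
  · refine Finset.sum_congr rfl fun n _ => ?_
    rw [Ring.choose_natCast]
    rcases le_or_gt n k with h | h
    · rw [← Nat.cast_sub h, unipotentPow_nat]
    · rw [Nat.choose_eq_zero_of_lt h]; simp
  · intro n _ hn
    rw [Finset.mem_range, not_lt] at hn
    rw [← Nat.sub_add_cancel hn, pow_add, Module.End.mul_apply, hN]; simp
  · intro n _ hn
    rw [Finset.mem_range, not_lt] at hn
    rw [Nat.choose_eq_zero_of_lt hn]; simp

end Unipotent

/-! ### Extending representations to complex powers -/

section PowRep

variable {M : Type} [AddCommGroup M] [Module ℂ M]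

theorem iterComm_eq (g x : Env) (n : ℕ) : iterComm g x n = (adRight g ^ n) x := by
  rw [Module.End.pow_apply]; rfl

theorem map_adRight_pow {A B : Type} [Ring A] [Algebra ℂ A] [Ring B] [Algebra ℂ B] (ρ : A →ₐ[ℂ] B)
    (g x : A) (n : ℕ) : ρ ((adRight g ^ n) x) = (adRight (ρ g) ^ n) (ρ x) := by
  induction n with
  | zero => simp
  | succ n ih => simp [pow_succ', ih]

theorem adRight_smul_pow {A : Type} [Ring A] [Algebra ℂ A] (c : ℂ) (g x : A) (n : ℕ) :
    (adRight (c • g) ^ n) x = c ^ n • (adRight g ^ n) x := by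
  induction n with
  | zero => simp
  | succ n ih => simp [pow_succ', ih, mul_smul, smul_sub, smul_comm c]

/-- An `Env`-module on which both bases act as nonzero multiples of locally unipotent operators
is a module over the algebra of complex powers. -/
theorem exists_powRep (ρ : Env →ₐ[ℂ] Module.End ℂ M) (c : Fin 2 → ℂ) (hc : ∀ i, c i ≠ 0)
    (ν : Fin 2 → Module.End ℂ M) (hν : ∀ i, LocallyNilpotent (ν i))
    (h : ∀ i, ρ (base i) = c i • (1 + ν i)) :
    ∃ σ : PowAlg →ₐ[ℂ] Module.End ℂ M, ∀ u, σ (toPow u) = ρ u := by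
  -- The principal branch of `c i ^ γ` suffices: for fixed nonzero `c i` it is multiplicative in
  -- `γ`, which is all that the laws of exponents require.
  let f : PowGen → Module.End ℂ M := fun x => match x with
    | PowGen.elt u => ρ u
    | PowGen.pow i γ => (c i ^ γ) • unipotentPow (hν i) γ
  have fe : ∀ u, FreeAlgebra.lift ℂ f (FreeAlgebra.ι ℂ (PowGen.elt u)) = ρ u := fun u =>
    FreeAlgebra.lift_ι_apply f _
  have fp : ∀ i γ, FreeAlgebra.lift ℂ f (FreeAlgebra.ι ℂ (PowGen.pow i γ))
      = (c i ^ γ) • unipotentPow (hν i) γ := fun i γ => FreeAlgebra.lift_ι_apply f _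
  refine ⟨RingQuot.liftAlgHom ℂ ⟨FreeAlgebra.lift ℂ f, ?_⟩, fun u => ?_⟩
  · intro u v huv
    induction huv with
    | elt_add x y => rw [map_add, fe, fe, fe, map_add]
    | elt_mul x y => rw [map_mul, fe, fe, fe, map_mul]
    | elt_scalar a => rw [fe, AlgHom.commutes, AlgHom.commutes]
    | pow_zero i => rw [fp, Complex.cpow_zero, one_smul, unipotentPow_zero, map_one]
    | pow_one i => rw [fp, fe, Complex.cpow_one, unipotentPow_one, h]
    | pow_add i γ δ =>
      rw [map_mul, fp, fp, fp, Complex.cpow_add _ _ (hc i), unipotentPow_add, smul_mul_smul_comm]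
    | commutator i γ x N hN =>
      have hN' : (adRight (1 + ν i) ^ N) (ρ x) = 0 := by
        have := congrArg ρ hN
        rw [iterComm_eq, map_adRight_pow, h, adRight_smul_pow, map_zero] at this
        exact (smul_eq_zero.1 this).resolve_left (pow_ne_zero _ (hc i))
      rw [map_mul, fe, fp, map_sum, mul_smul_comm, mul_unipotentPow (hν i) (ρ x) γ hN',
        Finset.smul_sum]
      refine Finset.sum_congr rfl fun n _ => ?_
      rw [map_smul, map_mul, fp, fe, iterComm_eq, map_adRight_pow, h, adRight_smul_pow,
        smul_mul_smul_comm, smul_comm, Complex.cpow_sub _ _ (hc i), Complex.cpow_natCast,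
        div_mul_cancel₀ _ (pow_ne_zero _ (hc i))]
  · simp only [toPow, AlgHom.coe_mk, RingHom.coe_mk, MonoidHom.coe_mk, OneHom.coe_mk]
    rw [RingQuot.liftAlgHom_mkAlgHom_apply, fe]

end PowRep
end AffineOsp
end

/-! ### Nilpotency of commutators with `f₀²` and `f₁` -/

noncomputable section
namespace AffineOsp
open Finsupp (linearCombination)
open Osp12 SuperBracket

section AdNilpotent

variable {A : Type} [Ring A] [Algebra ℂ A]

theorem adRight_mul (g x y : A) : adRight g (x * y) = adRight g x * y + x * adRight g y := by
  simp only [adRight_apply]; noncomm_ring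

/-- The commutator is a derivation, so each application to a product lowers the nilpotency order of
one of the factors. -/
theorem adRight_pow_mul_eq_zero (g : A) (n : ℕ) : ∀ (p q : ℕ) (x y : A), p + q = n →
    (adRight g ^ p) x = 0 → (adRight g ^ q) y = 0 → (adRight g ^ n) (x * y) = 0 := by
  induction n with
  | zero =>
    intro p q x y hn hx _
    obtain rfl : p = 0 := by omega
    have hx' : x = 0 := by simpa using hx
    simp [hx']
  | succ n ih =>
    intro p q x y hn hx hy
    cases p with
    | zero =>
      have hx' : x = 0 := by simpa using hx
      simp [hx']
    | succ p =>
      cases q with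
      | zero =>
        have hy' : y = 0 := by simpa using hy
        simp [hy']
      | succ q =>
        rw [pow_succ, Module.End.mul_apply, adRight_mul, map_add,
          ih p (q + 1) (adRight g x) y (by omega) (by rwa [pow_succ] at hx) hy,
          ih (p + 1) q x (adRight g y) (by omega) hx (by rwa [pow_succ] at hy), add_zero]

/-- The elements on which the commutator with `g` is nilpotent. -/
def adNilSub (g : A) : Subalgebra ℂ A where
  carrier := {x | ∃ n, (adRight g ^ n) x = 0}
  mul_mem' := by
    rintro x y ⟨p, hp⟩ ⟨q, hq⟩
    exact ⟨p + q, adRight_pow_mul_eq_zero g _ p q x y rfl hp hq⟩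
  add_mem' := by
    rintro x y ⟨p, hp⟩ ⟨q, hq⟩
    refine ⟨p + q, ?_⟩
    rw [map_add, pow_apply_eq_zero_of_le hp (by omega), pow_apply_eq_zero_of_le hq (by omega),
      add_zero]
  algebraMap_mem' c := ⟨1, by simp [Algebra.commutes]⟩

theorem mem_adNilSub_of_adRight {g x : A} (h : adRight g x ∈ adNilSub g) : x ∈ adNilSub g := by
  obtain ⟨n, hn⟩ := h
  exact ⟨n + 1, by rw [pow_succ]; exact hn⟩

theorem mem_adNilSub_of_commute {g x : A} (h : adRight g x = 0) : x ∈ adNilSub g :=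
  mem_adNilSub_of_adRight (by rw [h]; exact zero_mem _)

theorem adNilSub_smul (c : ℂ) (g : A) : adNilSub g ≤ adNilSub (c • g) := by
  rintro x ⟨n, hn⟩
  exact ⟨n, by rw [adRight_smul_pow, hn, smul_zero]⟩

end AdNilpotent

section Relations

theorem mode_mul_mode (a b : Osp12) (n m : ℤ) : mode a n * mode b m
      - koszulSign a b • (mode b m * mode a n)
    = (∑ c, bracket a b c • mode c (n + m))
      + (if n + m = 0 then (n : ℂ) * form a b else 0) • gen Gen.K := by
  have := isRep_gen (Gen.mode a n) (Gen.mode b m) trivial trivial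
  rw [linearCombination_affineBr_mode] at this
  exact this

theorem K_mul (x : Gen) : gen Gen.K * gen x = gen x * gen Gen.K := by
  have := isRep_gen Gen.K x trivial trivial
  cases x <;> simp_all [affine, affineBr, ε, paritySign, Gen.isOdd, sub_eq_zero]

theorem commute_K (u : Env) : gen Gen.K * u = u * gen Gen.K := by
  induction u using env_induction with
  | one => simp
  | add a b ha hb => rw [mul_add, add_mul, ha, hb]
  | smul c a ha => rw [mul_smul_comm, smul_mul_assoc, ha]
  | mul x a ha => rw [← mul_assoc, K_mul, mul_assoc, ha, mul_assoc]

theorem d_mul_mode (a : Osp12) (n : ℤ) :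
    gen Gen.d * mode a n - mode a n * gen Gen.d = (n : ℂ) • mode a n := by
  have := isRep_gen Gen.d (Gen.mode a n) trivial trivial
  simpa [affine, affineBr, ε, paritySign, Gen.isOdd, mode] using this

theorem sum_osp {M : Type} [AddCommMonoid M] (f : Osp12 → M) :
    ∑ c, f c = f Jplus + f Jminus + f Jthree + f jplus + f jminus := by
  have : (Finset.univ : Finset Osp12) = {Jplus, Jminus, Jthree, jplus, jminus} := rfl
  rw [this, Finset.sum_insert (by decide), Finset.sum_insert (by decide),
    Finset.sum_insert (by decide), Finset.sum_insert (by decide), Finset.sum_singleton]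
  simp only [add_assoc]

theorem jminus_sq (n : ℤ) : mode jminus n * mode jminus n = -mode Jminus (n + n) := by
  have h := mode_mul_mode jminus jminus n n
  simp [koszulSign, Osp12.isOdd, bracket, form, Pi.single_apply] at h
  have h2 : (2 : ℂ) • (mode jminus n * mode jminus n) = (2 : ℂ) • (-mode Jminus (n + n)) := by
    linear_combination (norm := module) h
  exact smul_right_injective _ (two_ne_zero) h2

theorem sqrt_two_mul_self : ((Real.sqrt 2 : ℝ) : ℂ) * ((Real.sqrt 2 : ℝ) : ℂ) = 2 := by
  rw [← Complex.ofReal_mul, Real.mul_self_sqrt (by norm_num)]; simp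

theorem f₀_sq : f₀ * f₀ = (-2 : ℂ) • mode Jminus 0 := by
  rw [f₀, smul_mul_smul_comm, sqrt_two_mul_self, jminus_sq, smul_neg, add_zero]
  module

theorem base_zero : base 0 = (-2 : ℂ) • mode Jminus 0 := by
  rw [base, if_pos rfl, sq, f₀_sq]

theorem base_one : base 1 = mode Jplus (-1) := by simp [base, f₁]

theorem gen_mem_adNilSub_Jminus (x : Gen) : gen x ∈ adNilSub (mode Jminus 0) := by
  have hK : gen Gen.K ∈ adNilSub (mode Jminus 0) :=
    mem_adNilSub_of_commute (by rw [adRight_apply, commute_K, sub_self])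
  have hb : ∀ a n, adRight (mode Jminus 0) (mode a n) = (∑ c, bracket a Jminus c • mode c n)
      + (if n = 0 then (n : ℂ) * form a Jminus else 0) • gen Gen.K := by
    intro a n
    have := mode_mul_mode a Jminus n 0
    simpa [koszulSign, Osp12.isOdd] using this
  have h1 : ∀ n, mode Jminus n ∈ adNilSub (mode Jminus 0) := fun n =>
    mem_adNilSub_of_commute (by rw [hb]; simp [bracket, form])
  have h2 : ∀ n, mode jminus n ∈ adNilSub (mode Jminus 0) := fun n =>
    mem_adNilSub_of_commute (by rw [hb]; simp [bracket, form])
  have h3 : ∀ n, mode Jthree n ∈ adNilSub (mode Jminus 0) := fun n =>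
    mem_adNilSub_of_adRight (by
      rw [hb]; simpa [bracket, form, sum_osp, Pi.single_apply] using
        Subalgebra.smul_mem _ (h1 n) (-1 : ℂ))
  have h4 : ∀ n, mode jplus n ∈ adNilSub (mode Jminus 0) := fun n =>
    mem_adNilSub_of_adRight (by
      rw [hb]; simpa [bracket, form, sum_osp, Pi.single_apply] using h2 n)
  have h5 : ∀ n, mode Jplus n ∈ adNilSub (mode Jminus 0) := fun n =>
    mem_adNilSub_of_adRight (by
      rw [hb]
      refine add_mem ?_ (Subalgebra.smul_mem _ hK _)
      simpa [bracket, form, sum_osp, Pi.single_apply] using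
        Subalgebra.smul_mem _ (h3 n) (2 : ℂ))
  cases x with
  | mode a n => cases a <;> [exact h5 n; exact h1 n; exact h3 n; exact h4 n; exact h2 n]
  | K => exact hK
  | d =>
    refine mem_adNilSub_of_commute ?_
    have := d_mul_mode Jminus 0
    simpa using this

theorem gen_mem_adNilSub_Jplus (x : Gen) : gen x ∈ adNilSub (mode Jplus (-1)) := by
  have hK : gen Gen.K ∈ adNilSub (mode Jplus (-1)) :=
    mem_adNilSub_of_commute (by rw [adRight_apply, commute_K, sub_self])
  have hb : ∀ a n, adRight (mode Jplus (-1)) (mode a n)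
      = (∑ c, bracket a Jplus c • mode c (n + -1))
      + (if n + -1 = 0 then (n : ℂ) * form a Jplus else 0) • gen Gen.K := by
    intro a n
    have := mode_mul_mode a Jplus n (-1)
    simpa [koszulSign, Osp12.isOdd] using this
  have h1 : ∀ n, mode Jplus n ∈ adNilSub (mode Jplus (-1)) := fun n =>
    mem_adNilSub_of_commute (by rw [hb]; simp [bracket, form])
  have h2 : ∀ n, mode jplus n ∈ adNilSub (mode Jplus (-1)) := fun n =>
    mem_adNilSub_of_commute (by rw [hb]; simp [bracket, form])
  have h3 : ∀ n, mode Jthree n ∈ adNilSub (mode Jplus (-1)) := fun n =>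
    mem_adNilSub_of_adRight (by
      rw [hb]; simpa [bracket, form, sum_osp, Pi.single_apply] using h1 (n + -1))
  have h4 : ∀ n, mode jminus n ∈ adNilSub (mode Jplus (-1)) := fun n =>
    mem_adNilSub_of_adRight (by
      rw [hb]; simpa [bracket, form, sum_osp, Pi.single_apply] using h2 (n + -1))
  have h5 : ∀ n, mode Jminus n ∈ adNilSub (mode Jplus (-1)) := fun n =>
    mem_adNilSub_of_adRight (by
      rw [hb]
      refine add_mem ?_ (Subalgebra.smul_mem _ hK _)
      simpa [bracket, form, sum_osp, Pi.single_apply] using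
        Subalgebra.smul_mem _ (h3 (n + -1)) (-2 : ℂ))
  cases x with
  | mode a n => cases a <;> [exact h1 n; exact h5 n; exact h3 n; exact h2 n; exact h4 n]
  | K => exact hK
  | d =>
    refine mem_adNilSub_of_adRight ?_
    have := d_mul_mode Jplus (-1)
    rw [adRight_apply, this]
    exact Subalgebra.smul_mem _ (h1 _) _

theorem mem_adNilSub_base (i : Fin 2) (u : Env) : u ∈ adNilSub (base i) := by
  have hg : ∀ x, gen x ∈ adNilSub (base i) := by
    intro x
    fin_cases i
    · change gen x ∈ adNilSub (base 0)
      rw [base_zero]; exact adNilSub_smul _ _ (gen_mem_adNilSub_Jminus x)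
    · change gen x ∈ adNilSub (base 1)
      rw [base_one]; exact gen_mem_adNilSub_Jplus x
  induction u using env_induction with
  | one => exact one_mem _
  | add a b ha hb => exact add_mem ha hb
  | smul c a ha => exact Subalgebra.smul_mem _ ha c
  | mul x a ha => exact mul_mem (hg x) ha

end Relations
end AffineOsp
end

/-! ### A deformed action of `𝔫₋` on sequences -/

noncomputable section
namespace AffineOsp
open Finsupp (linearCombination)
open Osp12 SuperBracket

section Twist

/-- The enveloping algebra of `𝔫₋`. -/
abbrev EnvNeg : Type := affine.EnvOf Gen.IsNeg

/-- The parity automorphism of the enveloping algebra of `𝔫₋`. -/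
def parityHom : EnvNeg →ₐ[ℂ] EnvNeg :=
  affine.liftEnv (fun x => (if x.isOdd then (-1 : ℂ) else 1) • affine.of Gen.IsNeg x)
    (by
      intro x y hx hy
      have h := affine.isRep_of x y hx hy
      rw [linearCombination_congr (g := fun u => (((if x.isOdd then (-1 : ℂ) else 1) *
        (if y.isOdd then (-1 : ℂ) else 1)) • (LinearMap.id : EnvNeg →ₗ[ℂ] EnvNeg))
          (affine.of Gen.IsNeg u)) (fun u hu => ?_), linearCombination_fun_map, ← h]
      · simp only [smul_mul_smul_comm, LinearMap.smul_apply, LinearMap.id_apply]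
        module
      · have : u.isOdd = xor x.isOdd y.isOdd := affine.odd_of_mem x y u hu
        rw [this]
        cases x.isOdd <;> cases y.isOdd <;> simp <;> module)
    (fun x hx => by rw [affine.of_eq_zero hx, smul_zero])

theorem parityHom_of (x : Gen) : parityHom (affine.of Gen.IsNeg x)
    = (if x.isOdd then (-1 : ℂ) else 1) • affine.of Gen.IsNeg x := by simp [parityHom]

/-- Finite sequences in the enveloping algebra of `𝔫₋`. -/
def NegSeq : Type := ℕ →₀ EnvNeg

instance : AddCommGroup NegSeq := inferInstanceAs (AddCommGroup (ℕ →₀ EnvNeg))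

instance : Module ℂ NegSeq := inferInstanceAs (Module ℂ (ℕ →₀ EnvNeg))

namespace NegSeq

/-- The entries of a sequence. -/
def coeff (n : ℕ) : NegSeq →ₗ[ℂ] EnvNeg :=
  (Finsupp.lapply n : (ℕ →₀ EnvNeg) →ₗ[ℂ] EnvNeg)

/-- Sequences with one nonzero entry. -/
def single (n : ℕ) : EnvNeg →ₗ[ℂ] NegSeq :=
  (Finsupp.lsingle n : EnvNeg →ₗ[ℂ] (ℕ →₀ EnvNeg))

/-- The sum of the entries of a sequence. -/
def total : NegSeq →ₗ[ℂ] EnvNeg :=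
  (Finsupp.lsum ℂ (fun _ => LinearMap.id) : (ℕ →₀ EnvNeg) →ₗ[ℂ] EnvNeg)

theorem total_single (n : ℕ) (w : EnvNeg) : total (single n w) = w :=
  (Finsupp.lsum_single ℂ (fun _ => LinearMap.id) n w)

theorem coeff_single (m n : ℕ) (w : EnvNeg) : coeff m (single n w) = if n = m then w else 0 :=
  Finsupp.single_apply

theorem ext {p q : NegSeq} (h : ∀ n, coeff n p = coeff n q) : p = q := Finsupp.ext h

theorem hom_ext {M : Type} [AddCommGroup M] [Module ℂ M] {f g : NegSeq →ₗ[ℂ] M}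
    (h : ∀ n w, f (single n w) = g (single n w)) : f = g :=
  Finsupp.lhom_ext (M := EnvNeg) h

theorem exists_coeff_eq_zero (p : NegSeq) : ∃ N, ∀ n, N ≤ n → coeff n p = 0 := by
  refine ⟨(Finsupp.support (p : ℕ →₀ EnvNeg)).sup id + 1, fun n hn => ?_⟩
  by_contra h
  have := Finset.le_sup (f := id) (Finsupp.mem_support_iff.2 h)
  simp only [id] at this
  omega

end NegSeq

/-- Left multiplication. -/
def seqMul (w : EnvNeg) : Module.End ℂ NegSeq :=
  (Finsupp.mapRange.linearMap (LinearMap.mulLeft ℂ w) : (ℕ →₀ EnvNeg) →ₗ[ℂ] (ℕ →₀ EnvNeg))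

/-- The parity operator. -/
def seqParity : Module.End ℂ NegSeq :=
  (Finsupp.mapRange.linearMap parityHom.toLinearMap : (ℕ →₀ EnvNeg) →ₗ[ℂ] (ℕ →₀ EnvNeg))

/-- The shift to the left. -/
def seqShift : Module.End ℂ NegSeq :=
  (Finsupp.lcomapDomain (fun n => n + 1) (add_left_injective 1) :
    (ℕ →₀ EnvNeg) →ₗ[ℂ] (ℕ →₀ EnvNeg))

/-- The shift to the right. -/
def seqUnshift : Module.End ℂ NegSeq :=
  (Finsupp.lmapDomain EnvNeg ℂ (fun n => n + 1) : (ℕ →₀ EnvNeg) →ₗ[ℂ] (ℕ →₀ EnvNeg))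

open NegSeq

@[simp]
theorem coeff_seqMul (w : EnvNeg) (p : NegSeq) (n : ℕ) : coeff n (seqMul w p) = w * coeff n p :=
  rfl

@[simp]
theorem coeff_seqParity (p : NegSeq) (n : ℕ) : coeff n (seqParity p) = parityHom (coeff n p) :=
  rfl

@[simp]
theorem coeff_seqShift (p : NegSeq) (n : ℕ) : coeff n (seqShift p) = coeff (n + 1) p := rfl

theorem seqUnshift_single (n : ℕ) (w : EnvNeg) : seqUnshift (single n w) = single (n + 1) w :=
  Finsupp.mapDomain_single

theorem seqMul_single (a : EnvNeg) (n : ℕ) (w : EnvNeg) :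
    seqMul a (single n w) = single n (a * w) := Finsupp.mapRange_single (hf := mul_zero a)

/-- Left multiplication, as an algebra homomorphism. -/
def seqMulHom : EnvNeg →ₐ[ℂ] Module.End ℂ NegSeq :=
  AlgHom.ofLinearMap
    { toFun := seqMul
      map_add' := fun a b => LinearMap.ext fun p => NegSeq.ext fun n => by simp [add_mul]
      map_smul' := fun c a => LinearMap.ext fun p => NegSeq.ext fun n => by simp }
    (LinearMap.ext fun p => NegSeq.ext fun n => by simp)
    (fun a b => LinearMap.ext fun p => NegSeq.ext fun n => by simp [mul_assoc])

theorem seqMulHom_apply (w : EnvNeg) : seqMulHom w = seqMul w := rfl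

theorem commute_shift_mul (w : EnvNeg) : Commute seqShift (seqMul w) :=
  LinearMap.ext fun p => NegSeq.ext fun n => by simp

theorem commute_shift_parity : Commute seqShift seqParity :=
  LinearMap.ext fun p => NegSeq.ext fun n => by simp

theorem commute_unshift_mul (w : EnvNeg) : Commute seqUnshift (seqMul w) :=
  NegSeq.hom_ext fun n a => by simp only [Module.End.mul_apply, seqUnshift_single, seqMul_single]

theorem shift_mul_unshift : seqShift * seqUnshift = 1 :=
  NegSeq.hom_ext fun n a => NegSeq.ext fun m => by
    rw [Module.End.mul_apply, seqUnshift_single, coeff_seqShift]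
    simp [coeff_single]

theorem parity_mul (x : Gen) : seqParity * seqMul (affine.of Gen.IsNeg x)
    = (if x.isOdd then (-1 : ℂ) else 1) • (seqMul (affine.of Gen.IsNeg x) * seqParity) :=
  LinearMap.ext fun p => NegSeq.ext fun n => by
    rw [LinearMap.smul_apply, map_smul]
    simp only [Module.End.mul_apply, coeff_seqParity, coeff_seqMul, map_mul, parityHom_of,
      smul_mul_assoc]

theorem parity_mul_parity : seqParity * seqParity = 1 := by
  have h : ∀ w, parityHom (parityHom w) = w := by
    intro w
    induction w using affine.envOf_induction with
    | one => simp
    | add a b ha hb => simp [ha, hb]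
    | smul c a ha => simp [ha]
    | mul x a _ ha =>
      rw [map_mul, map_mul, ha, parityHom_of, map_smul, parityHom_of, smul_smul]
      split_ifs <;> simp
  exact LinearMap.ext fun p => NegSeq.ext fun n => by simp [h]

/-- Twice the `J³`-weight. -/
def osWeight : Osp12 → ℤ
  | Jplus => 2
  | Jminus => -2
  | Jthree => 0
  | jplus => 1
  | jminus => -1

/-- The principal degree, which is positive on `𝔫₋`. -/
def Gen.deg : Gen → ℕ
  | Gen.mode a n => (-3 * n - osWeight a).toNat
  | _ => 0

theorem osWeight_bracket : ∀ a b c : Osp12, bracketInt a b c ≠ 0 →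
    osWeight c = osWeight a + osWeight b := by decide

theorem osWeight_bounds : ∀ a, -2 ≤ osWeight a ∧ osWeight a ≤ 2 := by decide

theorem osWeight_neg : ∀ a, (a = Jminus ∨ a = jminus) → osWeight a < 0 := by decide

theorem Gen.deg_pos {a : Osp12} {n : ℤ} (h : (Gen.mode a n).IsNeg) :
    0 < -3 * n - osWeight a := by
  have := osWeight_bounds a
  rcases h with h | ⟨h, ha⟩
  · omega
  · have := osWeight_neg a ha; omega

/-- On `𝔫₋` the integer `-3n - osWeight` is positive, so `toNat` loses nothing. The factor 3 is
chosen so that both simple generators `j⁻_0` and `J⁺_{-1}` have degree one. Additivity lets the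
shift powers in `twist` match those of a bracket. -/
theorem Gen.deg_of_mem {x y u : Gen} (hx : x.IsNeg) (hy : y.IsNeg)
    (hu : u ∈ (affine.br x y).support) : u.deg = x.deg + y.deg := by
  cases x with
  | mode a n =>
    cases y with
    | mode b m =>
      have h1 := Gen.deg_pos hx
      have h2 := Gen.deg_pos hy
      rcases mem_support_affineBr_mode hu with ⟨c, hc, rfl⟩ | ⟨rfl, h0, h3, _⟩
      · have h3 := osWeight_bracket a b c (bracketInt_ne_zero hc)
        simp only [Gen.deg]; omega
      · simp only [Gen.IsNeg] at hx hy; omega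
    | K => exact hy.elim
    | d => exact hy.elim
  | K => exact hx.elim
  | d => exact hx.elim

/-- The coefficient of the parity operator in the twisted action. -/
def twistOdd (z : ℂ) : Gen → ℂ
  | Gen.mode jminus n => if n = 0 then z else 0
  | _ => 0

/-- The scalar term in the twisted action. -/
def twistEven (z : ℂ) : Gen → ℂ
  | Gen.mode Jminus n => if n = 0 then -z ^ 2 else 0
  | Gen.mode Jplus n => if n = -1 then z else 0
  | _ => 0

/-- The twisted action of `𝔫₋` on finite sequences. -/
def twist (z : ℂ) (x : Gen) : Module.End ℂ NegSeq :=
  seqShift ^ x.deg * seqMul (affine.of Gen.IsNeg x)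
    + twistOdd z x • seqParity + twistEven z x • 1

theorem bracketInt_neg_Jplus : ∀ a b : Osp12, (a = Jminus ∨ a = jminus) →
    bracketInt a b Jplus = 0 ∧ bracketInt b a Jplus = 0 := by decide

theorem bracket_neg_Jplus {a b : Osp12} (h : (a = Jminus ∨ a = jminus) ∨ (b = Jminus ∨ b = jminus)) :
    bracket a b Jplus = 0 := by
  rw [bracket_eq]
  rcases h with h | h
  · rw [(bracketInt_neg_Jplus a b h).1]; simp
  · rw [(bracketInt_neg_Jplus b a h).2]; simp

theorem linearCombination_twistOdd (z : ℂ) {x y : Gen} (hx : x.IsNeg) (hy : y.IsNeg) :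
    linearCombination ℂ (twistOdd z) (affine.br x y) = 0 := by
  cases x with
  | mode a n =>
    cases y with
    | mode b m =>
      rw [linearCombination_affineBr_mode, sum_osp]
      simp only [Gen.IsNeg] at hx hy
      by_cases h : n + m = 0
      · obtain ⟨hn, ha⟩ : n = 0 ∧ (a = Jminus ∨ a = jminus) := hx.resolve_left (by omega)
        obtain ⟨hm, hb⟩ : m = 0 ∧ (b = Jminus ∨ b = jminus) := hy.resolve_left (by omega)
        rcases ha with rfl | rfl <;> rcases hb with rfl | rfl <;>
          simp [twistOdd, bracket]
      · simp [twistOdd, h]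
    | K => exact hy.elim
    | d => exact hy.elim
  | K => exact hx.elim
  | d => exact hx.elim

/-- The extra terms imitate a character with `j⁻_0 ↦ zσ` and `σ² = 1`: the anticommutator of `j⁻_0`
with itself contributes `2z²`, which forces the value `-z²` on `J⁻_0`. The value on `J⁺_{-1}` is
unconstrained because that mode does not occur in any bracket within `𝔫₋`. -/
theorem linearCombination_twistEven (z : ℂ) {x y : Gen} (hx : x.IsNeg) (hy : y.IsNeg) :
    linearCombination ℂ (twistEven z) (affine.br x y) = 2 * twistOdd z x * twistOdd z y := by
  cases x with
  | mode a n =>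
    cases y with
    | mode b m =>
      rw [linearCombination_affineBr_mode, sum_osp]
      simp only [Gen.IsNeg] at hx hy
      by_cases h : n + m = 0
      · obtain ⟨hn, ha⟩ : n = 0 ∧ (a = Jminus ∨ a = jminus) := hx.resolve_left (by omega)
        obtain ⟨hm, hb⟩ : m = 0 ∧ (b = Jminus ∨ b = jminus) := hy.resolve_left (by omega)
        rcases ha with rfl | rfl <;> rcases hb with rfl | rfl <;>
          simp [twistOdd, twistEven, bracket, hn, hm]
        ring
      · have h1 : twistOdd z (Gen.mode a n) * twistOdd z (Gen.mode b m) = 0 := by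
          by_cases hn : n = 0
          · have hm : m ≠ 0 := by omega
            cases b <;> simp [twistOdd, hm]
          · cases a <;> simp [twistOdd, hn]
        have h2 : bracket a b Jplus * twistEven z (Gen.mode Jplus (n + m)) = 0 := by
          by_cases h3 : n + m = -1
          · have h4 : n = 0 ∨ m = 0 := by omega
            rw [bracket_neg_Jplus (h4.imp (fun h => hx.resolve_left (by omega) |>.2)
              (fun h => hy.resolve_left (by omega) |>.2)), zero_mul]
          · simp [twistEven, h3]
        rw [mul_assoc, h1]
        simp only [smul_eq_mul, h2]
        simp [twistEven, h]
    | K => exact hy.elim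
    | d => exact hy.elim
  | K => exact hx.elim
  | d => exact hx.elim

theorem isOdd_of_twistOdd {z : ℂ} {x : Gen} (h : twistOdd z x ≠ 0) : x.isOdd = true := by
  cases x with
  | mode a n => cases a <;> simp_all [twistOdd, Gen.isOdd, Osp12.isOdd]
  | K => simp [twistOdd] at h
  | d => simp [twistOdd] at h

theorem isOdd_of_twistEven {z : ℂ} {x : Gen} (h : twistEven z x ≠ 0) : x.isOdd = false := by
  cases x with
  | mode a n => cases a <;> simp_all [twistEven, Gen.isOdd, Osp12.isOdd]
  | K => rfl
  | d => rfl

theorem shift_mul_mul_shift_mul (m n : ℕ) (a b : EnvNeg) :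
    (seqShift ^ m * seqMul a) * (seqShift ^ n * seqMul b) = seqShift ^ (m + n) * seqMul (a * b) := by
  rw [pow_add, mul_assoc, ← mul_assoc (seqMul a), ← ((commute_shift_mul a).pow_left n).eq,
    ← seqMulHom_apply (a * b), map_mul, seqMulHom_apply, seqMulHom_apply]
  simp only [mul_assoc]

/-- The leading terms satisfy the bracket relations because the degree is additive and the shift
commutes with multiplication. The cross terms cancel since the parity operator anticommutes with odd
multiplications and commutes with even ones; the scalar terms are `linearCombination_twistEven`. -/
theorem isRep_twist (z : ℂ) : affine.IsRep Gen.IsNeg (twist z) := by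
  intro x y hx hy
  have hR : linearCombination ℂ (twist z) (affine.br x y)
      = seqShift ^ (x.deg + y.deg) * seqMul (linearCombination ℂ (affine.of Gen.IsNeg) (affine.br x y))
        + (2 * twistOdd z x * twistOdd z y) • (1 : Module.End ℂ NegSeq) := by
    rw [linearCombination_congr (g := fun u =>
      ((LinearMap.mulLeft ℂ (seqShift ^ (x.deg + y.deg))).comp seqMulHom.toLinearMap)
        (affine.of Gen.IsNeg u)
      + ((LinearMap.toSpanSingleton ℂ _ seqParity) (twistOdd z u)
      + (LinearMap.toSpanSingleton ℂ _ (1 : Module.End ℂ NegSeq)) (twistEven z u)))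
      (fun u hu => ?_), linearCombination_fun_add, linearCombination_fun_add,
      linearCombination_fun_map, linearCombination_fun_map, linearCombination_fun_map,
      linearCombination_twistOdd z hx hy, linearCombination_twistEven z hx hy, map_zero, zero_add]
    · rfl
    · rw [twist, Gen.deg_of_mem hx hy hu, add_assoc]; rfl
  have e1 : ∀ u v : Gen, twistOdd z v • (seqParity * (seqShift ^ u.deg * seqMul (affine.of Gen.IsNeg u)))
      = (affine.ε u v * twistOdd z v) • (seqShift ^ u.deg * seqMul (affine.of Gen.IsNeg u) * seqParity) := by
    intro u v
    by_cases h : twistOdd z v = 0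
    · simp [h]
    have hv : affine.ε u v = if u.isOdd then (-1 : ℂ) else 1 := by
      simp [ε, paritySign, affine, isOdd_of_twistOdd h]
    rw [← mul_assoc, ← (commute_shift_parity.pow_left _).eq, mul_assoc, parity_mul, hv,
      mul_smul_comm, smul_smul, mul_comm, mul_assoc]
  have e2 : ∀ u v : Gen, affine.ε u v * twistEven z v = twistEven z v := by
    intro u v
    by_cases h : twistEven z v = 0
    · simp [h]
    have : affine.ε u v = 1 := by simp [ε, paritySign, affine, isOdd_of_twistEven h]
    rw [this, one_mul]
  have e3 : affine.ε x y * (twistOdd z x * twistOdd z y) = -(twistOdd z x * twistOdd z y) := by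
    by_cases h : twistOdd z x = 0
    · simp [h]
    by_cases h' : twistOdd z y = 0
    · simp [h']
    have : affine.ε x y = -1 := by
      simp [ε, paritySign, affine, isOdd_of_twistOdd h, isOdd_of_twistOdd h']
    rw [this]; ring
  have m1 := shift_mul_mul_shift_mul x.deg y.deg (affine.of Gen.IsNeg x) (affine.of Gen.IsNeg y)
  have m2 := shift_mul_mul_shift_mul y.deg x.deg (affine.of Gen.IsNeg y) (affine.of Gen.IsNeg x)
  have exy := e1 x y
  have eyx := e1 y x
  have b1 := e2 x y
  have b2 := e2 y x
  rw [affine.ε_comm y x] at b2 eyx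
  have hrel := affine.isRep_of x y hx hy
  have e := affine.ε_mul_self x y
  rw [hR, ← hrel, ← seqMulHom_apply, map_sub, map_smul, seqMulHom_apply, seqMulHom_apply, mul_sub,
    mul_smul_comm, ← m1, add_comm x.deg y.deg, ← m2, twist, twist]
  generalize seqShift ^ x.deg * seqMul (affine.of Gen.IsNeg x) = P at *
  generalize seqShift ^ y.deg * seqMul (affine.of Gen.IsNeg y) = Q at *
  generalize twistOdd z x = α at *
  generalize twistOdd z y = β at *
  generalize twistEven z x = γ at *
  generalize twistEven z y = δ at *
  generalize affine.ε x y = ε at *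
  have hσ := parity_mul_parity
  generalize seqParity = σ at *
  have hl : ∀ (P Q : Module.End ℂ NegSeq) (α β γ δ : ℂ), (P + α • σ + γ • 1) * (Q + β • σ + δ • 1)
      = P * Q + β • (P * σ) + δ • P + α • (σ * Q) + (α * β) • 1 + (α * δ) • σ + γ • Q
        + (γ * β) • σ + (γ * δ) • 1 := by
    intro P Q α β γ δ
    simp only [add_mul, mul_add, smul_mul_assoc, mul_smul_comm, hσ, mul_one, one_mul, smul_add]
    module
  rw [hl, hl]
  linear_combination (norm := module) eyx - ε • exy - (β * e) • (P * σ) - b1 • P - b2 • Q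
    - e3 • (1 : Module.End ℂ NegSeq) - (α * b1) • σ - (β * b2) • σ
    - (γ * b1) • (1 : Module.End ℂ NegSeq)

end Twist
end AffineOsp
end

/-! ### Faithfulness of the deformed action -/

noncomputable section
namespace AffineOsp
open Finsupp (linearCombination)
open Osp12 SuperBracket NegSeq

section TwistFaithful

theorem twist_eq_zero (z : ℂ) {x : Gen} (hx : ¬ x.IsNeg) : twist z x = 0 := by
  have h1 : twistOdd z x = 0 := by
    cases x with
    | mode a n => cases a <;> simp_all [twistOdd, Gen.IsNeg]
    | K => rfl
    | d => rfl
  have h2 : twistEven z x = 0 := by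
    cases x with
    | mode a n =>
      cases a <;> simp_all [twistEven, Gen.IsNeg]
      omega
    | K => rfl
    | d => rfl
  rw [twist, h1, h2, affine.of_eq_zero hx, ← seqMulHom_apply, map_zero]
  simp

/-- The twisted action of the enveloping algebra of `𝔫₋`. -/
def twistHom (z : ℂ) : EnvNeg →ₐ[ℂ] Module.End ℂ NegSeq :=
  affine.liftEnv (twist z) (isRep_twist z) (fun _ => twist_eq_zero z)

theorem twistHom_of (z : ℂ) (x : Gen) : twistHom z (affine.of Gen.IsNeg x) = twist z x := by
  simp [twistHom]

open Polynomial in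
theorem twist_mem_polyFun (x : Gen) {f : ℂ → NegSeq} (hf : f ∈ polyFun (⊤ : Submodule ℂ NegSeq)) :
    (fun z => twist z x (f z)) ∈ polyFun (⊤ : Submodule ℂ NegSeq) := by
  have h1 : ∃ p : ℂ[X], ∀ z, twistOdd z x = p.eval z := by
    refine ⟨C (twistOdd 1 x) * X, fun z => ?_⟩
    cases x with
    | mode a n => cases a <;> simp only [twistOdd] <;> (try split_ifs) <;> simp
    | K => simp [twistOdd]
    | d => simp [twistOdd]
  have h2 : ∃ p : ℂ[X], ∀ z, twistEven z x = p.eval z := by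
    -- The scalar is `-z²`, `z` or `0`; the values at `1` and `-1` separate the even part from the
    -- odd part and so recover both coefficients uniformly.
    refine ⟨C ((twistEven 1 x + twistEven (-1) x) / 2) * X ^ 2
      + C ((twistEven 1 x - twistEven (-1) x) / 2) * X, fun z => ?_⟩
    cases x with
    | mode a n =>
      cases a <;> simp only [twistEven] <;> (try split_ifs) <;>
        simp only [eval_add, eval_mul, eval_C, eval_X, eval_pow] <;> ring
    | K => simp [twistEven]
    | d => simp [twistEven]
  obtain ⟨p, hp⟩ := h1
  obtain ⟨q, hq⟩ := h2
  have : (fun z => twist z x (f z))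
      = (fun z => (seqShift ^ x.deg * seqMul (affine.of Gen.IsNeg x)) (f z))
        + (fun z => p.eval z • seqParity (f z)) + (fun z => q.eval z • f z) := by
    funext z
    simp [twist, hp, hq]
  rw [this]
  refine Submodule.add_mem _ (Submodule.add_mem _ ?_ ?_) (eval_smul_polyFun q hf)
  · exact polyFun_map _ (fun _ _ => Submodule.mem_top) hf
  · exact eval_smul_polyFun p (polyFun_map _ (fun _ _ => Submodule.mem_top) hf)

theorem twistHom_mem_polyFun (b : EnvNeg) (v : NegSeq) :
    (fun z => twistHom z b v) ∈ polyFun (⊤ : Submodule ℂ NegSeq) := by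
  induction b using affine.envOf_induction with
  | one => simpa using const_mem_polyFun (Submodule.mem_top (x := v))
  | add a b ha hb =>
    convert Submodule.add_mem _ ha hb using 1
    funext z; simp
  | smul c a ha =>
    convert Submodule.smul_mem _ c ha using 1
    funext z; simp
  | mul x a _ ha =>
    convert twist_mem_polyFun x ha using 1
    funext z; rw [map_mul, twistHom_of]; rfl

theorem total_seqMul (a : EnvNeg) (p : NegSeq) : total (seqMul a p) = a * total p := by
  have : total.comp (seqMul a) = (LinearMap.mulLeft ℂ a).comp total :=
    NegSeq.hom_ext fun n w => by simp [seqMul_single, total_single]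
  exact DFunLike.congr_fun this p

theorem total_seqUnshift_pow (n : ℕ) (p : NegSeq) : total ((seqUnshift ^ n) p) = total p := by
  have : total.comp seqUnshift = total :=
    NegSeq.hom_ext fun n w => by simp [seqUnshift_single, total_single]
  induction n with
  | zero => simp
  | succ n ih =>
    rw [pow_succ', Module.End.mul_apply, ← ih]
    exact DFunLike.congr_fun this _

theorem shift_pow_mul_unshift_pow (n : ℕ) : seqShift ^ n * seqUnshift ^ n = 1 := by
  induction n with
  | zero => simp
  | succ n ih => rw [pow_succ, pow_succ', mul_assoc, ← mul_assoc seqShift, shift_mul_unshift,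
      one_mul, ih]

/-- At `z = 0` a generator acts as multiplication followed by a power of the left shift, and
shifting right far enough beforehand cancels that loss. What remains is plain multiplication by `b`,
seen after summing the entries. The commutation clause lets further right shifts pass through in the
induction. -/
theorem twistHom_zero_unshift (b : EnvNeg) : ∃ N : ℕ,
    Commute (twistHom 0 b * seqUnshift ^ N) seqUnshift ∧
      ∀ p, total (twistHom 0 b ((seqUnshift ^ N) p)) = b * total p := by
  induction b using affine.envOf_induction with
  | one => exact ⟨0, by simp, fun p => by simp⟩
  | add a b ha hb =>
    obtain ⟨m, hm, hm'⟩ := ha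
    obtain ⟨n, hn, hn'⟩ := hb
    refine ⟨m + n, ?_, fun p => ?_⟩
    · rw [map_add, add_mul]
      refine Commute.add_left ?_ ?_
      · rw [pow_add, ← mul_assoc]
        exact hm.mul_left (Commute.pow_self _ _)
      · rw [add_comm, pow_add, ← mul_assoc]
        exact hn.mul_left (Commute.pow_self _ _)
    · rw [map_add, LinearMap.add_apply, map_add]
      nth_rewrite 1 [pow_add]
      rw [Module.End.mul_apply, hm',
add_comm m n, pow_add, Module.End.mul_apply, hn',
        total_seqUnshift_pow, total_seqUnshift_pow, add_mul]
  | smul c a ha =>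
    obtain ⟨m, hm, hm'⟩ := ha
    refine ⟨m, ?_, fun p => ?_⟩
    · rw [map_smul, smul_mul_assoc]; exact hm.smul_left c
    · rw [map_smul, LinearMap.smul_apply, map_smul, hm', smul_mul_assoc]
  | mul x a _ ha =>
    obtain ⟨m, hm, hm'⟩ := ha
    have h0 : twist 0 x = seqShift ^ x.deg * seqMul (affine.of Gen.IsNeg x) := by
      have h1 : twistOdd 0 x = 0 := by
        cases x with
        | mode a n => cases a <;> simp [twistOdd]
        | K => rfl
        | d => rfl
      have h2 : twistEven 0 x = 0 := by
        cases x with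
        | mode a n => cases a <;> simp [twistEven]
        | K => rfl
        | d => rfl
      rw [twist, h1, h2]; simp
    have key : twistHom 0 (affine.of Gen.IsNeg x * a) * seqUnshift ^ (m + x.deg)
        = seqMul (affine.of Gen.IsNeg x) * (twistHom 0 a * seqUnshift ^ m) := by
      rw [map_mul, twistHom_of, h0, pow_add, mul_assoc, ← mul_assoc (twistHom 0 a),
        (hm.pow_right _).eq, mul_assoc, ← mul_assoc (seqMul _),
        ← ((commute_unshift_mul _).pow_left x.deg).eq, ← mul_assoc, ← mul_assoc, ← mul_assoc,
        shift_pow_mul_unshift_pow, one_mul, mul_assoc]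
    refine ⟨m + x.deg, ?_, fun p => ?_⟩
    · rw [key]
      exact (commute_unshift_mul _).symm.mul_left hm
    · rw [← Module.End.mul_apply, key, Module.End.mul_apply, total_seqMul, Module.End.mul_apply,
        hm', mul_assoc]

/-- The action is polynomial in `z`, so it vanishes at `z = 0` too. There `twistHom_zero_unshift`,
applied to the sequence with single entry `1`, gives back `b`. -/
theorem eq_zero_of_twistHom {b : EnvNeg} (h : ∀ z : ℂ, z ≠ 0 → twistHom z b = 0) : b = 0 := by
  have h0 : twistHom 0 b = 0 := by
    refine LinearMap.ext fun v => ?_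
    refine eq_zero_of_infinite (twistHom_mem_polyFun b v) (s := {0}ᶜ)
      (Set.finite_singleton 0).infinite_compl (fun z hz => ?_) 0
    rw [h z hz]; rfl
  obtain ⟨N, -, hN⟩ := twistHom_zero_unshift b
  have := hN (single 0 1)
  rw [h0, total_single, LinearMap.zero_apply, map_zero, mul_one] at this
  exact this.symm

end TwistFaithful

/-! ### The factorization `U = U(𝔟₊) U(𝔫₋)` -/

section Decomposition

/-- The basis elements outside `𝔫₋`. -/
def Gen.IsNonneg (x : Gen) : Prop := ¬ x.IsNeg

theorem closed_isNonneg : affine.Closed Gen.IsNonneg := closed_not_isNeg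

theorem closed_not_isNonneg : affine.Closed (fun x => ¬ Gen.IsNonneg x) := by
  simpa only [Gen.IsNonneg, not_not] using closed_isNeg

/-- Multiplication `U(𝔟₊) ⊗ U(𝔫₋) → U`. -/
def tensorMul : affine.IndMod Gen.IsNonneg EnvNeg →ₗ[ℂ] Env :=
  IndMod.lift ((LinearMap.mul ℂ Env).compl₁₂ (envIncl closed_isNonneg).toLinearMap
    (envIncl closed_isNeg).toLinearMap)

theorem tensorMul_tens (a : affine.EnvOf Gen.IsNonneg) (b : EnvNeg) :
    tensorMul (affine.tens a b) = envIncl closed_isNonneg a * envIncl closed_isNeg b := by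
  simp [tensorMul]

theorem tensorMul_leftMul (a : affine.EnvOf Gen.IsNonneg) (T : affine.IndMod Gen.IsNonneg EnvNeg) :
    tensorMul (affine.leftMul a T) = envIncl closed_isNonneg a * tensorMul T := by
  have : tensorMul.comp (affine.leftMul a)
      = (LinearMap.mulLeft ℂ (envIncl closed_isNonneg a)).comp tensorMul :=
    IndMod.hom_ext fun w v => by simp [tensorMul_tens, mul_assoc]
  exact DFunLike.congr_fun this T

/-- The product set is stable under left multiplication by any generator: the generator is commuted
to the right through the letters of `a`, each bracket being again a combination of generators in
front of a shorter word. -/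
theorem gen_mul_mem_range_tensorMul (a : affine.EnvOf Gen.IsNonneg) : ∀ (x : Gen) (b : EnvNeg),
    gen x * (envIncl closed_isNonneg a * envIncl closed_isNeg b) ∈ LinearMap.range tensorMul := by
  induction a using affine.envOf_induction with
  | one =>
    intro x b
    by_cases hx : x.IsNeg
    · refine ⟨affine.tens 1 (affine.of Gen.IsNeg x * b), ?_⟩
      rw [tensorMul_tens, map_mul, envIncl_of closed_isNeg hx, map_one, one_mul, one_mul]
    · refine ⟨affine.tens (affine.of Gen.IsNonneg x) b, ?_⟩
      rw [tensorMul_tens, envIncl_of closed_isNonneg hx, map_one, one_mul]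
  | add a a' ha ha' =>
    intro x b
    rw [map_add, add_mul, mul_add]
    exact add_mem (ha x b) (ha' x b)
  | smul c a ha =>
    intro x b
    rw [map_smul, smul_mul_assoc, mul_smul_comm]
    exact Submodule.smul_mem _ c (ha x b)
  | mul y a hy ha =>
    intro x b
    have h := isRep_gen x y trivial trivial
    rw [map_mul, envIncl_of closed_isNonneg hy, mul_assoc, ← mul_assoc (gen x),
      sub_eq_iff_eq_add.1 h, add_mul, linearCombination_mul_right]
    refine add_mem (linearCombination_mem fun u _ => ha u b) ?_
    rw [smul_mul_assoc, mul_assoc]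
    obtain ⟨T, hT⟩ := ha x b
    refine Submodule.smul_mem _ _ ⟨affine.leftMul (affine.of Gen.IsNonneg y) T, ?_⟩
    rw [tensorMul_leftMul, hT, envIncl_of closed_isNonneg hy]

theorem tensorMul_surjective : Function.Surjective tensorMul := by
  intro u
  change u ∈ LinearMap.range tensorMul
  induction u using env_induction with
  | one => exact ⟨affine.tens 1 1, by rw [tensorMul_tens, map_one, map_one, mul_one]⟩
  | add a b ha hb => exact add_mem ha hb
  | smul c a ha => exact Submodule.smul_mem _ c ha
  | mul x a ha =>
    obtain ⟨T, rfl⟩ := ha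
    have : (⊤ : Submodule ℂ (affine.IndMod Gen.IsNonneg EnvNeg))
        ≤ (LinearMap.range tensorMul).comap ((LinearMap.mulLeft ℂ (gen x)).comp tensorMul) := by
      refine (IndMod.span_tens _ fun w v => ?_).ge
      rw [Submodule.mem_comap, LinearMap.comp_apply, tensorMul_tens]
      exact gen_mul_mem_range_tensorMul w x v
    exact this (Submodule.mem_top (x := T))

theorem isRep_twist' (z : ℂ) : affine.IsRep (fun x => ¬ Gen.IsNonneg x) (twist z) := by
  simpa only [Gen.IsNonneg, not_not] using isRep_twist z

/-- The representation induced from the twisted action of `𝔫₋`. -/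
def twistRep (z : ℂ) : Env →ₐ[ℂ] Module.End ℂ (affine.IndMod Gen.IsNonneg NegSeq) :=
  inducedRep closed_isNonneg closed_not_isNonneg (twist z) (isRep_twist' z)

theorem twistRep_neg (z : ℂ) (b : EnvNeg) (v : NegSeq) :
    twistRep z (envIncl closed_isNeg b) (affine.tens 1 v) = affine.tens 1 (twistHom z b v) := by
  induction b using affine.envOf_induction with
  | one => simp
  | add a b ha hb => simp [ha, hb]
  | smul c a ha => simp [ha]
  | mul x a hx ha =>
    rw [map_mul, map_mul, Module.End.mul_apply, ha, envIncl_of closed_isNeg hx, map_mul,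
      twistHom_of, Module.End.mul_apply, twistRep, inducedRep_gen_one _ _ _ _ (not_not.2 hx)]

/-- On `1 ⊗ v` the negative factor acts through the deformed action and the other factor then
becomes the left tensor factor. Thus the action of an element on such vectors exposes its
`U(𝔫₋)`-coefficients separately. -/
theorem twistRep_tensorMul (z : ℂ) (v : NegSeq) (T : affine.IndMod Gen.IsNonneg EnvNeg) :
    twistRep z (tensorMul T) (affine.tens 1 v)
      = IndMod.lift (affine.tens.compl₂ ((LinearMap.applyₗ v).comp (twistHom z).toLinearMap)) T := by
  have : (LinearMap.applyₗ (affine.tens 1 v)).comp ((twistRep z).toLinearMap.comp tensorMul)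
      = IndMod.lift (affine.tens.compl₂ ((LinearMap.applyₗ v).comp (twistHom z).toLinearMap)) := by
    refine IndMod.hom_ext fun a b => ?_
    simp only [LinearMap.comp_apply, AlgHom.toLinearMap_apply, LinearMap.applyₗ_apply_apply,
      tensorMul_tens, map_mul, Module.End.mul_apply, twistRep_neg, IndMod.lift_tens,
      LinearMap.compl₂_apply]
    exact inducedRep_incl_one ..
  exact DFunLike.congr_fun this T

end Decomposition
end AffineOsp
end

/-! ### Nilpotent vectors and coordinates in induced modules -/

noncomputable section
namespace AffineOsp
open Finsupp (linearCombination)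
open Osp12 SuperBracket NegSeq
open scoped TensorProduct

section NilpotentVectors

variable {M : Type} [AddCommGroup M] [Module ℂ M]

/-- Induction on `a + n` through `ν x m = x ν m - (adRight ν x) m`: each `ν` either moves past `x`
onto `m` or takes one commutator. -/
theorem pow_apply_apply_eq_zero (ν : Module.End ℂ M) (N : ℕ) : ∀ (a n : ℕ) (x : Module.End ℂ M)
    (m : M), a + n = N → (adRight ν ^ a) x = 0 → (ν ^ n) m = 0 → (ν ^ N) (x m) = 0 := by
  induction N with
  | zero =>
    intro a n x m hN hx _
    obtain rfl : a = 0 := by omega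
    have hx' : x = 0 := by simpa using hx
    simp [hx']
  | succ N ih =>
    intro a n x m hN hx hm
    cases a with
    | zero =>
      have hx' : x = 0 := by simpa using hx
      simp [hx']
    | succ a =>
      cases n with
      | zero =>
        have hm' : m = 0 := by simpa using hm
        simp [hm']
      | succ n =>
        have h : ν (x m) = x (ν m) - (adRight ν x) m := by simp
        rw [pow_succ, Module.End.mul_apply, h, map_sub,
          ih (a + 1) n x (ν m) (by omega) hx (by rwa [pow_succ] at hm),
          ih a (n + 1) (adRight ν x) m (by omega) (by rwa [pow_succ] at hx) hm, sub_zero]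

/-- The vectors annihilated by a power of an operator. -/
def nilVectors (ν : Module.End ℂ M) : Submodule ℂ M where
  carrier := {m | ∃ n, (ν ^ n) m = 0}
  zero_mem' := ⟨0, map_zero _⟩
  add_mem' := by
    rintro x y ⟨p, hp⟩ ⟨q, hq⟩
    refine ⟨p + q, ?_⟩
    rw [map_add, pow_apply_eq_zero_of_le hp (by omega), pow_apply_eq_zero_of_le hq (by omega),
      add_zero]
  smul_mem' := by
    rintro c x ⟨p, hp⟩
    exact ⟨p, by rw [map_smul, hp, smul_zero]⟩

theorem apply_mem_nilVectors {ν x : Module.End ℂ M} (hx : x ∈ adNilSub ν) {m : M}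
    (hm : m ∈ nilVectors ν) : x m ∈ nilVectors ν := by
  obtain ⟨a, ha⟩ := hx
  obtain ⟨n, hn⟩ := hm
  exact ⟨a + n, pow_apply_apply_eq_zero ν _ a n x m rfl ha hn⟩

theorem locallyNilpotent_smul (c : ℂ) {ν : Module.End ℂ M} (h : LocallyNilpotent ν) :
    LocallyNilpotent (c • ν) := fun m => by
  obtain ⟨n, hn⟩ := h m
  exact ⟨n, by rw [smul_pow, LinearMap.smul_apply, hn, smul_zero]⟩

end NilpotentVectors

section Coordinates

variable {S : Gen → Prop} {V W : Type} [AddCommGroup V] [Module ℂ V] [AddCommGroup W] [Module ℂ W]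
  {ι : Type} (B : Module.Basis ι ℂ (affine.EnvOf S))

/-- The coordinates of an element of an induced module. -/
def indCoord (V : Type) [AddCommGroup V] [Module ℂ V] (i : ι) : affine.IndMod S V →ₗ[ℂ] V :=
  IndMod.lift ((LinearMap.lsmul ℂ V).comp (B.coord i))

theorem indCoord_tens (i : ι) (w : affine.EnvOf S) (v : V) :
    indCoord B V i (affine.tens w v) = B.coord i w • v := by simp [indCoord]

theorem indCoord_map (i : ι) (f : V →ₗ[ℂ] W) (T : affine.IndMod S V) :
    indCoord B W i (IndMod.lift (affine.tens.compl₂ f) T) = f (indCoord B V i T) := by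
  have : (indCoord B W i).comp (IndMod.lift (affine.tens.compl₂ f)) = f.comp (indCoord B V i) :=
    IndMod.hom_ext fun w v => by simp [indCoord_tens]
  exact DFunLike.congr_fun this T

theorem eq_zero_of_indCoord {T : affine.IndMod S V} (h : ∀ i, indCoord B V i T = 0) : T = 0 := by
  classical
  have h1 : ∀ i, indCoord B V i T = TensorProduct.equivFinsuppOfBasisLeft B
      (T : affine.EnvOf S ⊗[ℂ] V) i := by
    intro i
    have : indCoord B V i = ((Finsupp.lapply i).comp
        (TensorProduct.equivFinsuppOfBasisLeft (N := V) B).toLinearMap :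
          affine.EnvOf S ⊗[ℂ] V →ₗ[ℂ] V) :=
      IndMod.hom_ext fun w v => (indCoord_tens B i w v).trans
        (TensorProduct.equivFinsuppOfBasisLeft_apply_tmul_apply B w v i).symm
    exact DFunLike.congr_fun this T
  refine (TensorProduct.equivFinsuppOfBasisLeft (N := V) B).injective
    ((Finsupp.ext fun i => ?_).trans (map_zero _).symm)
  exact (h1 i).symm.trans (h i)

end Coordinates

/-! ### Injectivity of `U → Û` -/

section Injective

theorem shift_pow_mul_pow (d : ℕ) (w : EnvNeg) (n : ℕ) :
    (seqShift ^ d * seqMul w) ^ n = seqMul w ^ n * seqShift ^ (d * n) := by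
  rw [((commute_shift_mul w).pow_left d).mul_pow, ← pow_mul,
    ((commute_shift_mul w).pow_pow _ n).eq]

theorem coeff_shift_pow (n k : ℕ) (p : NegSeq) :
    coeff k ((seqShift ^ n) p) = coeff (k + n) p := by
  induction n generalizing p with
  | zero => simp
  | succ n ih => rw [pow_succ, Module.End.mul_apply, ih, coeff_seqShift]; rfl

theorem exists_shift_mul_pow_eq_zero {d : ℕ} (hd : 0 < d) (w : EnvNeg) (p : NegSeq) :
    ∃ n, ((seqShift ^ d * seqMul w) ^ n) p = 0 := by
  obtain ⟨N, hN⟩ := exists_coeff_eq_zero p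
  refine ⟨N, ?_⟩
  have : (seqShift ^ (d * N)) p = 0 := NegSeq.ext fun k => by
    rw [coeff_shift_pow, hN _ (le_add_left (Nat.le_mul_of_pos_left N hd)), map_zero]
  rw [shift_pow_mul_pow, Module.End.mul_apply, this, map_zero]

/-- On `1 ⊗ v` only the shifted multiplication is left, and it is nilpotent because sequences are
finite. Since commutators with `y` are nilpotent on every generator, nilpotency spreads to the whole
induced module. -/
theorem locallyNilpotent_twistRep (z : ℂ) {y : Gen} (hy : y.IsNeg) (h0 : twistOdd z y = 0)
    (hd : 0 < y.deg) (hnil : ∀ x, gen x ∈ adNilSub (gen y)) :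
    LocallyNilpotent (twistRep z (gen y) - twistEven z y • 1) := by
  set ν := twistRep z (gen y) - twistEven z y • 1 with hν
  have had : adRight ν = adRight (twistRep z (gen y)) := by
    refine LinearMap.ext fun x => ?_
    simp only [adRight_apply, hν, mul_sub, sub_mul, mul_smul_comm, smul_mul_assoc, mul_one, one_mul]
    abel
  have hx : ∀ x, twistRep z (gen x) ∈ adNilSub ν := by
    intro x
    obtain ⟨n, hn⟩ := hnil x
    exact ⟨n, by rw [had, ← map_adRight_pow, hn, map_zero]⟩
  have h1 : ∀ v, ν (affine.tens 1 v)
      = affine.tens 1 ((seqShift ^ y.deg * seqMul (affine.of Gen.IsNeg y)) v) := by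
    intro v
    rw [hν, LinearMap.sub_apply, twistRep, inducedRep_gen_one _ _ _ _ (not_not.2 hy), twist, h0,
      zero_smul, add_zero, LinearMap.add_apply, map_add]
    simp only [LinearMap.smul_apply, Module.End.one_apply, map_smul]
    abel
  have h2 : ∀ (n : ℕ) v, (ν ^ n) (affine.tens 1 v)
      = affine.tens 1 (((seqShift ^ y.deg * seqMul (affine.of Gen.IsNeg y)) ^ n) v) := by
    intro n
    induction n with
    | zero => intro v; rfl
    | succ n ih => intro v; rw [pow_succ, Module.End.mul_apply, h1, ih, pow_succ]; rfl
  have h3 : nilVectors ν = ⊤ := by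
    refine IndMod.span_tens _ fun w v => ?_
    induction w using affine.envOf_induction with
    | one =>
      obtain ⟨n, hn⟩ := exists_shift_mul_pow_eq_zero hd (affine.of Gen.IsNeg y) v
      exact ⟨n, by rw [h2, hn, map_zero]⟩
    | add a b ha hb => rw [map_add, LinearMap.add_apply]; exact add_mem ha hb
    | smul c a ha => rw [map_smul, LinearMap.smul_apply]; exact Submodule.smul_mem _ c ha
    | mul x a hxn ha =>
      have : affine.tens (affine.of Gen.IsNonneg x * a) v
          = twistRep z (gen x) (affine.tens a v) := by
        rw [← envIncl_of closed_isNonneg hxn, twistRep, inducedRep_incl, leftMul_tens]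
      rw [this]
      exact apply_mem_nilVectors (hx x) ha
  intro m
  have : m ∈ nilVectors ν := by rw [h3]; exact Submodule.mem_top
  exact this

theorem exists_powRep_twist {z : ℂ} (hz : z ≠ 0) :
    ∃ σ : PowAlg →ₐ[ℂ] Module.End ℂ (affine.IndMod Gen.IsNonneg NegSeq),
      ∀ u, σ (toPow u) = twistRep z u := by
  have hn0 := locallyNilpotent_twistRep z (y := Gen.mode Jminus 0) (by simp [Gen.IsNeg]) rfl
    (by simp [Gen.deg, osWeight]) gen_mem_adNilSub_Jminus
  have hn1 := locallyNilpotent_twistRep z (y := Gen.mode Jplus (-1)) (by simp [Gen.IsNeg]) rfl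
    (by simp [Gen.deg, osWeight]) gen_mem_adNilSub_Jplus
  -- The constants are the scalar parts of the two bases: `f₀² = -2 J⁻_0`, where `J⁻_0` has scalar
  -- part `-z²`, and `f₁ = J⁺_{-1}`, with scalar part `z`.
  refine exists_powRep (twistRep z) (fun i => if i = 0 then 2 * z ^ 2 else z) (fun i => ?_)
    (fun i => if i = 0
      then (-(z ^ 2)⁻¹) • (twistRep z (gen (Gen.mode Jminus 0)) - twistEven z (Gen.mode Jminus 0) • 1)
      else z⁻¹ • (twistRep z (gen (Gen.mode Jplus (-1)))
        - twistEven z (Gen.mode Jplus (-1)) • 1)) (fun i => ?_) (fun i => ?_)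
  · fin_cases i <;> simp [hz]
  · fin_cases i
    · exact locallyNilpotent_smul _ hn0
    · exact locallyNilpotent_smul _ hn1
  · fin_cases i
    · change twistRep z (base 0) = (2 * z ^ 2) • (1 + (-(z ^ 2)⁻¹) •
        (twistRep z (gen (Gen.mode Jminus 0)) - twistEven z (Gen.mode Jminus 0) • 1))
      have : z ^ 2 * (z ^ 2)⁻¹ = 1 := mul_inv_cancel₀ (pow_ne_zero 2 hz)
      rw [base_zero, map_smul]
      simp only [twistEven, if_true, mode]
      generalize twistRep z (gen (Gen.mode Jminus 0)) = G
      linear_combination (norm := module) (2 * this) • G + (2 * z ^ 2 * this) • 1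
    · change twistRep z (base 1) = z • (1 + z⁻¹ •
        (twistRep z (gen (Gen.mode Jplus (-1))) - twistEven z (Gen.mode Jplus (-1)) • 1))
      have : z * z⁻¹ = 1 := mul_inv_cancel₀ hz
      rw [base_one]
      simp only [twistEven, if_true, mode]
      generalize twistRep z (gen (Gen.mode Jplus (-1))) = G
      linear_combination (norm := module) (-this) • G + (z * this) • 1

/-- For `z ≠ 0` the deformed representation factors through the algebra of complex powers, so an
element of the kernel acts by zero. Taking coordinates along a basis of `U(𝔟₊)`, each
`U(𝔫₋)`-coefficient acts by zero for all `z ≠ 0` and therefore vanishes. -/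
theorem toPow_injective : Function.Injective toPow := by
  rw [injective_iff_map_eq_zero]
  intro u hu
  obtain ⟨T, rfl⟩ := tensorMul_surjective u
  set B := Module.Basis.ofVectorSpace ℂ (affine.EnvOf Gen.IsNonneg)
  suffices T = 0 by rw [this, map_zero]
  refine eq_zero_of_indCoord B fun i => eq_zero_of_twistHom fun z hz => LinearMap.ext fun v => ?_
  obtain ⟨σ, hσ⟩ := exists_powRep_twist hz
  have h1 : twistRep z (tensorMul T) = 0 := by rw [← hσ, hu, map_zero]
  have h2 := twistRep_tensorMul z v T
  rw [h1, LinearMap.zero_apply] at h2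
  have h3 := congrArg (indCoord B NegSeq i) h2
  rw [map_zero, indCoord_map] at h3
  exact h3.symm

end Injective
end AffineOsp
end

/-! ### Calculus of complex powers -/

noncomputable section
namespace AffineOsp
open Finsupp (linearCombination)
open Osp12 SuperBracket

section Cpow

theorem cpow_zero (i : Fin 2) : cpow i 0 = 1 :=
  (RingQuot.mkAlgHom_rel ℂ (PowRel.pow_zero i)).trans (map_one _)

theorem cpow_one (i : Fin 2) : cpow i 1 = toPow (base i) :=
  RingQuot.mkAlgHom_rel ℂ (PowRel.pow_one i)

theorem cpow_add (i : Fin 2) (γ δ : ℂ) : cpow i (γ + δ) = cpow i γ * cpow i δ :=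
  (RingQuot.mkAlgHom_rel ℂ (PowRel.pow_add i γ δ)).trans (map_mul _ _ _)

theorem cpow_natCast (i : Fin 2) (n : ℕ) : cpow i n = toPow (base i ^ n) := by
  induction n with
  | zero => simp [cpow_zero]
  | succ n ih => rw [Nat.cast_succ, cpow_add, ih, cpow_one, pow_succ, map_mul]

theorem cpow_mul_cpow_neg (i : Fin 2) (γ : ℂ) : cpow i γ * cpow i (-γ) = 1 := by
  rw [← cpow_add, add_neg_cancel, cpow_zero]

theorem cpow_neg_mul_cpow (i : Fin 2) (γ : ℂ) : cpow i (-γ) * cpow i γ = 1 := by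
  rw [← cpow_add, neg_add_cancel, cpow_zero]

theorem isUnit_cpow (i : Fin 2) (γ : ℂ) : IsUnit (cpow i γ) :=
  ⟨⟨_, _, cpow_mul_cpow_neg i γ, cpow_neg_mul_cpow i γ⟩, rfl⟩

theorem cpow_comm (i : Fin 2) (γ δ : ℂ) : Commute (cpow i γ) (cpow i δ) := by
  rw [Commute, SemiconjBy, ← cpow_add, ← cpow_add, add_comm]

theorem toPow_mul_cpow (i : Fin 2) (γ : ℂ) {x : Env} {N : ℕ} (hN : (adRight (base i) ^ N) x = 0) :
    toPow x * cpow i γ = ∑ n ∈ Finset.range N, Ring.choose γ n •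
      (cpow i (γ - n) * toPow ((adRight (base i) ^ n) x)) := by
  have := RingQuot.mkAlgHom_rel ℂ (PowRel.commutator i γ x N (by rw [iterComm_eq, hN]))
  simp only [map_mul, map_sum, map_smul] at this
  simp only [iterComm_eq] at this
  exact this

theorem toPow_mul_cpow_of_weight (i : Fin 2) (γ : ℂ) {x : Env} {c : ℂ}
    (h : adRight (base i) x = c • base i) :
    toPow x * cpow i γ = cpow i γ * (toPow x + (c * γ) • 1) := by
  have h2 : adRight (base i) (base i) = 0 := by simp
  rw [toPow_mul_cpow i γ (N := 2) (by rw [sq, Module.End.mul_apply, h, map_smul, h2, smul_zero])]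
  simp only [Finset.sum_range_succ, Finset.sum_range_zero, Ring.choose_zero_right,
    Ring.choose_one_right, pow_zero, pow_one, Module.End.one_apply, h, map_smul, ← cpow_one,
    mul_smul_comm, ← cpow_add]
  rw [mul_add, mul_smul_comm, mul_one]
  simp
  module

theorem commute_toPow_cpow {i : Fin 2} {x : Env} (h : x * base i = base i * x) (γ : ℂ) :
    Commute (toPow x) (cpow i γ) := by
  have := toPow_mul_cpow_of_weight i γ (x := x) (c := 0) (by rw [adRight_apply, h]; simp)
  rwa [zero_mul, zero_smul, add_zero] at this

/-- The generalized commutator formula truncated after the second commutator, which is enough for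
the raising generators; the second commutator is a multiple of the base and is absorbed into the
power. -/
theorem toPow_mul_cpow_two (i : Fin 2) (γ : ℂ) {x y : Env} {c : ℂ}
    (hx : adRight (base i) x = y) (hy : adRight (base i) y = c • base i) :
    toPow x * cpow i γ = cpow i γ * toPow x
      + cpow i (γ - 1) * (γ • toPow y + (c * (γ * (γ - 1) / 2)) • 1) := by
  have h2 : adRight (base i) (base i) = 0 := by simp
  have h3 : cpow i (γ - 2) * toPow (base i) = cpow i (γ - 1) := by
    rw [← cpow_one, ← cpow_add]; ring_nf
  have h4 : Ring.choose γ 2 = γ * (γ - 1) / 2 := by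
    rw [Ring.choose_eq_smul, ← Polynomial.aeval_eq_smeval]
    simp [descPochhammer, Nat.factorial]
    ring
  rw [toPow_mul_cpow i γ (N := 3) (by
    rw [pow_succ, pow_succ, pow_one, Module.End.mul_apply, Module.End.mul_apply, hx, hy, map_smul,
      h2, smul_zero])]
  simp only [Finset.sum_range_succ, Finset.sum_range_zero, Ring.choose_zero_right,
    Ring.choose_one_right, pow_zero, pow_one, Module.End.one_apply, sq, Module.End.mul_apply, hx,
    hy, map_smul, mul_smul_comm, h4, Nat.cast_one, Nat.cast_zero, Nat.cast_ofNat, h3, mul_add,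
    mul_one, sub_zero]
  module

end Cpow

/-! ### Chevalley generators against complex powers -/

section Chevalley

/-- The generator `J³_0`. -/
def J₃ : Env := mode Jthree 0

/-- The odd raising generator. -/
def e₀ : Env := ((Real.sqrt 2 : ℝ) : ℂ)⁻¹ • mode jplus 0

/-- The even raising generator. -/
def e₁ : Env := mode Jminus 1

/-- The coroot of the odd simple root. -/
def h₀ : Env := (2 : ℂ) • J₃

/-- The coroot of the even simple root. -/
def h₁ : Env := gen Gen.K - (2 : ℂ) • J₃

theorem sqrt_two_ne_zero : ((Real.sqrt 2 : ℝ) : ℂ) ≠ 0 := fun h => by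
  have := sqrt_two_mul_self
  rw [h] at this; simp at this

theorem e₀_mul_f₀ : e₀ * f₀ = h₀ - f₀ * e₀ := by
  have h := mode_mul_mode jplus jminus 0 0
  simp [koszulSign, Osp12.isOdd, bracket, Pi.single_apply] at h
  have hs := mul_inv_cancel₀ sqrt_two_ne_zero
  have hs' := inv_mul_cancel₀ sqrt_two_ne_zero
  rw [e₀, f₀, h₀, J₃, smul_mul_smul_comm, smul_mul_smul_comm, hs, hs']
  linear_combination (norm := module) h

theorem J₃_mul_f₀ : J₃ * f₀ = f₀ * J₃ - (1 / 2 : ℂ) • f₀ := by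
  have h := mode_mul_mode Jthree jminus 0 0
  simp [koszulSign, Osp12.isOdd, bracket, Pi.single_apply] at h
  rw [J₃, f₀, mul_smul_comm, smul_mul_assoc]
  linear_combination (norm := module) ((Real.sqrt 2 : ℝ) : ℂ) • h

theorem J₃_mul_f₁ : J₃ * f₁ = f₁ * J₃ + f₁ := by
  have h := mode_mul_mode Jthree Jplus 0 (-1)
  simp [koszulSign, Osp12.isOdd, bracket, Pi.single_apply] at h
  rw [J₃, f₁]
  linear_combination (norm := module) h

theorem e₁_mul_f₁ : e₁ * f₁ = f₁ * e₁ + h₁ := by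
  have h := mode_mul_mode Jminus Jplus 1 (-1)
  simp [koszulSign, Osp12.isOdd, bracket, form, Pi.single_apply] at h
  rw [e₁, f₁, h₁, J₃]
  linear_combination (norm := module) h

theorem e₁_mul_f₀ : e₁ * f₀ = f₀ * e₁ := by
  have h := mode_mul_mode Jminus jminus 1 0
  simp [koszulSign, Osp12.isOdd, bracket] at h
  rw [e₁, f₀, mul_smul_comm, smul_mul_assoc]
  linear_combination (norm := module) ((Real.sqrt 2 : ℝ) : ℂ) • h

theorem e₀_mul_f₁ : e₀ * f₁ = f₁ * e₀ := by
  have h := mode_mul_mode jplus Jplus 0 (-1)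
  simp [koszulSign, Osp12.isOdd, bracket] at h
  rw [e₀, f₁, mul_smul_comm, smul_mul_assoc]
  linear_combination (norm := module) (((Real.sqrt 2 : ℝ) : ℂ)⁻¹) • h

theorem d_mul_f₀ : gen Gen.d * f₀ = f₀ * gen Gen.d := by
  have h := d_mul_mode jminus 0
  simp at h
  rw [f₀, mul_smul_comm, smul_mul_assoc]
  linear_combination (norm := module) ((Real.sqrt 2 : ℝ) : ℂ) • h

theorem d_mul_f₁ : gen Gen.d * f₁ = f₁ * gen Gen.d - f₁ := by
  have h := d_mul_mode Jplus (-1)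
  rw [f₁]
  simp at h
  linear_combination (norm := module) h

theorem base_zero_eq : base 0 = f₀ * f₀ := by rw [base, if_pos rfl, sq]

theorem base_one_eq : base 1 = f₁ := by simp [base]

theorem isUnit_toPow_f₀ : IsUnit (toPow f₀) := by
  have h : toPow f₀ * toPow f₀ = cpow 0 1 := by rw [cpow_one, base_zero_eq, map_mul]
  refine ⟨⟨toPow f₀, toPow f₀ * cpow 0 (-1), ?_, ?_⟩, rfl⟩
  · rw [← mul_assoc, h, cpow_mul_cpow_neg]
  · rw [mul_assoc, ← (commute_toPow_cpow (x := f₀) (by rw [base_zero_eq, mul_assoc]) _).eq,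
      ← mul_assoc, h, cpow_mul_cpow_neg]

theorem commute_f₀_cpow (γ : ℂ) : Commute (toPow f₀) (cpow 0 γ) :=
  commute_toPow_cpow (by rw [base_zero_eq, mul_assoc]) γ

theorem f₀_mul_f₀_mul_cpow (γ : ℂ) : toPow f₀ * (toPow f₀ * cpow 0 γ) = cpow 0 (γ + 1) := by
  rw [← mul_assoc, ← map_mul, ← base_zero_eq, ← cpow_one, ← cpow_add, add_comm]

theorem e₁_mul_cpow (γ : ℂ) : toPow e₁ * cpow 1 γ
    = cpow 1 γ * toPow e₁ + cpow 1 (γ - 1) * (γ • toPow h₁ - (γ * (γ - 1)) • 1) := by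
  rw [toPow_mul_cpow_two 1 γ (x := e₁) (y := h₁) (c := -2)]
  · congr 2; module
  · rw [base_one_eq, adRight_apply, e₁_mul_f₁]; abel
  · rw [base_one_eq, adRight_apply, h₁, sub_mul, mul_sub, commute_K, smul_mul_assoc, J₃_mul_f₁,
      mul_smul_comm]
    module

theorem e₀_mul_cpow (γ : ℂ) : toPow e₀ * cpow 0 γ
    = cpow 0 γ * toPow e₀ - γ • (cpow 0 (γ - 1) * toPow f₀) := by
  have h : adRight (base 0) e₀ = (-1 : ℂ) • f₀ := by
    have h1 : h₀ * f₀ = f₀ * h₀ - f₀ := by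
      rw [h₀, smul_mul_assoc, J₃_mul_f₀, mul_smul_comm]; module
    rw [base_zero_eq, adRight_apply, ← mul_assoc, e₀_mul_f₀, sub_mul, mul_assoc, e₀_mul_f₀, h1, mul_sub,
      mul_assoc]
    module
  rw [toPow_mul_cpow_two 0 γ (x := e₀) (y := (-1 : ℂ) • f₀) (c := 0) h]
  · rw [map_smul, zero_mul, zero_smul, add_zero, mul_smul_comm, mul_smul_comm]
    module
  · rw [base_zero_eq, adRight_apply, smul_mul_assoc, mul_smul_comm, mul_assoc, sub_self, zero_smul]

/-- Moving `h₀` through `(f₀²)^γ` costs `-2γ`, while moving `e₀` through it gives back `γ`. The net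
factor `h₀ - γ` shows which odd power of `f₀` is formally singular. -/
theorem e₀_mul_f₀_mul_cpow (γ : ℂ) : toPow e₀ * (toPow f₀ * cpow 0 γ)
    = cpow 0 γ * (toPow h₀ - γ • 1) - toPow f₀ * cpow 0 γ * toPow e₀ := by
  have h1 : toPow h₀ * cpow 0 γ = cpow 0 γ * (toPow h₀ + ((-2) * γ) • 1) := by
    refine toPow_mul_cpow_of_weight 0 γ ?_
    have : J₃ * (f₀ * f₀) = f₀ * f₀ * J₃ - f₀ * f₀ := by
      rw [← mul_assoc, J₃_mul_f₀, sub_mul, mul_assoc, J₃_mul_f₀, mul_sub, smul_mul_assoc,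
        mul_smul_comm, mul_assoc]
      module
    rw [base_zero_eq, adRight_apply, h₀, smul_mul_assoc, this, mul_smul_comm]
    module
  have h2 : toPow f₀ * (cpow 0 (γ - 1) * toPow f₀) = cpow 0 γ := by
    rw [← (commute_f₀_cpow _).eq, f₀_mul_f₀_mul_cpow, sub_add_cancel]
  rw [← mul_assoc, ← map_mul, e₀_mul_f₀, map_sub, map_mul, sub_mul, mul_assoc, e₀_mul_cpow, h1,
    mul_sub, mul_smul_comm, h2]
  simp only [mul_add, mul_sub, mul_smul_comm, mul_one, mul_assoc]
  module

theorem J₃_mul_cpow_zero (γ : ℂ) : toPow J₃ * cpow 0 γ = cpow 0 γ * (toPow J₃ - γ • 1) := by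
  rw [toPow_mul_cpow_of_weight 0 γ (c := -1)]
  · congr 1; module
  · rw [base_zero_eq, adRight_apply, ← mul_assoc, J₃_mul_f₀, sub_mul, mul_assoc, J₃_mul_f₀, mul_sub,
      smul_mul_assoc, mul_smul_comm, mul_assoc]
    module

theorem J₃_mul_cpow_one (γ : ℂ) : toPow J₃ * cpow 1 γ = cpow 1 γ * (toPow J₃ + γ • 1) := by
  rw [toPow_mul_cpow_of_weight 1 γ (c := 1)]
  · congr 1; module
  · rw [base_one_eq, adRight_apply, J₃_mul_f₁]
    module

theorem d_mul_cpow_zero (γ : ℂ) : Commute (toPow (gen Gen.d)) (cpow 0 γ) :=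
  commute_toPow_cpow (by rw [base_zero_eq, ← mul_assoc, d_mul_f₀, mul_assoc, d_mul_f₀, mul_assoc]) γ

theorem d_mul_cpow_one (γ : ℂ) :
    toPow (gen Gen.d) * cpow 1 γ = cpow 1 γ * (toPow (gen Gen.d) - γ • 1) := by
  rw [toPow_mul_cpow_of_weight 1 γ (c := -1)]
  · congr 1; module
  · rw [base_one_eq, adRight_apply, d_mul_f₁]
    module

theorem commute_K_cpow (i : Fin 2) (γ : ℂ) : Commute (toPow (gen Gen.K)) (cpow i γ) :=
  commute_toPow_cpow (commute_K _) γ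

theorem commute_e₁_cpow (γ : ℂ) : Commute (toPow e₁) (cpow 0 γ) :=
  commute_toPow_cpow (by rw [base_zero_eq, ← mul_assoc, e₁_mul_f₀, mul_assoc, e₁_mul_f₀, mul_assoc]) γ

theorem commute_e₀_cpow (γ : ℂ) : Commute (toPow e₀) (cpow 1 γ) :=
  commute_toPow_cpow (by rw [base_one_eq, e₀_mul_f₁]) γ

end Chevalley
end AffineOsp
end

/-! ### Localization of `U(𝔫₋)` at `f₀²` or `f₁` -/

noncomputable section
namespace AffineOsp
open Finsupp (linearCombination)
open Osp12 SuperBracket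

section Localization

/-- The enveloping algebra of `𝔫₋` inside the algebra of complex powers. -/
def powNeg : Subalgebra ℂ PowAlg := negSub.map toPow

theorem toPow_mem_powNeg {u : Env} (hu : u ∈ negSub) : toPow u ∈ powNeg := ⟨u, hu, rfl⟩

theorem f₀_mem_negSub : f₀ ∈ negSub :=
  Subalgebra.smul_mem _ (gen_mem_negSub (by simp [Gen.IsNeg])) _

theorem f₁_mem_negSub : f₁ ∈ negSub := gen_mem_negSub (by simp [Gen.IsNeg])

theorem base_mem_negSub (i : Fin 2) : base i ∈ negSub := by
  fin_cases i
  · change base 0 ∈ negSub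
    rw [base_zero_eq]; exact mul_mem f₀_mem_negSub f₀_mem_negSub
  · change base 1 ∈ negSub
    rw [base_one_eq]; exact f₁_mem_negSub

theorem adRight_pow_mem_negSub (i : Fin 2) (n : ℕ) {u : Env} (hu : u ∈ negSub) :
    (adRight (base i) ^ n) u ∈ negSub := by
  induction n with
  | zero => simpa using hu
  | succ n ih =>
    rw [pow_succ', Module.End.mul_apply, adRight_apply]
    exact sub_mem (mul_mem ih (base_mem_negSub i)) (mul_mem (base_mem_negSub i) ih)

theorem cpow_natCast_mem_powNeg (i : Fin 2) (n : ℕ) : cpow i n ∈ powNeg := by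
  rw [cpow_natCast]; exact toPow_mem_powNeg (pow_mem (base_mem_negSub i) n)

/-- The elements that a power of `base i` moves into the enveloping algebra of `𝔫₋`. -/
def locNeg (i : Fin 2) : Submodule ℂ PowAlg where
  carrier := {x | ∃ N : ℕ, cpow i N * x ∈ powNeg}
  zero_mem' := ⟨0, by rw [mul_zero]; exact zero_mem _⟩
  add_mem' := by
    rintro x y ⟨p, hp⟩ ⟨q, hq⟩
    refine ⟨p + q, ?_⟩
    rw [mul_add, Nat.cast_add]
    refine add_mem ?_ ?_
    · rw [add_comm, cpow_add, mul_assoc]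
      exact mul_mem (cpow_natCast_mem_powNeg i q) hp
    · rw [cpow_add, mul_assoc]
      exact mul_mem (cpow_natCast_mem_powNeg i p) hq
  smul_mem' := by
    rintro c x ⟨p, hp⟩
    exact ⟨p, by rw [mul_smul_comm]; exact Subalgebra.smul_mem _ hp c⟩

theorem cpow_intCast_mul_mem_locNeg (i : Fin 2) (k : ℤ) {x : PowAlg} (hx : x ∈ powNeg) :
    cpow i k * x ∈ locNeg i := by
  -- Multiplying by the power `|k|` makes the total exponent `|k| + k` a natural number.
  refine ⟨k.natAbs, ?_⟩
  obtain ⟨n, hn⟩ : ∃ n : ℕ, (k.natAbs : ℤ) + k = n := ⟨((k.natAbs : ℤ) + k).toNat, by omega⟩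
  have : (k.natAbs : ℂ) + k = n := by
    have := congrArg (Int.cast : ℤ → ℂ) hn
    rwa [Int.cast_add, Int.cast_natCast, Int.cast_natCast] at this
  rw [← mul_assoc, ← cpow_add, this]
  exact mul_mem (cpow_natCast_mem_powNeg i n) hx

-- Pushing the right-hand power to the left by the commutator formula leaves the integral powers `k
-- - n` with coefficients `Ring.choose (q t) n`, polynomial in `t`; nilpotency makes the number of
-- terms independent of `t`.
open Polynomial in
theorem cpow_mul_mul_cpow_mem_polyFun (i : Fin 2) {y : ℂ → PowAlg}
    (hy : y ∈ polyFun (Subalgebra.toSubmodule powNeg)) {p q : ℂ → ℂ} (k : ℤ)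
    (hpq : ∀ t, p t + q t = k) (Q : ℂ[X]) (hQ : ∀ t, q t = Q.eval t) :
    (fun t => cpow i (p t) * y t * cpow i (q t)) ∈ polyFun (locNeg i) := by
  induction hy using Submodule.span_induction with
  | mem x h =>
    obtain ⟨P, w, ⟨u, hu, rfl⟩, rfl⟩ := h
    obtain ⟨N, hN⟩ := mem_adNilSub_base i u
    choose C hC using exists_choose_eq_eval
    have : (fun t => cpow i (p t) * (P.eval t • (toPow : Env →+* PowAlg) u) * cpow i (q t))
        = ∑ n ∈ Finset.range N, fun t => (P * (C n).comp Q).eval t •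
          (cpow i ((k - n : ℤ) : ℂ) * toPow ((adRight (base i) ^ n) u)) := by
      funext t
      change cpow i (p t) * (P.eval t • toPow u) * cpow i (q t) = _
      rw [Finset.sum_apply, mul_smul_comm, smul_mul_assoc, mul_assoc, toPow_mul_cpow i _ hN,
        Finset.mul_sum, Finset.smul_sum]
      refine Finset.sum_congr rfl fun n _ => ?_
      rw [eval_mul, eval_comp, ← hC, ← hQ, mul_smul_comm, mul_smul, ← mul_assoc, ← cpow_add,
        ← add_sub_assoc, hpq]
      push_cast; rfl
    change (fun t => cpow i (p t) * (P.eval t • (toPow : Env →+* PowAlg) u) * cpow i (q t)) ∈ _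
    rw [this]
    exact Submodule.sum_mem _ fun n _ => eval_smul_mem_polyFun _
      (cpow_intCast_mul_mem_locNeg i _ (toPow_mem_powNeg (adRight_pow_mem_negSub i n hu)))
  | zero => convert (polyFun (locNeg i)).zero_mem using 1; funext t; simp
  | add x y _ _ hx hy =>
    convert (polyFun (locNeg i)).add_mem hx hy using 1
    funext t; simp [mul_add, add_mul]
  | smul c x _ hx =>
    convert (polyFun (locNeg i)).smul_mem c hx using 1
    funext t; simp

end Localization

/-! ### Raising generators against `U(𝔫₋)` -/

section ChevalleyPair

/-- The properties of a raising generator `e` with coroot `h` used to extract identities in the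
enveloping algebra of `𝔫₋` from identities in `U`. -/
structure ChevalleyPair (e h : Env) : Prop where
  decomp : ∀ z ∈ negSub, ∃ c ∈ negSub, ∃ a ∈ negSub, ∃ b ∈ negSub, e * z = c * e + a * h + b
  hwv : ∀ x : ℂ, ∃ k j : ℂ, e • hwv k j = 0 ∧ (h - x • 1) • hwv k j = 0

theorem negSub_induction {P : (z : Env) → z ∈ negSub → Prop} (one : P 1 (one_mem _))
    (add : ∀ a b ha hb, P a ha → P b hb → P (a + b) (add_mem ha hb))
    (smul : ∀ (c : ℂ) a ha, P a ha → P (c • a) (Subalgebra.smul_mem _ ha c))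
    (mul : ∀ x a (hx : x.IsNeg) (ha : a ∈ negSub), P a ha →
      P (gen x * a) (mul_mem (gen_mem_negSub hx) ha)) {z : Env} (hz : z ∈ negSub) : P z hz := by
  have hmem : ∀ w, envIncl closed_isNeg w ∈ negSub := fun w => ⟨w, rfl⟩
  have key : ∀ w z (hz : z ∈ negSub), z = envIncl closed_isNeg w → P z hz := by
    intro w
    induction w using affine.envOf_induction with
    | one => intro z hz h; rw [map_one] at h; subst h; exact one
    | add a b ha hb =>
      intro z hz h; rw [map_add] at h; subst h
      exact add _ _ (hmem a) (hmem b) (ha _ _ rfl) (hb _ _ rfl)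
    | smul c a ha =>
      intro z hz h; rw [map_smul] at h; subst h
      exact smul c _ (hmem a) (ha _ _ rfl)
    | mul x a hx ha =>
      intro z hz h; rw [map_mul, envIncl_of closed_isNeg hx] at h; subst h
      exact mul x _ hx (hmem a) (ha _ _ rfl)
  obtain ⟨w, hw⟩ := id hz
  exact key w z hz hw.symm

theorem exists_mul_eq_of_gen {h : Env}
    (hh : ∀ x : Gen, x.IsNeg → ∃ x' ∈ negSub, h * gen x = gen x * h + x') {z : Env}
    (hz : z ∈ negSub) : ∃ z' ∈ negSub, h * z = z * h + z' := by
  induction hz using negSub_induction with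
  | one => exact ⟨0, zero_mem _, by rw [mul_one, one_mul, add_zero]⟩
  | add a b _ _ ha hb =>
    obtain ⟨a', ha', ha⟩ := ha
    obtain ⟨b', hb', hb⟩ := hb
    exact ⟨a' + b', add_mem ha' hb', by rw [mul_add, ha, hb, add_mul]; abel⟩
  | smul c a _ ha =>
    obtain ⟨a', ha', ha⟩ := ha
    exact ⟨c • a', Subalgebra.smul_mem _ ha' c, by
      rw [mul_smul_comm, ha, smul_add, smul_mul_assoc]⟩
  | mul x a hx han ha =>
    obtain ⟨a', ha', ha⟩ := ha
    obtain ⟨x', hx', hxx⟩ := hh x hx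
    refine ⟨gen x * a' + x' * a, add_mem (mul_mem (gen_mem_negSub hx) ha') (mul_mem hx' han), ?_⟩
    rw [← mul_assoc, hxx, add_mul, mul_assoc, ha, mul_add, ← mul_assoc, add_assoc]

/-- A simple raising generator commutes with each negative generator up to sign, an element of
`U(𝔫₋)` and a multiple of its own coroot. Moving it through a word therefore creates at most one `h`
per term, which can then be moved to the right. -/
theorem exists_decomp_of_gen {e h : Env}
    (hh : ∀ x : Gen, x.IsNeg → ∃ x' ∈ negSub, h * gen x = gen x * h + x')
    (he : ∀ x : Gen, x.IsNeg → ∃ s κ : ℂ, ∃ x' ∈ negSub,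
      e * gen x = s • (gen x * e) + x' + κ • h) {z : Env} (hz : z ∈ negSub) :
    ∃ c ∈ negSub, ∃ a ∈ negSub, ∃ b ∈ negSub, e * z = c * e + a * h + b := by
  induction hz using negSub_induction with
  | one =>
    exact ⟨1, one_mem _, 0, zero_mem _, 0, zero_mem _, by
      rw [mul_one, one_mul, zero_mul, add_zero, add_zero]⟩
  | add z z' _ _ hz hz' =>
    obtain ⟨c, hc, a, ha, b, hb, h1⟩ := hz
    obtain ⟨c', hc', a', ha', b', hb', h2⟩ := hz'
    exact ⟨c + c', add_mem hc hc', a + a', add_mem ha ha', b + b', add_mem hb hb', by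
      rw [mul_add, h1, h2, add_mul, add_mul]; abel⟩
  | smul r z _ hz =>
    obtain ⟨c, hc, a, ha, b, hb, h1⟩ := hz
    exact ⟨r • c, Subalgebra.smul_mem _ hc r, r • a, Subalgebra.smul_mem _ ha r, r • b,
      Subalgebra.smul_mem _ hb r, by
      rw [mul_smul_comm, h1, smul_add, smul_add, smul_mul_assoc, smul_mul_assoc]⟩
  | mul x z hx hzn hz =>
    obtain ⟨c, hc, a, ha, b, hb, h1⟩ := hz
    obtain ⟨s, κ, x', hx', h2⟩ := he x hx
    obtain ⟨z', hz', h3⟩ := exists_mul_eq_of_gen hh hzn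
    have hg := gen_mem_negSub hx
    refine ⟨s • (gen x * c), Subalgebra.smul_mem _ (mul_mem hg hc) s,
      s • (gen x * a) + κ • z, add_mem (Subalgebra.smul_mem _ (mul_mem hg ha) s)
        (Subalgebra.smul_mem _ hzn κ), s • (gen x * b) + x' * z + κ • z',
      add_mem (add_mem (Subalgebra.smul_mem _ (mul_mem hg hb) s) (mul_mem hx' hzn))
        (Subalgebra.smul_mem _ hz' κ), ?_⟩
    rw [← mul_assoc, h2, add_mul, add_mul, smul_mul_assoc, smul_mul_assoc, mul_assoc, h1, h3]
    simp only [mul_add, add_mul, smul_add, smul_mul_assoc, mul_assoc]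
    abel

theorem sum_bracket_mem {a b : Osp12} {n : ℤ} (h : n < 0) : ∑ c, bracket a b c • mode c n ∈ negSub :=
  sum_mem fun _ _ => Subalgebra.smul_mem _ (gen_mem_negSub (x := Gen.mode _ n) (Or.inl h)) _

theorem J₃_mul_gen {x : Gen} (hx : x.IsNeg) : ∃ x' ∈ negSub, J₃ * gen x = gen x * J₃ + x' := by
  cases x with
  | mode a n =>
    have h := mode_mul_mode Jthree a 0 n
    have hk : koszulSign Jthree a = 1 := by cases a <;> rfl
    rw [hk, one_smul, Int.cast_zero, zero_mul, ite_self, zero_smul, add_zero, zero_add] at h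
    refine ⟨_, ?_, sub_eq_iff_eq_add'.1 h⟩
    have hm := gen_mem_negSub hx
    cases a <;> simp [bracket, Pi.single_apply] <;>
      first
      | exact hm
      | exact Subalgebra.smul_mem _ hm _
  | K => exact hx.elim
  | d => exact hx.elim

theorem h₀_mul_gen {x : Gen} (hx : x.IsNeg) : ∃ x' ∈ negSub, h₀ * gen x = gen x * h₀ + x' := by
  obtain ⟨x', hx', h⟩ := J₃_mul_gen hx
  exact ⟨(2 : ℂ) • x', Subalgebra.smul_mem _ hx' _, by
    rw [h₀, smul_mul_assoc, h, smul_add, mul_smul_comm]⟩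

theorem h₁_mul_gen {x : Gen} (hx : x.IsNeg) : ∃ x' ∈ negSub, h₁ * gen x = gen x * h₁ + x' := by
  obtain ⟨x', hx', h⟩ := J₃_mul_gen hx
  exact ⟨(-2 : ℂ) • x', Subalgebra.smul_mem _ hx' _, by
    rw [h₁, sub_mul, smul_mul_assoc, h, commute_K, mul_sub, mul_smul_comm]; module⟩

theorem e₀_mul_gen {x : Gen} (hx : x.IsNeg) :
    ∃ s κ : ℂ, ∃ x' ∈ negSub, e₀ * gen x = s • (gen x * e₀) + x' + κ • h₀ := by
  cases x with
  | mode a n =>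
    suffices ∃ κ : ℂ, ∃ x' ∈ negSub, mode jplus 0 * mode a n
        = koszulSign jplus a • (mode a n * mode jplus 0) + x' + κ • h₀ by
      obtain ⟨κ, x', hx', h⟩ := this
      refine ⟨koszulSign jplus a, ((Real.sqrt 2 : ℝ) : ℂ)⁻¹ * κ, ((Real.sqrt 2 : ℝ) : ℂ)⁻¹ • x',
        Subalgebra.smul_mem _ hx' _, ?_⟩
      change e₀ * mode a n = koszulSign jplus a • (mode a n * e₀) + _ + _
      rw [e₀, smul_mul_assoc, h, mul_smul_comm]
      module
    have h := mode_mul_mode jplus a 0 n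
    rw [Int.cast_zero, zero_mul, ite_self, zero_smul, add_zero, zero_add] at h
    rcases hx with hx | ⟨rfl, ha⟩
    · refine ⟨0, _, sum_bracket_mem (a := jplus) (b := a) hx, ?_⟩
      rw [sub_eq_iff_eq_add'.1 h, zero_smul, add_zero]
    · rcases ha with rfl | rfl
      · refine ⟨0, mode jminus 0, gen_mem_negSub (by simp [Gen.IsNeg]), ?_⟩
        rw [sub_eq_iff_eq_add'.1 h]
        simp [bracket, Pi.single_apply]
      · refine ⟨1, 0, zero_mem _, ?_⟩
        rw [sub_eq_iff_eq_add'.1 h]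
        simp [bracket, Pi.single_apply, h₀, J₃]
  | K => exact hx.elim
  | d => exact hx.elim

theorem e₁_mul_gen {x : Gen} (hx : x.IsNeg) :
    ∃ s κ : ℂ, ∃ x' ∈ negSub, e₁ * gen x = s • (gen x * e₁) + x' + κ • h₁ := by
  cases x with
  | mode a n =>
    have hk : koszulSign Jminus a = 1 := by cases a <;> rfl
    have h := mode_mul_mode Jminus a 1 n
    rw [hk] at h
    rcases lt_trichotomy n (-1) with hn | rfl | hn
    · refine ⟨1, 0, _, sum_bracket_mem (a := Jminus) (b := a) (n := 1 + n) (by omega), ?_⟩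
      rw [if_neg (by omega), zero_smul, add_zero] at h
      rw [zero_smul, add_zero]
      exact sub_eq_iff_eq_add'.1 h
    · have hJ : mode Jminus 0 ∈ negSub := gen_mem_negSub (by simp [Gen.IsNeg])
      have hj : mode jminus 0 ∈ negSub := gen_mem_negSub (by simp [Gen.IsNeg])
      have h' := sub_eq_iff_eq_add'.1 h
      change ∃ s κ : ℂ, ∃ x' ∈ negSub, mode Jminus 1 * mode a (-1)
        = s • (mode a (-1) * mode Jminus 1) + x' + κ • h₁
      rw [h']
      cases a with
      | Jplus =>
        refine ⟨1, 1, 0, zero_mem _, ?_⟩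
        simp [bracket, form, Pi.single_apply, h₁, J₃]
        module
      | Jminus => exact ⟨1, 0, 0, zero_mem _, by simp [bracket, form]⟩
      | Jthree => exact ⟨1, 0, mode Jminus 0, hJ, by simp [bracket, form, Pi.single_apply]⟩
      | jplus =>
        refine ⟨1, 0, (-1 : ℂ) • mode jminus 0, Subalgebra.smul_mem _ hj _, ?_⟩
        simp [bracket, form, Pi.single_apply]
      | jminus => exact ⟨1, 0, 0, zero_mem _, by simp [bracket, form]⟩
    · obtain ⟨rfl, ha⟩ : n = 0 ∧ (a = Jminus ∨ a = jminus) := hx.resolve_left (by omega)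
      refine ⟨1, 0, 0, zero_mem _, ?_⟩
      rw [if_neg (by omega), zero_smul, add_zero] at h
      have h0 : ∑ c, bracket Jminus a c • mode c (1 + 0) = 0 := by
        rcases ha with rfl | rfl <;> simp [bracket]
      rw [h0] at h
      rw [zero_smul, add_zero]
      exact sub_eq_iff_eq_add'.1 h
  | K => exact hx.elim
  | d => exact hx.elim

theorem smul_hwv_eq_zero {k j : ℂ} {x : Env} (h : x ∈ vermaIdeal k j) : x • hwv k j = 0 := by
  rw [hwv, ← map_smul, smul_eq_mul, mul_one]
  exact (Submodule.Quotient.mk_eq_zero _).2 h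

theorem mode_smul_hwv (k j : ℂ) (a : Osp12) {n : ℤ} (hn : 0 < n) : mode a n • hwv k j = 0 :=
  smul_hwv_eq_zero (Submodule.subset_span (Or.inl ⟨a, n, hn, rfl⟩))

theorem e₁_smul_hwv (k j : ℂ) : e₁ • hwv k j = 0 := mode_smul_hwv k j _ one_pos

theorem smul_eq_algebraMap_mul (c : ℂ) (x : Env) : c • x = algebraMap ℂ Env c * x :=
  Algebra.smul_def c x

theorem e₀_smul_hwv (k j : ℂ) : e₀ • hwv k j = 0 := by
  rw [e₀, smul_eq_algebraMap_mul, mul_smul,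
    smul_hwv_eq_zero (Submodule.subset_span (Or.inr (by simp))), smul_zero]

theorem J₃_sub_smul_hwv (k j : ℂ) : (J₃ - algebraMap ℂ Env j) • hwv k j = 0 :=
  smul_hwv_eq_zero (Submodule.subset_span (Or.inr (by simp [J₃])))

theorem K_sub_smul_hwv (k j : ℂ) : (gen Gen.K - algebraMap ℂ Env k) • hwv k j = 0 :=
  smul_hwv_eq_zero (Submodule.subset_span (Or.inr (by simp)))

theorem d_smul_hwv (k j : ℂ) : gen Gen.d • hwv k j = 0 :=
  smul_hwv_eq_zero (Submodule.subset_span (Or.inr (by simp)))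

theorem h₀_sub_smul_hwv (k j : ℂ) : (h₀ - (2 * j) • 1) • hwv k j = 0 := by
  have : h₀ - (2 * j) • (1 : Env) = algebraMap ℂ Env 2 * (J₃ - algebraMap ℂ Env j) := by
    rw [← smul_eq_algebraMap_mul, h₀, Algebra.algebraMap_eq_smul_one]; module
  rw [this, mul_smul, J₃_sub_smul_hwv, smul_zero]

theorem h₁_sub_smul_hwv (k j : ℂ) : (h₁ - (k - 2 * j) • 1) • hwv k j = 0 := by
  have : h₁ - (k - 2 * j) • (1 : Env) = (gen Gen.K - algebraMap ℂ Env k)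
      + algebraMap ℂ Env (-2) * (J₃ - algebraMap ℂ Env j) := by
    rw [← smul_eq_algebraMap_mul, h₁, Algebra.algebraMap_eq_smul_one,
      Algebra.algebraMap_eq_smul_one]; module
  rw [this, add_smul, mul_smul, J₃_sub_smul_hwv, K_sub_smul_hwv, smul_zero, add_zero]

theorem chevalleyPair_zero : ChevalleyPair e₀ h₀ where
  decomp _ hz := exists_decomp_of_gen (fun _ => h₀_mul_gen) (fun _ => e₀_mul_gen) hz
  hwv x := ⟨0, x / 2, e₀_smul_hwv _ _, by
    have := h₀_sub_smul_hwv 0 (x / 2)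
    rwa [mul_div_cancel₀ x two_ne_zero] at this⟩

theorem chevalleyPair_one : ChevalleyPair e₁ h₁ where
  decomp _ hz := exists_decomp_of_gen (fun _ => h₁_mul_gen) (fun _ => e₁_mul_gen) hz
  hwv x := ⟨x, 0, e₁_smul_hwv _ _, by simpa using h₁_sub_smul_hwv x 0⟩

end ChevalleyPair

end AffineOsp
end

/-! ### Removing denominators with raising generators -/

noncomputable section
namespace AffineOsp
open Finsupp (linearCombination)
open Osp12 SuperBracket

section Extraction

variable {e h : Env}

/-- Comparison of coefficients in `e z = c e + a h + b`. Uniqueness is tested on highest weight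
vectors on which `h` has an arbitrary eigenvalue, where `U(𝔫₋)` acts freely. The coefficient of `e`
need not be controlled, since `e` kills these vectors. -/
theorem ChevalleyPair.exists_env (hp : ChevalleyPair e h) {z : Env} (hz : z ∈ negSub) :
    ∃ a ∈ negSub, ∃ b ∈ negSub, ∀ g ∈ negSub, ∀ A ∈ negSub, ∀ B ∈ negSub, ∀ (C : Env) (l : ℂ),
      g * (e * z) = C * e + A * (h - l • 1) + B → g * (l • a + b) = B ∧ g * a = A := by
  obtain ⟨c, hc, a, ha, b, hb, hd⟩ := hp.decomp z hz
  refine ⟨a, ha, b, hb, fun g hg A hA B hB C l hrel => ?_⟩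
  have key : ∀ x : ℂ, g * (x • a + b) = (x - l) • A + B := by
    intro x
    obtain ⟨k, j, h1, h2⟩ := hp.hwv x
    have hmem : g * (x • a + b) - ((x - l) • A + B) ∈ negSub :=
      sub_mem (mul_mem hg (add_mem (Subalgebra.smul_mem _ ha x) hb))
        (add_mem (Subalgebra.smul_mem _ hA _) hB)
    have heq : g * (x • a + b) - ((x - l) • A + B)
        = (C - g * c) * e + (A - g * a) * (h - x • 1) := by
      rw [hd] at hrel
      simp only [mul_add, sub_mul, mul_sub, mul_smul_comm, mul_one, mul_assoc] at hrel ⊢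
      linear_combination (norm := module) hrel
    refine sub_eq_zero.1 (eq_zero_of_smul_hwv hmem (k := k) (j := j) ?_)
    rw [heq, add_smul, mul_smul, mul_smul, h1, h2, smul_zero, smul_zero, add_zero]
  -- The identity is affine in the eigenvalue: `x = l` isolates `B`, and the difference with `x = l
  -- + 1` isolates `A`.
  have k0 := key l
  have k1 := key (l + 1)
  rw [sub_self, zero_smul, zero_add] at k0
  refine ⟨k0, ?_⟩
  rw [mul_add, mul_smul_comm] at k0 k1
  linear_combination (norm := module) k1 - k0

theorem ChevalleyPair.exists_powNeg (hp : ChevalleyPair e h) {Z : PowAlg} (hZ : Z ∈ powNeg) :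
    ∃ a ∈ powNeg, ∃ b ∈ powNeg, ∀ g ∈ powNeg, ∀ A ∈ powNeg, ∀ B ∈ powNeg, ∀ C ∈ powNeg, ∀ l : ℂ,
      g * (toPow e * Z) = C * toPow e + A * (toPow h - l • 1) + B →
        g * (l • a + b) = B ∧ g * a = A := by
  obtain ⟨z, hz, rfl⟩ := hZ
  obtain ⟨a, ha, b, hb, H⟩ := hp.exists_env hz
  refine ⟨toPow a, toPow_mem_powNeg ha, toPow b, toPow_mem_powNeg hb, ?_⟩
  rintro _ ⟨g, hg, rfl⟩ _ ⟨A, hA, rfl⟩ _ ⟨B, hB, rfl⟩ _ ⟨C, -, rfl⟩ l hrel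
  change toPow g * (toPow e * toPow z)
    = toPow C * toPow e + toPow A * (toPow h - l • 1) + toPow B at hrel
  change toPow g * (l • toPow a + toPow b) = toPow B ∧ toPow g * toPow a = toPow A
  obtain ⟨h1, h2⟩ := H g hg A hA B hB C l (toPow_injective (by
    simpa only [map_mul, map_add, map_sub, map_smul, map_one] using hrel))
  exact ⟨by rw [← h1]; simp only [map_mul, map_add, map_smul], by rw [← h2, map_mul]⟩

variable {i : Fin 2} {F a' : PowAlg} {η l : ℂ}

/-- In `e F = η F e + a (h - l)` with `F` in the enveloping algebra of `𝔫₋`, so is `a`. -/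
theorem ChevalleyPair.coeff_mem (hp : ChevalleyPair e h) (hF : F ∈ powNeg) (ha : a' ∈ locNeg i)
    (hrel : toPow e * F = η • (F * toPow e) + a' * (toPow h - l • 1)) : a' ∈ powNeg := by
  obtain ⟨K, hK⟩ := ha
  obtain ⟨a, ha, b, hb, H⟩ := hp.exists_powNeg hF
  have hg := cpow_natCast_mem_powNeg i K
  obtain ⟨-, h2⟩ := H _ hg _ hK 0 (zero_mem _) _ (Subalgebra.smul_mem _ (mul_mem hg hF) η) l (by
    rw [hrel]; simp only [mul_add, mul_smul_comm, smul_mul_assoc, mul_assoc, add_zero])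
  rwa [← (isUnit_cpow i K).mul_left_cancel h2]

/-- One factor `f` is removed from `φ F = f ψ F`. In `e (φ F)` the term free of `e` and of `h - l`
is `(γ (l + w) + δ) ψ F`, and comparison with the decomposition of `e (φ F)` in `U(𝔫₋)` identifies
it with an element of `U(𝔫₋)`. The comparison needs denominators cleared; the clearing factor is a
unit and is cancelled afterwards. -/
theorem ChevalleyPair.descend (hp : ChevalleyPair e h) {f : Env} {φ ψ : PowAlg} {ε γ δ w : ℂ}
    (hf : f ∈ negSub) (hfu : IsUnit (toPow f)) (hfc : ∀ N : ℕ, Commute (cpow i N) (toPow f))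
    (hφ : φ ∈ powNeg) (hφc : ∀ N : ℕ, Commute (cpow i N) φ) (hψ : φ = toPow f * ψ)
    (hφrel : toPow e * φ = ε • (φ * toPow e) + ψ * (γ • toPow h + δ • 1))
    (hrel : toPow e * F = η • (F * toPow e) + a' * (toPow h - l • 1))
    (hw : toPow h * F = F * (toPow h + w • 1)) (hc : γ * (l + w) + δ ≠ 0)
    (ha : a' ∈ locNeg i) (hF : φ * F ∈ powNeg) : ψ * F ∈ powNeg := by
  obtain ⟨K, hK⟩ := ha
  obtain ⟨a, ha, b, hb, H⟩ := hp.exists_powNeg hF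
  have hG := cpow_natCast_mem_powNeg i K
  have hf' := toPow_mem_powNeg hf
  set G := cpow i K
  -- `G` clears the denominator of `a'` and `f` turns `ψ F` back into `φ F`, so multiplication by `G
  -- f` puts every term of the relation into `U(𝔫₋)`.
  have hg : G * toPow f ∈ powNeg := mul_mem hG hf'
  have h1 : G * toPow f * (φ * a') = toPow f * (φ * (G * a')) := by
    rw [(hfc K).eq, mul_assoc, ← mul_assoc φ, ← (hφc K).eq, mul_assoc]
  have h2 : G * toPow f * (ψ * F) = G * (φ * F) := by rw [hψ]; simp only [mul_assoc]
  have h3 : toPow e * (φ * F) = (ε * η) • (φ * F * toPow e)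
      + (ε • (φ * a') + γ • (ψ * F)) * (toPow h - l • 1) + (γ * (l + w) + δ) • (ψ * F) := by
    rw [← mul_assoc, hφrel, add_mul, smul_mul_assoc, mul_assoc, hrel, mul_assoc ψ, add_mul,
      smul_mul_assoc, hw, smul_mul_assoc, one_mul]
    simp only [mul_add, add_mul, mul_sub, mul_smul_comm, smul_mul_assoc, mul_one, mul_assoc]
    module
  obtain ⟨h4, -⟩ := H _ hg (ε • (toPow f * (φ * (G * a'))) + γ • (G * (φ * F)))
    (add_mem (Subalgebra.smul_mem _ (mul_mem hf' (mul_mem hφ hK)) ε)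
      (Subalgebra.smul_mem _ (mul_mem hG hF) γ)) ((γ * (l + w) + δ) • (G * (φ * F)))
    (Subalgebra.smul_mem _ (mul_mem hG hF) _) ((ε * η) • (G * toPow f * (φ * F)))
    (Subalgebra.smul_mem _ (mul_mem hg hF) _) l (by
      rw [h3, mul_add, mul_add, ← h1, ← h2, mul_smul_comm, mul_smul_comm, ← mul_assoc _ _ (toPow e),
        smul_mul_assoc, ← mul_assoc _ _ (toPow h - l • 1), mul_add, mul_smul_comm, mul_smul_comm])
  rw [← h2, ← mul_smul_comm] at h4
  have h5 := ((isUnit_cpow i K).mul hfu).mul_left_cancel h4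
  have h6 : ψ * F = (γ * (l + w) + δ)⁻¹ • (l • a + b) := by rw [h5, inv_smul_smul₀ hc]
  rw [h6]
  exact Subalgebra.smul_mem _ (add_mem (Subalgebra.smul_mem _ ha l) hb) _

/-- Descent from `f₁^(N+1) F` to `f₁^N F` meets the scalar `(N + 1) (l + w - N)`, which is nonzero
as soon as `l + w` is not real. -/
theorem mem_powNeg_of_rel_one {w : ℂ}
    (hrel : toPow e₁ * F = η • (F * toPow e₁) + a' * (toPow h₁ - l • 1))
    (hw : toPow h₁ * F = F * (toPow h₁ + w • 1)) (hlw : (l + w).im ≠ 0)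
    (ha : a' ∈ locNeg 1) (hF : F ∈ locNeg 1) : F ∈ powNeg := by
  obtain ⟨N, hN⟩ := hF
  induction N with
  | zero => rwa [Nat.cast_zero, cpow_zero, one_mul] at hN
  | succ N ih =>
    refine ih ?_
    refine chevalleyPair_one.descend (i := 1) (f := f₁) (φ := cpow 1 (N + 1 : ℕ)) (ψ := cpow 1 N)
      (ε := 1) (γ := N + 1) (δ := -((N + 1) * N)) f₁_mem_negSub ?_ (fun _ => ?_)
      (cpow_natCast_mem_powNeg 1 _) (fun _ => cpow_comm _ _ _) ?_ ?_ hrel hw ?_ ha hN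
    · rw [← base_one_eq, ← cpow_one]; exact isUnit_cpow _ _
    · rw [← base_one_eq, ← cpow_one]; exact cpow_comm _ _ _
    · rw [← base_one_eq, ← cpow_one, ← cpow_add]; push_cast; rw [add_comm]
    · rw [e₁_mul_cpow]
      push_cast
      rw [add_sub_cancel_right, one_smul]
      congr 2
      module
    · intro h0
      have h1 : ((N : ℂ) + 1) * (l + w - N) = 0 := by linear_combination h0
      have h2 : l + w = N :=
        sub_eq_zero.1 ((mul_eq_zero.1 h1).resolve_left (Nat.cast_add_one_ne_zero N))
      rw [h2] at hlw
      simp at hlw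

/-- Each factor `f₀²` is removed in two steps, one `f₀` at a time. Going from even to odd powers the
scalar is `-(N + 1)`; going from odd to even powers it is `l + w - N`, which is nonzero since `l +
w` is not real. -/
theorem mem_powNeg_of_rel_zero {w : ℂ}
    (hrel : toPow e₀ * F = η • (F * toPow e₀) + a' * (toPow h₀ - l • 1))
    (hw : toPow h₀ * F = F * (toPow h₀ + w • 1)) (hlw : (l + w).im ≠ 0)
    (ha : a' ∈ locNeg 0) (hF : F ∈ locNeg 0) : F ∈ powNeg := by
  have hf := toPow_mem_powNeg f₀_mem_negSub
  obtain ⟨N, hN⟩ := hF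
  induction N with
  | zero => rwa [Nat.cast_zero, cpow_zero, one_mul] at hN
  | succ N ih =>
    refine ih ?_
    refine chevalleyPair_zero.descend (i := 0) (f := f₀) (φ := toPow f₀ * cpow 0 N)
      (ψ := cpow 0 N) (ε := -1) (γ := 1) (δ := -N) f₀_mem_negSub isUnit_toPow_f₀
      (fun _ => (commute_f₀_cpow _).symm) (mul_mem hf (cpow_natCast_mem_powNeg 0 _))
      (fun _ => (commute_f₀_cpow _).symm.mul_right (cpow_comm _ _ _)) rfl ?_ hrel hw ?_ ha ?_
    · rw [e₀_mul_f₀_mul_cpow, one_smul]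
      simp only [mul_sub, mul_add, mul_smul_comm, mul_one, mul_assoc]
      module
    · intro h0
      have h2 : l + w = N := by linear_combination h0
      rw [h2] at hlw
      simp at hlw
    · refine chevalleyPair_zero.descend (i := 0) (f := f₀) (φ := cpow 0 (N + 1 : ℕ))
        (ψ := toPow f₀ * cpow 0 N) (ε := 1) (γ := 0) (δ := -(N + 1)) f₀_mem_negSub isUnit_toPow_f₀
        (fun _ => (commute_f₀_cpow _).symm) (cpow_natCast_mem_powNeg 0 _)
        (fun _ => cpow_comm _ _ _) ?_ ?_ hrel hw ?_ ha hN
      · rw [f₀_mul_f₀_mul_cpow]; push_cast; rfl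
      · rw [e₀_mul_cpow]
        push_cast
        rw [add_sub_cancel_right, one_smul, zero_smul, zero_add, mul_smul_comm, mul_one,
          (commute_f₀_cpow _).eq]
        module
      · rw [zero_mul, zero_add, neg_ne_zero]
        exact Nat.cast_add_one_ne_zero N

end Extraction

/-! ### From non-real `t` to all `t` -/

section Density

theorem polyFun_powNeg_of_locNeg {i : Fin 2} {F : ℂ → PowAlg} (hF : F ∈ polyFun (locNeg i))
    (h : ∀ t : ℂ, t.im ≠ 0 → F t ∈ powNeg) :
    F ∈ polyFun (Subalgebra.toSubmodule powNeg) := by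
  refine polyFun_of_infinite hF (s := {t | t.im ≠ 0}) ?_ h
  refine Set.infinite_of_injective_forall_mem (f := fun n : ℕ => ((n : ℂ) + 1) * Complex.I)
    (fun m n hmn => ?_) (fun n => ?_)
  · have := congrArg Complex.im hmn
    simpa using this
  · simp; positivity

end Density
end AffineOsp
end

/-! ### Raising operators on wrapped products -/

noncomputable section
namespace AffineOsp
open Finsupp (linearCombination)
open Osp12 SuperBracket

section Sandwich

variable {A : Type} [Ring A] [Algebra ℂ A]

theorem mul_sandwich_of_commute {E H P Q Y a : A} {η l v : ℂ} (hP : Commute E P) (hQ : Commute E Q)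
    (hHQ : H * Q = Q * (H + v • 1)) (hY : E * Y = η • (Y * E) + a * (H - l • 1)) :
    E * (P * Y * Q) = η • (P * Y * Q * E) + P * a * Q * (H - (l - v) • 1) := by
  calc E * (P * Y * Q) = (E * P) * Y * Q := by simp only [mul_assoc]
    _ = P * (E * Y) * Q := by rw [hP.eq]; simp only [mul_assoc]
    _ = η • (P * Y * (E * Q)) + P * a * (H * Q) - l • (P * a * Q) := by
      rw [hY]
      simp only [mul_add, add_mul, mul_sub, sub_mul, mul_smul_comm, smul_mul_assoc, mul_one,
        mul_assoc]
      module
    _ = _ := by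
      rw [hQ.eq, hHQ]
      simp only [mul_add, mul_sub, mul_smul_comm, mul_one, mul_assoc]
      module

/-- On a vector with `H = q - 1`, the power `f^q` is singular and changes the eigenvalue to `-q -
1`, where `Y` is singular. Then `Y` raises it by `p + q` to `p - 1`, at which `f^p` is singular
again. As an operator identity, all obstructions carry the factor `H - (q - 1)`. -/
theorem mul_sandwich_even {E H P P' Q Q' Y a : A} {p q : ℂ}
    (hP : E * P = P * E + P' * (p • H - (p * (p - 1)) • 1))
    (hQ : E * Q = Q * E + Q' * (q • H - (q * (q - 1)) • 1))
    (hHQ : H * Q = Q * (H + (-2 * q) • 1)) (hHY : H * Y = Y * (H + (p + q) • 1))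
    (hY : E * Y = (1 : ℂ) • (Y * E) + a * (H - (-q - 1) • 1)) :
    E * (P * Y * Q) = (1 : ℂ) • (P * Y * Q * E)
      + (q • (P * Y * Q') + P * a * Q + p • (P' * Y * Q)) * (H - (q - 1) • 1) := by
  calc E * (P * Y * Q) = (E * P) * Y * Q := by simp only [mul_assoc]
    _ = P * (E * Y) * Q + p • (P' * (H * Y) * Q) - (p * (p - 1)) • (P' * Y * Q) := by
      rw [hP]
      simp only [mul_sub, add_mul, sub_mul, mul_smul_comm, smul_mul_assoc, mul_one, mul_assoc]
      module
    _ = P * Y * (E * Q) + P * a * (H * Q) - (-q - 1) • (P * a * Q)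
        + p • (P' * Y * (H * Q)) + (p * (p + q)) • (P' * Y * Q)
        - (p * (p - 1)) • (P' * Y * Q) := by
      rw [hY, hHY]
      simp only [mul_add, add_mul, mul_sub, sub_mul, mul_smul_comm, smul_mul_assoc, mul_one,
        mul_assoc]
      module
    _ = _ := by
      rw [hQ, hHQ]
      simp only [mul_add, add_mul, mul_sub, mul_smul_comm, smul_mul_assoc, mul_one, mul_assoc]
      module

/-- The same pattern for the odd root: the eigenvalue of `H` passes from `(q - 1)/2` through `(-q -
1)/2` to `(p - 1)/2`. The sign `η` records the parity of `Y`; passing the two odd powers changes it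
twice. -/
theorem mul_sandwich_odd {E H P P' Q Q' Y a : A} {p q η : ℂ}
    (hP : E * P = P' * (H - ((p - 1) / 2) • 1) - P * E)
    (hQ : E * Q = Q' * (H - ((q - 1) / 2) • 1) - Q * E)
    (hHQ : H * Q = Q * (H + (-q) • 1)) (hHY : H * Y = Y * (H + ((p + q) / 2) • 1))
    (hY : E * Y = η • (Y * E) + a * (H - ((-q - 1) / 2) • 1)) :
    E * (P * Y * Q) = η • (P * Y * Q * E)
      + (P' * Y * Q - η • (P * Y * Q') - P * a * Q) * (H - ((q - 1) / 2) • 1) := by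
  calc E * (P * Y * Q) = (E * P) * Y * Q := by simp only [mul_assoc]
    _ = P' * (H * Y) * Q - ((p - 1) / 2) • (P' * Y * Q) - P * (E * Y) * Q := by
      rw [hP]
      simp only [mul_sub, sub_mul, mul_smul_comm, smul_mul_assoc, mul_one, mul_assoc]
    _ = P' * Y * (H * Q) + ((p + q) / 2 - (p - 1) / 2) • (P' * Y * Q) - η • (P * Y * (E * Q))
        - P * a * (H * Q) + ((-q - 1) / 2) • (P * a * Q) := by
      rw [hY, hHY]
      simp only [mul_add, add_mul, mul_sub, sub_mul, mul_smul_comm, smul_mul_assoc, mul_one,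
        mul_assoc]
      module
    _ = _ := by
      rw [hQ, hHQ]
      simp only [mul_add, sub_mul, mul_sub, mul_smul_comm, smul_mul_assoc, mul_one, mul_assoc]
      module

theorem weight_sandwich {x P Q Y : A} {p w q : ℂ} (hP : x * P = P * (x + p • 1))
    (hY : x * Y = Y * (x + w • 1)) (hQ : x * Q = Q * (x + q • 1)) :
    x * (P * Y * Q) = P * Y * Q * (x + (p + w + q) • 1) := by
  calc x * (P * Y * Q) = (x * P) * Y * Q := by simp only [mul_assoc]
    _ = P * (x * Y) * Q + p • (P * Y * Q) := by
      rw [hP]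
      simp only [mul_add, add_mul, mul_smul_comm, smul_mul_assoc, mul_one, mul_assoc]
    _ = P * Y * (x * Q) + (p + w) • (P * Y * Q) := by
      rw [hY]
      simp only [mul_add, add_mul, mul_smul_comm, smul_mul_assoc, mul_one, mul_assoc]
      module
    _ = _ := by
      rw [hQ]
      simp only [mul_add, mul_smul_comm, mul_one, mul_assoc]
      module

end Sandwich

/-! ### Weights of the factors -/

section Weights

theorem f₀pow_eq (x : ℂ) : f₀pow x = cpow 0 ((x - 1) / 2) * toPow f₀ := (commute_f₀_cpow _).eq

theorem isUnit_f₀pow (x : ℂ) : IsUnit (f₀pow x) := isUnit_toPow_f₀.mul (isUnit_cpow _ _)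

theorem J₃_mul_f₀pow (x : ℂ) : toPow J₃ * f₀pow x = f₀pow x * (toPow J₃ + (-(x / 2)) • 1) := by
  rw [f₀pow, ← mul_assoc, ← map_mul, J₃_mul_f₀, map_sub, map_mul, map_smul, sub_mul, mul_assoc,
    J₃_mul_cpow_zero]
  simp only [mul_add, mul_sub, mul_smul_comm, smul_mul_assoc, mul_one, mul_assoc]
  module

theorem J₃_mul_f₁pow (x : ℂ) : toPow J₃ * f₁pow x = f₁pow x * (toPow J₃ + x • 1) :=
  J₃_mul_cpow_one x

theorem d_mul_f₀pow (x : ℂ) :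
    toPow (gen Gen.d) * f₀pow x = f₀pow x * (toPow (gen Gen.d) + (0 : ℂ) • 1) := by
  rw [f₀pow, ← mul_assoc, ← map_mul, d_mul_f₀, map_mul, mul_assoc, (d_mul_cpow_zero _).eq, zero_smul,
    add_zero, mul_assoc]

theorem d_mul_f₁pow (x : ℂ) :
    toPow (gen Gen.d) * f₁pow x = f₁pow x * (toPow (gen Gen.d) + (-x) • 1) := by
  rw [f₁pow, d_mul_cpow_one]; congr 1; module

theorem commute_K_f₀pow (x : ℂ) : Commute (toPow (gen Gen.K)) (f₀pow x) :=
  Commute.mul_right (by rw [Commute, SemiconjBy, ← map_mul, ← map_mul, commute_K])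
    (commute_K_cpow _ _)

theorem commute_K_of_mem {F : PowAlg} (hF : F ∈ powNeg) : Commute (toPow (gen Gen.K)) F := by
  obtain ⟨u, -, rfl⟩ := hF
  change toPow (gen Gen.K) * toPow u = toPow u * toPow (gen Gen.K)
  rw [← map_mul, ← map_mul, commute_K]

theorem h₀_mul_of_weight {F : PowAlg} {w : ℂ} (h : toPow J₃ * F = F * (toPow J₃ + w • 1)) :
    toPow h₀ * F = F * (toPow h₀ + (2 * w) • 1) := by
  rw [h₀, map_smul, smul_mul_assoc, h]
  simp only [mul_add, mul_smul_comm, mul_one]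
  module

theorem h₁_mul_of_weight {F : PowAlg} {w : ℂ} (hK : Commute (toPow (gen Gen.K)) F)
    (h : toPow J₃ * F = F * (toPow J₃ + w • 1)) :
    toPow h₁ * F = F * (toPow h₁ + (-2 * w) • 1) := by
  rw [h₁, map_sub, map_smul, sub_mul, smul_mul_assoc, h, hK.eq]
  simp only [mul_add, mul_sub, mul_smul_comm, mul_one]
  module

theorem e₀_mul_f₀pow (x : ℂ) : toPow e₀ * f₀pow x
    = cpow 0 ((x - 1) / 2) * (toPow h₀ - ((x - 1) / 2) • 1) - f₀pow x * toPow e₀ :=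
  e₀_mul_f₀_mul_cpow _

theorem commute_e₁_f₀pow (x : ℂ) : Commute (toPow e₁) (f₀pow x) :=
  Commute.mul_right (by rw [Commute, SemiconjBy, ← map_mul, ← map_mul, e₁_mul_f₀])
    (commute_e₁_cpow _)

end Weights

/-! ### Polynomial families of singular elements -/

section Families

/-- A polynomial family `F` of elements of the enveloping algebra of `𝔫₋`, of weight `w` and
`d`-degree `δ`, such that `F(t)` applied to the highest weight vector of isospin `J(t)` and level
`(t - 3) / 2` is singular. -/
structure SingularFamily (F : ℂ → PowAlg) (J : ℂ → ℂ) (w δ : ℂ) : Prop where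
  mem : F ∈ polyFun (Subalgebra.toSubmodule powNeg)
  rel_zero : ∃ η : ℂ, ∃ a ∈ polyFun (Subalgebra.toSubmodule powNeg), ∀ t,
    toPow e₀ * F t = η • (F t * toPow e₀) + a t * (toPow h₀ - (2 * J t) • 1)
  rel_one : ∃ a ∈ polyFun (Subalgebra.toSubmodule powNeg), ∀ t,
    toPow e₁ * F t = (1 : ℂ) • (F t * toPow e₁)
      + a t * (toPow h₁ - ((t - 3) / 2 - 2 * J t) • 1)
  weight : ∀ t, toPow J₃ * F t = F t * (toPow J₃ + w • 1)
  degree : ∀ t, toPow (gen Gen.d) * F t = F t * (toPow (gen Gen.d) + δ • 1)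
  unit : ∀ t, IsUnit (F t)

variable {Y : ℂ → PowAlg} {δ : ℂ}

theorem polyFun_mul_const {a : ℂ → PowAlg} (ha : a ∈ polyFun (Subalgebra.toSubmodule powNeg))
    {x y : PowAlg} (hx : x ∈ powNeg) (hy : y ∈ powNeg) :
    (fun t => x * a t * y) ∈ polyFun (Subalgebra.toSubmodule powNeg) :=
  polyFun_map ((LinearMap.mulRight ℂ y).comp (LinearMap.mulLeft ℂ x))
    (fun _ hw => powNeg.mul_mem (powNeg.mul_mem hx hw) hy) ha

-- The relation for `e₁` is the even sandwich, and that for `e₀` passes through because `e₀`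
-- commutes with powers of `f₁`. Since `p + q = m` is an integer, the family and its coefficients
-- lie in the localization and are polynomial in `t`. Non-real `t` gives membership in `U(𝔫₋)` by
-- descent, and density gives all `t`.
open Polynomial in
theorem SingularFamily.sandwich_f₁ {m : ℤ} {n : ℕ}
    (hY : SingularFamily Y (fun t => ((m : ℂ) - n * t - 1) / 4) (-(m / 2)) δ) :
    SingularFamily
      (fun t => f₁pow ((m + (n + 1) * t) / 2) * Y t * f₁pow ((m - (n + 1) * t) / 2))
      (fun t => (-(m : ℂ) + (n + 2) * t - 1) / 4) (m / 2) (δ - m) := by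
  obtain ⟨hmem, ⟨η, a₀, ha₀, h₀rel⟩, ⟨a₁, ha₁, h₁rel⟩, hwt, hdeg, hunit⟩ := hY
  set p : ℂ → ℂ := fun t => (m + (n + 1) * t) / 2 with hp
  set q : ℂ → ℂ := fun t => (m - (n + 1) * t) / 2 with hq
  set F : ℂ → PowAlg := fun t => f₁pow (p t) * Y t * f₁pow (q t) with hFdef
  set b₁ : ℂ → PowAlg := fun t => q t • (cpow 1 (p t) * Y t * cpow 1 (q t - 1))
    + cpow 1 (p t) * a₁ t * cpow 1 (q t) + p t • (cpow 1 (p t - 1) * Y t * cpow 1 (q t)) with hb₁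
  set b₀ : ℂ → PowAlg := fun t => cpow 1 (p t) * a₀ t * cpow 1 (q t) with hb₀
  have hJ : ∀ t, 2 * ((-(m : ℂ) + (n + 2) * t - 1) / 4) = 2 * (((m : ℂ) - n * t - 1) / 4) - 2 * q t :=
    fun t => by simp only [hq]; ring
  have hJ1 : ∀ t, (t - 3) / 2 - 2 * ((-(m : ℂ) + (n + 2) * t - 1) / 4) = q t - 1 :=
    fun t => by simp only [hq]; ring
  have hpq : ∀ t, p t + q t = m := fun t => by simp only [hp, hq]; ring
  have hwtF : ∀ t, toPow J₃ * F t = F t * (toPow J₃ + ((m : ℂ) / 2) • 1) := fun t => by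
    rw [weight_sandwich (J₃_mul_f₁pow (p t)) (hwt t) (J₃_mul_f₁pow (q t))]
    congr 3
    linear_combination hpq t
  have hKF : ∀ t, Commute (toPow (gen Gen.K)) (F t) := fun t =>
    ((commute_K_cpow _ _).mul_right
      (commute_K_of_mem (apply_mem_of_mem_polyFun hmem t))).mul_right (commute_K_cpow _ _)
  have hrel1 : ∀ t, toPow e₁ * F t = (1 : ℂ) • (F t * toPow e₁) + b₁ t * (toPow h₁ - (q t - 1) • 1) := by
    intro t
    refine mul_sandwich_even (e₁_mul_cpow _) (e₁_mul_cpow _)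
      (h₁_mul_of_weight (commute_K_cpow _ _) (J₃_mul_cpow_one _)) ?_ ?_
    · rw [h₁_mul_of_weight (commute_K_of_mem (apply_mem_of_mem_polyFun hmem t)) (hwt t), hpq]
      congr 3; ring
    · rw [h₁rel]
      congr 4
      simp only [hq]; ring
  have hrel0 : ∀ t, toPow e₀ * F t = η • (F t * toPow e₀)
      + b₀ t * (toPow h₀ - (2 * ((-(m : ℂ) + (n + 2) * t - 1) / 4)) • 1) := by
    intro t
    rw [hJ]
    exact mul_sandwich_of_commute (commute_e₀_cpow _) (commute_e₀_cpow _)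
      (h₀_mul_of_weight (J₃_mul_cpow_one _)) (h₀rel t)
  have hQ : ∀ t, q t = (C (m / 2 : ℂ) - C ((n + 1) / 2 : ℂ) * X).eval t := fun t => by
    simp only [hq, eval_sub, eval_mul, eval_C, eval_X]; ring
  have hP : ∀ t, p t = (C (m / 2 : ℂ) + C ((n + 1) / 2 : ℂ) * X).eval t := fun t => by
    simp only [hp, eval_add, eval_mul, eval_C, eval_X]; ring
  have hloc : F ∈ polyFun (locNeg 1) := cpow_mul_mul_cpow_mem_polyFun 1 hmem m hpq _ hQ
  have hb₀loc : b₀ ∈ polyFun (locNeg 1) := cpow_mul_mul_cpow_mem_polyFun 1 ha₀ m hpq _ hQ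
  have hb₁loc : b₁ ∈ polyFun (locNeg 1) := by
    refine Submodule.add_mem _ (Submodule.add_mem _ ?_ ?_) ?_
    · simp only [hQ]
      refine eval_smul_polyFun _ ?_
      simp only [← hQ]
      exact cpow_mul_mul_cpow_mem_polyFun 1 hmem (m - 1)
        (fun t => by push_cast; linear_combination hpq t)
        (C (m / 2 : ℂ) - C ((n + 1) / 2 : ℂ) * X - 1) (fun t => by rw [hQ]; simp)
    · exact cpow_mul_mul_cpow_mem_polyFun 1 ha₁ m hpq _ hQ
    · simp only [hP]
      refine eval_smul_polyFun _ ?_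
      simp only [← hP]
      exact cpow_mul_mul_cpow_mem_polyFun 1 hmem (m - 1)
        (fun t => by push_cast; linear_combination hpq t) _ hQ
  have hF : F ∈ polyFun (Subalgebra.toSubmodule powNeg) := by
    refine polyFun_powNeg_of_locNeg hloc fun t ht => ?_
    refine mem_powNeg_of_rel_one (hrel1 t) (h₁_mul_of_weight (hKF t) (hwtF t)) ?_
      (apply_mem_of_mem_polyFun hb₁loc t) (apply_mem_of_mem_polyFun hloc t)
    -- The quantity `l + w` of the descent is a real number minus a positive real multiple of `t`,
    -- hence non-real whenever `t` is.
    have h1 : q t - 1 + -2 * ((m : ℂ) / 2) = ((-(m / 2) - 1 : ℝ) : ℂ) - ((n + 1) / 2 : ℝ) * t := by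
      simp only [hq]; push_cast; ring
    rw [h1, Complex.sub_im, Complex.ofReal_im, Complex.im_ofReal_mul, zero_sub, neg_ne_zero]
    exact mul_ne_zero (by positivity) ht
  have hFt : ∀ t, F t ∈ powNeg := apply_mem_of_mem_polyFun hF
  refine ⟨hF, ⟨η, b₀, ?_, hrel0⟩, ⟨b₁, ?_, fun t => ?_⟩, hwtF, fun t => ?_, fun t => ?_⟩
  · exact polyFun_powNeg_of_locNeg hb₀loc fun t _ =>
      chevalleyPair_zero.coeff_mem (hFt t) (apply_mem_of_mem_polyFun hb₀loc t) (hrel0 t)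
  · exact polyFun_powNeg_of_locNeg hb₁loc fun t _ =>
      chevalleyPair_one.coeff_mem (hFt t) (apply_mem_of_mem_polyFun hb₁loc t) (hrel1 t)
  · rw [hJ1]; exact hrel1 t
  · rw [weight_sandwich (d_mul_f₁pow (p t)) (hdeg t) (d_mul_f₁pow (q t))]
    congr 3
    linear_combination -hpq t
  · exact ((isUnit_cpow _ _).mul (hunit t)).mul (isUnit_cpow _ _)

-- The counterpart for the odd root, with `e₀` and `e₁` exchanging roles. Here `p + q = 2m`, so the
-- two powers of `f₀²` have exponents adding up to `m - 1`, and the two remaining factors `f₀` are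
-- placed next to `Y`.
open Polynomial in
theorem SingularFamily.sandwich_f₀ {m : ℤ} {n : ℕ}
    (hY : SingularFamily Y (fun t => (-(m : ℂ) + (n + 1) * t - 1) / 4) (m / 2) δ) :
    SingularFamily
      (fun t => f₀pow (m + (n + 1) * t) * Y t * f₀pow (m - (n + 1) * t))
      (fun t => ((m : ℂ) - (n + 1) * t - 1) / 4) (-(m / 2)) δ := by
  obtain ⟨hmem, ⟨η, a₀, ha₀, h₀rel⟩, ⟨a₁, ha₁, h₁rel⟩, hwt, hdeg, hunit⟩ := hY
  set p : ℂ → ℂ := fun t => m + (n + 1) * t with hp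
  set q : ℂ → ℂ := fun t => m - (n + 1) * t with hq
  set F : ℂ → PowAlg := fun t => f₀pow (p t) * Y t * f₀pow (q t) with hFdef
  set G : ℂ → PowAlg := fun x => cpow 0 ((x - 1) / 2) with hG
  set f : PowAlg := toPow f₀ with hf
  have hfm : f ∈ powNeg := toPow_mem_powNeg f₀_mem_negSub
  set b₀ : ℂ → PowAlg := fun t => G (p t) * Y t * f₀pow (q t) - η • (f₀pow (p t) * Y t * G (q t))
    - f₀pow (p t) * a₀ t * f₀pow (q t) with hb₀
  set b₁ : ℂ → PowAlg := fun t => f₀pow (p t) * a₁ t * f₀pow (q t) with hb₁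
  have hJ : ∀ t, 2 * (((m : ℂ) - (n + 1) * t - 1) / 4) = (q t - 1) / 2 :=
    fun t => by simp only [hq]; ring
  have hJ1 : ∀ t, (t - 3) / 2 - 2 * (((m : ℂ) - (n + 1) * t - 1) / 4)
      = (t - 3) / 2 - 2 * ((-(m : ℂ) + (n + 1) * t - 1) / 4) - -2 * -(q t / 2) :=
    fun t => by simp only [hq]; ring
  have hpq : ∀ t, p t + q t = 2 * m := fun t => by simp only [hp, hq]; ring
  have hpq' : ∀ t, (p t - 1) / 2 + (q t - 1) / 2 = (m - 1 : ℤ) := fun t => by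
    push_cast; linear_combination hpq t / 2
  have hwtF : ∀ t, toPow J₃ * F t = F t * (toPow J₃ + (-((m : ℂ) / 2)) • 1) := fun t => by
    rw [weight_sandwich (J₃_mul_f₀pow (p t)) (hwt t) (J₃_mul_f₀pow (q t))]
    congr 3
    linear_combination (-1 / 2) * hpq t
  have hrel0 : ∀ t, toPow e₀ * F t = η • (F t * toPow e₀)
      + b₀ t * (toPow h₀ - ((q t - 1) / 2) • 1) := by
    intro t
    refine mul_sandwich_odd (e₀_mul_f₀pow _) (e₀_mul_f₀pow _) ?_ ?_ ?_
    · rw [h₀_mul_of_weight (J₃_mul_f₀pow _)]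
      congr 3; ring
    · rw [h₀_mul_of_weight (hwt t), hpq]
      congr 3; ring
    · rw [h₀rel]
      congr 4
      simp only [hq]; ring
  have hrel1 : ∀ t, toPow e₁ * F t = (1 : ℂ) • (F t * toPow e₁)
      + b₁ t * (toPow h₁ - ((t - 3) / 2 - 2 * (((m : ℂ) - (n + 1) * t - 1) / 4)) • 1) := by
    intro t
    rw [hJ1]
    exact mul_sandwich_of_commute (commute_e₁_f₀pow _) (commute_e₁_f₀pow _)
      (h₁_mul_of_weight (commute_K_f₀pow _) (J₃_mul_f₀pow _)) (h₁rel t)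
  have hQ : ∀ t, (q t - 1) / 2 = (C ((m - 1) / 2 : ℂ) - C ((n + 1) / 2 : ℂ) * X).eval t := fun t => by
    simp only [hq, eval_sub, eval_mul, eval_C, eval_X]; ring
  have hYl : (fun t => f * Y t * 1) ∈ polyFun (Subalgebra.toSubmodule powNeg) :=
    polyFun_mul_const hmem hfm (one_mem _)
  have hYr : (fun t => 1 * Y t * f) ∈ polyFun (Subalgebra.toSubmodule powNeg) :=
    polyFun_mul_const hmem (one_mem _) hfm
  have hloc2 : ∀ {x : ℂ → PowAlg}, x ∈ polyFun (Subalgebra.toSubmodule powNeg) →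
      (fun t => f₀pow (p t) * x t * f₀pow (q t)) ∈ polyFun (locNeg 0) := by
    intro x hx
    convert cpow_mul_mul_cpow_mem_polyFun 0 (polyFun_mul_const hx hfm hfm) _ hpq' _ hQ using 2 with t
    rw [f₀pow_eq, f₀pow]; simp only [mul_assoc]; rfl
  have hloc : F ∈ polyFun (locNeg 0) := hloc2 hmem
  have hb₁loc : b₁ ∈ polyFun (locNeg 0) := hloc2 ha₁
  have hb₀loc : b₀ ∈ polyFun (locNeg 0) := by
    have hA : (fun t => G (p t) * Y t * f₀pow (q t)) ∈ polyFun (locNeg 0) := by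
      convert cpow_mul_mul_cpow_mem_polyFun 0 hYr _ hpq' _ hQ using 2 with t
      rw [f₀pow]; simp only [mul_assoc, one_mul]; rfl
    have hB : (fun t => f₀pow (p t) * Y t * G (q t)) ∈ polyFun (locNeg 0) := by
      convert cpow_mul_mul_cpow_mem_polyFun 0 hYl _ hpq' _ hQ using 2 with t
      rw [f₀pow_eq]; simp only [mul_assoc, one_mul]; rfl
    exact sub_mem (sub_mem hA (Submodule.smul_mem _ η hB)) (hloc2 ha₀)
  have hF : F ∈ polyFun (Subalgebra.toSubmodule powNeg) := by
    refine polyFun_powNeg_of_locNeg hloc fun t ht => ?_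
    refine mem_powNeg_of_rel_zero (hrel0 t) (h₀_mul_of_weight (hwtF t)) ?_
      (apply_mem_of_mem_polyFun hb₀loc t) (apply_mem_of_mem_polyFun hloc t)
    have h1 : (q t - 1) / 2 + 2 * -((m : ℂ) / 2)
        = ((-(m / 2) - 1 / 2 : ℝ) : ℂ) - ((n + 1) / 2 : ℝ) * t := by
      simp only [hq]; push_cast; ring
    rw [h1, Complex.sub_im, Complex.ofReal_im, Complex.im_ofReal_mul, zero_sub, neg_ne_zero]
    exact mul_ne_zero (by positivity) ht
  have hFt : ∀ t, F t ∈ powNeg := apply_mem_of_mem_polyFun hF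
  refine ⟨hF, ⟨η, b₀, ?_, fun t => ?_⟩, ⟨b₁, ?_, hrel1⟩, hwtF, fun t => ?_, fun t => ?_⟩
  · exact polyFun_powNeg_of_locNeg hb₀loc fun t _ =>
      chevalleyPair_zero.coeff_mem (hFt t) (apply_mem_of_mem_polyFun hb₀loc t) (hrel0 t)
  · rw [hJ]; exact hrel0 t
  · exact polyFun_powNeg_of_locNeg hb₁loc fun t _ =>
      chevalleyPair_one.coeff_mem (hFt t) (apply_mem_of_mem_polyFun hb₁loc t) (hrel1 t)
  · rw [weight_sandwich (d_mul_f₀pow (p t)) (hdeg t) (d_mul_f₀pow (q t))]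
    congr 3
    ring
  · exact ((isUnit_f₀pow _).mul (hunit t)).mul (isUnit_f₀pow _)

end Families
end AffineOsp
end

/-! ### Induction on the number of factors -/

noncomputable section
namespace AffineOsp
open Finsupp (linearCombination)
open Osp12 SuperBracket

section Products

theorem prod_map_range_add_two {A : Type} [Monoid A] (f : ℕ → A) (k : ℕ) :
    ((List.range (k + 2)).map f).prod
      = f 0 * ((List.range k).map fun i => f (i + 1)).prod * f (k + 1) := by
  rw [List.range_succ, List.map_append, List.prod_append, List.range_succ_eq_map, List.map_cons,
    List.prod_cons, List.map_map]
  simp [Function.comp_def]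

theorem mffPos_zero (m : ℤ) (t : ℂ) : mffPos m (0 : ℕ) t = f₀pow m := by
  simp [mffPos]

theorem mffNeg_zero (m : ℤ) (t : ℂ) : mffNeg (-m) (-((0 : ℕ) + 1)) t = f₁pow (m / 2) := by
  simp [mffNeg]

theorem mffPos_succ (m : ℤ) (n : ℕ) (t : ℂ) : mffPos m ((n + 1 : ℕ) : ℤ) t
    = f₀pow (m + (n + 1) * t) * mffNeg (-m) (-((n : ℤ) + 1)) t * f₀pow (m - (n + 1) * t) := by
  have h1 : 2 * ((n + 1 : ℕ) : ℤ).toNat + 1 = (2 * n + 1) + 2 := by omega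
  have h2 : (-2 * (-((n : ℤ) + 1)) - 1).toNat = 2 * n + 1 := by omega
  rw [mffPos, h1, prod_map_range_add_two, mffNeg, h2]
  congr 1
  · congr 1
    · rw [if_pos (by decide)]; congr 1; push_cast; ring
    · congr 1
      refine List.map_congr_left fun i _ => ?_
      by_cases hi : Even i
      · rw [if_pos hi, if_neg (by simpa [Nat.even_add_one] using hi)]
        congr 1; push_cast; ring
      · rw [if_neg hi, if_pos (by simpa [Nat.even_add_one] using hi)]
        congr 1; push_cast; ring
  · rw [if_pos (by simp [parity_simps])]
    congr 1; push_cast; ring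

theorem mffNeg_succ (m : ℤ) (n : ℕ) (t : ℂ) : mffNeg (-m) (-(((n + 1 : ℕ) : ℤ) + 1)) t
    = f₁pow ((m + (n + 1) * t) / 2) * mffPos m n t * f₁pow ((m - (n + 1) * t) / 2) := by
  have h1 : (-2 * (-(((n + 1 : ℕ) : ℤ) + 1)) - 1).toNat = (2 * n + 1) + 2 := by omega
  have h2 : 2 * (n : ℤ).toNat + 1 = 2 * n + 1 := by omega
  rw [mffNeg, h1, prod_map_range_add_two, mffPos, h2]
  congr 1
  · congr 1
    · rw [if_pos (by decide)]; congr 1; push_cast; ring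
    · congr 1
      refine List.map_congr_left fun i _ => ?_
      by_cases hi : Even i
      · rw [if_pos hi, if_neg (by simpa [Nat.even_add_one] using hi)]
        congr 1; push_cast; ring
      · rw [if_neg hi, if_pos (by simpa [Nat.even_add_one] using hi)]
        congr 1; push_cast; ring
  · rw [if_pos (by simp [parity_simps])]
    congr 1; push_cast; ring

/-- For odd positive `m` the single factor is an honest power `f₀ (f₀²)^r` with `m = 2r + 1`,
singular at `h₀ = r`. -/
theorem singularFamily_mffPos_zero {m : ℤ} (hm : 0 < m) (hodd : Odd m) :
    SingularFamily (mffPos m (0 : ℕ)) (fun t => ((m : ℂ) - (0 : ℕ) * t - 1) / 4) (-(m / 2)) 0 := by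
  obtain ⟨r, rfl⟩ : ∃ r : ℕ, m = 2 * r + 1 := by
    obtain ⟨r, hr⟩ := hodd
    exact ⟨r.toNat, by omega⟩
  rw [show mffPos (2 * r + 1) (0 : ℕ) = fun _ => f₀pow ((2 * r + 1 : ℤ) : ℂ) from
    funext (mffPos_zero _)]
  have hr : (((2 * r + 1 : ℤ) : ℂ) - 1) / 2 = r := by push_cast; ring
  have hmem : f₀pow ((2 * r + 1 : ℤ) : ℂ) ∈ Subalgebra.toSubmodule powNeg := by
    rw [f₀pow, hr]
    exact powNeg.mul_mem (toPow_mem_powNeg f₀_mem_negSub) (cpow_natCast_mem_powNeg 0 r)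
  refine ⟨const_mem_polyFun hmem, ⟨-1, fun _ => cpow 0 r,
    const_mem_polyFun (cpow_natCast_mem_powNeg 0 r), fun t => ?_⟩, ⟨0, zero_mem _, fun t => ?_⟩,
    fun t => J₃_mul_f₀pow _, fun t => d_mul_f₀pow _, fun t => isUnit_f₀pow _⟩
  · rw [e₀_mul_f₀pow, hr, show 2 * ((((2 * r + 1 : ℤ) : ℂ) - (0 : ℕ) * t - 1) / 4) = r by
      push_cast; ring]
    module
  · rw [(commute_e₁_f₀pow _).eq, Pi.zero_apply, zero_mul, add_zero, one_smul]

theorem singularFamily_mffNeg_zero {m : ℤ} (hm : 0 < m) (heven : Even m) :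
    SingularFamily (mffNeg (-m) (-((0 : ℕ) + 1)))
      (fun t => (-(m : ℂ) + ((0 : ℕ) + 1) * t - 1) / 4) (m / 2) (-(m / 2)) := by
  obtain ⟨r, rfl⟩ : ∃ r : ℕ, m = 2 * r := by
    obtain ⟨r, hr⟩ := heven
    exact ⟨r.toNat, by omega⟩
  have hr : ((2 * r : ℤ) : ℂ) / 2 = r := by push_cast; ring
  rw [show mffNeg (-(2 * r)) (-((0 : ℕ) + 1)) = fun _ => f₁pow r from
    funext fun t => by rw [mffNeg_zero, hr], hr]
  obtain ⟨s, rfl⟩ : ∃ s, r = s + 1 := ⟨r - 1, by omega⟩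
  refine ⟨const_mem_polyFun (cpow_natCast_mem_powNeg 1 _), ⟨1, 0, zero_mem _, fun t => ?_⟩,
    ⟨fun _ => ((s : ℂ) + 1) • cpow 1 s,
    const_mem_polyFun (powNeg.smul_mem (cpow_natCast_mem_powNeg 1 s) _), fun t => ?_⟩,
    fun t => J₃_mul_f₁pow _, fun t => d_mul_f₁pow _, fun t => isUnit_cpow _ _⟩
  · rw [f₁pow, (commute_e₀_cpow _).eq, Pi.zero_apply, zero_mul, add_zero, one_smul]
  · rw [f₁pow, e₁_mul_cpow, show (t - 3) / 2
      - 2 * ((-((2 * (s + 1 : ℕ) : ℤ) : ℂ) + ((0 : ℕ) + 1) * t - 1) / 4) = s by push_cast; ring]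
    push_cast
    rw [add_sub_cancel_right]
    simp only [mul_sub, mul_smul_comm, smul_mul_assoc, mul_one]
    module

/-- The two kinds of product are treated together because peeling off the outer factors turns each
kind into the other with `m` negated. The parity condition fixes which simple generator sits in the
middle: `f₀^m` for odd `m`, `f₁^(m/2)` for even `m`, so that the starting point has an integral
exponent. -/
theorem singularFamily_mff {m : ℤ} (hm : 0 < m) (n : ℕ) :
    (Odd (m + n) → SingularFamily (mffPos m n) (fun t => ((m : ℂ) - n * t - 1) / 4) (-(m / 2))
      (-(n * m / 2))) ∧
    (Even (m + n) → SingularFamily (mffNeg (-m) (-((n : ℤ) + 1)))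
      (fun t => (-(m : ℂ) + (n + 1) * t - 1) / 4) (m / 2) (-((n + 1) * m / 2))) := by
  induction n with
  | zero =>
    refine ⟨fun h => ?_, fun h => ?_⟩
    · have := singularFamily_mffPos_zero hm (by simpa using h)
      convert this using 1
      simp
    · have := singularFamily_mffNeg_zero hm (by simpa using h)
      convert this using 1
      simp
  | succ n ih =>
    refine ⟨fun h => ?_, fun h => ?_⟩
    · have h' : Even (m + n) := by
        rw [Int.odd_iff] at h
        rw [Int.even_iff]
        omega
      have := (ih.2 h').sandwich_f₀
      convert this using 1
      · funext t; exact mffPos_succ m n t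
      · funext t; push_cast; rfl
      · push_cast; rfl
    · have h' : Odd (m + n) := by
        rw [Nat.cast_succ, ← add_assoc] at h
        exact (Int.even_add_one.1 h |> Int.not_even_iff_odd.1)
      have := (ih.1 h').sandwich_f₁
      convert this using 1
      · funext t; exact mffNeg_succ m n t
      · funext t; push_cast; ring
      · push_cast; ring

end Products

/-! ### From families to singular vectors -/

section SingularVectors

/-- The positive part is generated by `j⁺_0` and `J⁻_1`: brackets first give all modes of degree
one, then those of degree `n + 1` from degrees `1` and `n`. No central term appears, as the degrees
never sum to zero. -/
theorem mode_smul_eq_zero {V : Type} [AddCommGroup V] [Module Env V] {v : V}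
    (h0 : mode jplus 0 • v = 0) (h1 : mode Jminus 1 • v = 0) (a : Osp12) {n : ℤ} (hn : 0 < n) :
    mode a n • v = 0 := by
  have hbr : ∀ (a b c : Osp12) (x : ℂ) (p q : ℤ), bracket a b = Pi.single c x → x ≠ 0 → p + q ≠ 0 →
      mode a p • v = 0 → mode b q • v = 0 → mode c (p + q) • v = 0 := by
    intro a b c x p q hb hx hpq ha hb'
    have h := mode_mul_mode a b p q
    have hs : ∑ c', bracket a b c' • mode c' (p + q) = x • mode c (p + q) := by
      rw [Finset.sum_eq_single c]
      · rw [hb, Pi.single_eq_same]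
      · intro c' _ hc; rw [hb, Pi.single_eq_of_ne hc, zero_smul]
      · intro hc; exact absurd (Finset.mem_univ c) hc
    rw [if_neg hpq, zero_smul, add_zero, hs] at h
    have h2 : mode c (p + q) = x⁻¹ • (mode a p * mode b q
        - koszulSign a b • (mode b q * mode a p)) := by rw [h, inv_smul_smul₀ hx]
    rw [h2, smul_eq_algebraMap_mul, smul_eq_algebraMap_mul, mul_smul, sub_smul, mul_smul, mul_smul,
      mul_smul, ha, hb', smul_zero, smul_zero, smul_zero, sub_zero, smul_zero]
  have j1 : mode jminus 1 • v = 0 := hbr jplus Jminus _ 1 0 1 rfl one_ne_zero (by decide) h0 h1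
  have J1 : mode Jthree 1 • v = 0 := hbr jplus jminus _ 2 0 1 rfl two_ne_zero (by decide) h0 j1
  have j2 : mode jplus 1 • v = 0 :=
    hbr Jthree jplus _ (1 / 2) 1 0 rfl (by norm_num) (by decide) J1 h0
  have hone : ∀ a, mode a 1 • v = 0 := by
    intro a
    cases a
    · exact hbr jplus jplus _ 2 0 1 rfl two_ne_zero (by decide) h0 j2
    · exact h1
    · exact J1
    · exact j2
    · exact j1
  have key : ∀ n : ℕ, ∀ a, mode a ((n : ℤ) + 1) • v = 0 := by
    intro n
    induction n with
    | zero => simpa using hone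
    | succ n ih =>
      have e : ((n + 1 : ℕ) : ℤ) + 1 = 1 + ((n : ℤ) + 1) := by push_cast; ring
      have hne : (1 : ℤ) + ((n : ℤ) + 1) ≠ 0 := by omega
      rw [e]
      intro a
      cases a
      · exact hbr jplus jplus _ 2 _ _ rfl two_ne_zero hne (hone _) (ih _)
      · exact hbr jminus jminus _ (-2) _ _ rfl (by norm_num) hne (hone _) (ih _)
      · exact hbr jplus jminus _ 2 _ _ rfl two_ne_zero hne (hone _) (ih _)
      · exact hbr Jthree jplus _ (1 / 2) _ _ rfl (by norm_num) hne (hone _) (ih _)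
      · exact hbr Jthree jminus _ (-1 / 2) _ _ rfl (by norm_num) hne (hone _) (ih _)
  obtain ⟨N, rfl⟩ : ∃ N : ℕ, n = N + 1 := ⟨(n - 1).toNat, by omega⟩
  exact key N a

instance : Nontrivial Env := by
  -- The trivial one-dimensional representation gives a ring homomorphism to the nontrivial ring
  -- `ℂ`.
  have h : affine.IsRep (fun _ => True) (fun _ => (0 : ℂ)) := by
    intro x y _ _
    simp [Finsupp.linearCombination_apply]
  exact RingHom.domain_nontrivial (envLift (fun _ => (0 : ℂ)) h).toRingHom

/-- The relations of the family are pulled back to `U` along the injective map and applied to the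
highest weight vector, where `e_i` and `h_i - l` vanish. The value `t = 2k + 3` is what turns the
level `(t - 3)/2` into `k`. -/
theorem SingularFamily.isSingularVector {F : ℂ → PowAlg} {J : ℂ → ℂ} {w δ : ℂ}
    (hF : SingularFamily F J w δ) (k : ℂ) {u : Env} (hu : toPow u = F (2 * k + 3)) :
    IsSingularVector k (J (2 * k + 3) + w) δ (u • hwv k (J (2 * k + 3))) := by
  set t := 2 * k + 3 with ht
  set j := J t with hj
  have hun : u ∈ negSub := by
    obtain ⟨u', hu', h⟩ := apply_mem_of_mem_polyFun hF.mem t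
    rwa [toPow_injective (hu.trans h.symm)]
  have hwt : J₃ * u = u * (J₃ + w • 1) := toPow_injective (by
    simpa only [map_mul, map_add, map_smul, map_one, hu] using hF.weight t)
  have hdeg : gen Gen.d * u = u * (gen Gen.d + δ • 1) := toPow_injective (by
    simpa only [map_mul, map_add, map_smul, map_one, hu] using hF.degree t)
  have hJ : J₃ • hwv k j = algebraMap ℂ Env j • hwv k j := by
    have := J₃_sub_smul_hwv k j
    rwa [sub_smul, sub_eq_zero] at this
  have hK : gen Gen.K • hwv k j = algebraMap ℂ Env k • hwv k j := by
    have := K_sub_smul_hwv k j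
    rwa [sub_smul, sub_eq_zero] at this
  have he₀ : e₀ • u • hwv k j = 0 := by
    obtain ⟨η, a, ha, hrel⟩ := hF.rel_zero
    obtain ⟨a', -, ha'⟩ := apply_mem_of_mem_polyFun ha t
    change toPow a' = a t at ha'
    have h : e₀ * u = algebraMap ℂ Env η * (u * e₀) + a' * (h₀ - (2 * j) • 1) := toPow_injective (by
      have := hrel t
      rw [← ha', ← hu] at this
      rw [← smul_eq_algebraMap_mul]
      simpa only [map_mul, map_add, map_sub, map_smul, map_one] using this)
    rw [← mul_smul, h, add_smul, mul_smul, mul_smul, mul_smul, e₀_smul_hwv, h₀_sub_smul_hwv,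
      smul_zero, smul_zero, smul_zero, add_zero]
  have he₁ : e₁ • u • hwv k j = 0 := by
    obtain ⟨a, ha, hrel⟩ := hF.rel_one
    obtain ⟨a', -, ha'⟩ := apply_mem_of_mem_polyFun ha t
    change toPow a' = a t at ha'
    have h : e₁ * u = u * e₁ + a' * (h₁ - (k - 2 * j) • 1) := toPow_injective (by
      have := hrel t
      rw [← ha', ← hu, one_smul, show (t - 3) / 2 = k by rw [ht]; ring] at this
      simpa only [map_mul, map_add, map_sub, map_smul, map_one] using this)
    rw [← mul_smul, h, add_smul, mul_smul, mul_smul, e₁_smul_hwv, h₁_sub_smul_hwv,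
      smul_zero, smul_zero, add_zero]
  have hj₀ : mode jplus 0 • u • hwv k j = 0 := by
    have : mode jplus 0 = algebraMap ℂ Env ((Real.sqrt 2 : ℝ) : ℂ) * e₀ := by
      rw [← smul_eq_algebraMap_mul, e₀, smul_inv_smul₀ sqrt_two_ne_zero]
    rw [this, mul_smul, he₀, smul_zero]
  refine ⟨fun h => ?_, fun a n hn => mode_smul_eq_zero hj₀ he₁ a hn, hj₀, ?_, ?_, ?_⟩
  · have h0 := hF.unit t
    rw [← hu, eq_zero_of_smul_hwv hun h, map_zero, isUnit_zero_iff] at h0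
    exact zero_ne_one (toPow_injective (by rw [map_zero, map_one, h0]))
  · change J₃ • u • hwv k j = _
    rw [← mul_smul, hwt, mul_smul, add_smul, hJ, ← add_smul, ← mul_smul, ← mul_smul,
      Algebra.smul_def, mul_one, ← map_add, Algebra.commutes]
  · rw [← mul_smul, commute_K, mul_smul, hK, ← mul_smul, ← mul_smul, Algebra.commutes]
  · rw [← mul_smul, hdeg, mul_smul, add_smul, d_smul_hwv, zero_add, ← mul_smul, ← mul_smul,
      Algebra.smul_def, mul_one, Algebra.commutes]

end SingularVectors
end AffineOsp
end

theorem mainTheorem4 :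
    Function.Injective AffineOsp.toPow ∧
    (∀ m s : ℤ, Odd (m + s) → 0 < m → 0 ≤ s →
      (∀ t : ℂ, ∃ u : AffineOsp.Env, AffineOsp.toPow u = AffineOsp.mffPos m s t) ∧
      ∀ k : ℂ, 2 * k + 3 ≠ 0 → ∀ u : AffineOsp.Env,
        AffineOsp.toPow u = AffineOsp.mffPos m s (2 * k + 3) →
        AffineOsp.IsSingularVector k (AffineOsp.isospin (2 * k + 3) (-m) s)
          (-((m : ℂ) * (s : ℂ) / 2))
          (u • AffineOsp.hwv k (AffineOsp.isospin (2 * k + 3) m s))) ∧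
    (∀ m s : ℤ, Odd (m + s) → m < 0 → s < 0 →
      (∀ t : ℂ, ∃ u : AffineOsp.Env, AffineOsp.toPow u = AffineOsp.mffNeg m s t) ∧
      ∀ k : ℂ, 2 * k + 3 ≠ 0 → ∀ u : AffineOsp.Env,
        AffineOsp.toPow u = AffineOsp.mffNeg m s (2 * k + 3) →
        AffineOsp.IsSingularVector k (AffineOsp.isospin (2 * k + 3) (-m) s)
          (-((m : ℂ) * (s : ℂ) / 2))
          (u • AffineOsp.hwv k (AffineOsp.isospin (2 * k + 3) m s))) := by
  refine ⟨AffineOsp.toPow_injective, fun m s hodd hm hs => ?_, fun m s hodd hm hs => ?_⟩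
  · obtain ⟨n, rfl⟩ := Int.eq_ofNat_of_zero_le hs
    have hF := (AffineOsp.singularFamily_mff hm n).1 hodd
    refine ⟨fun t => ?_, fun k _ u hu => ?_⟩
    · obtain ⟨u, -, hu⟩ := AffineOsp.apply_mem_of_mem_polyFun hF.mem t
      exact ⟨u, hu⟩
    · have h := hF.isSingularVector k hu
      have h1 : AffineOsp.isospin (2 * k + 3) m n = ((m : ℂ) - n * (2 * k + 3) - 1) / 4 := by
        simp [AffineOsp.isospin]
      have h2 : AffineOsp.isospin (2 * k + 3) (-m) n
          = ((m : ℂ) - n * (2 * k + 3) - 1) / 4 + -(m / 2) := by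
        simp only [AffineOsp.isospin]; push_cast; ring
      rw [h1, h2, show -((m : ℂ) * ((n : ℤ) : ℂ) / 2) = -(n * m / 2) by push_cast; ring]
      exact h
  -- The substitution `s = -(n + 1)`, `m = -M` brings the negative case to the indexing of
  -- `singularFamily_mff`; the sign shift turns `m + s` odd into `M + n` even.
  · obtain ⟨n, hn⟩ := Int.eq_ofNat_of_zero_le (show 0 ≤ -s - 1 by omega)
    obtain rfl : s = -((n : ℤ) + 1) := by omega
    obtain ⟨M, rfl⟩ : ∃ M, m = -M := ⟨-m, by omega⟩
    have hF := (AffineOsp.singularFamily_mff (m := M) (by omega) n).2 (by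
      rw [Int.odd_iff] at hodd
      rw [Int.even_iff]
      omega)
    refine ⟨fun t => ?_, fun k _ u hu => ?_⟩
    · obtain ⟨u, -, hu⟩ := AffineOsp.apply_mem_of_mem_polyFun hF.mem t
      exact ⟨u, hu⟩
    · have h := hF.isSingularVector k hu
      have h1 : AffineOsp.isospin (2 * k + 3) (-M) (-((n : ℤ) + 1))
          = (-(M : ℂ) + (n + 1) * (2 * k + 3) - 1) / 4 := by
        simp only [AffineOsp.isospin]; push_cast; ring
      have h2 : AffineOsp.isospin (2 * k + 3) (- -M) (-((n : ℤ) + 1))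
          = (-(M : ℂ) + (n + 1) * (2 * k + 3) - 1) / 4 + M / 2 := by
        simp only [AffineOsp.isospin]; push_cast; ring
      rw [h1, h2, show -(((-M : ℤ) : ℂ) * ((-((n : ℤ) + 1) : ℤ) : ℂ) / 2)
        = -((n + 1) * M / 2) by push_cast; ring]
      exact h
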